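/- Let $n\ge 1$. Write $[n+1]=\{1,\dots,n+1\}$ and let $e_1,\dots,e_{n+1}$ be the standard basis of $\mathbb{R}^{n+1}$. All graphs are simple graphs on the vertex set $[n+1]$ (unless they are subtrees of such graphs), and an edge $\{i,j\}$ with $i<j$ is written $(i,j)$. **Definitions.** A graph is *noncrossing* if it has no edges $(i,k),(j,l)$ with $i<j<k<l$, and *alternating* if it has no edges $(i,j),(j,k)$ with $i<j<k$. The *transitive closure* $\overline G$ of $G$ has the edges $(i,j)$, $i<j$, such that $i$ and $j$ are joined by an increasing path of $G$. A *spanning forest* of $G$ is an acyclic graph on all of $[n+1]$ whose edges are edges of $G$; a *spanning tree* is a connected one. The *root polytope* of $G$ is $$\mathcal P(G)=\mathrm{ConvHull}\big(0,\ e_i-e_j : 1\le i<j\le n+1\big)\ \cap\ \Big\{\sum_{(i,j)\in E(G)} c_{ij}(e_i-e_j) : c_{ij}\ge 0\Big\}.$$ Interiors of polytopes are relative interiors. Volume is $n$-dimensional volume in the hyperplane $x_1+\dots+x_{n+1}=0$, normalized so that a fundamental parallelepiped of the lattice of its integer points has volume $1$. For $t\in\mathbb{Z}_{\ge 0}$ let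 $L_{\mathcal P}(t)=\#(t\mathcal P\cap\mathbb{Z}^{n+1})$. The *pseudo-components* of a noncrossing tree $T$ (with at least one edge, on a finite set of integers) are defined inductively. The simple path $P$ in $T$ from its least to its greatest vertex is a pseudo-component. The graph $T\setminus P$ is an edge-disjoint union of trees (each with at least one edge) such that every vertex of $P$ lying in one of these trees is the least or the greatest vertex of that tree; take such a decomposition into the least possible number of trees. The pseudo-components of these trees are the other pseudo-components of $T$. A pseudo-component with endpoints $i<j$ is said to be on $[i,j]$; it is *left* if $T$ has no edge $(s,i)$ with $s<i$, and *right* if $T$ has no edge $(j,s)$ with $j<s$. **Theorem.** Let $T$ be a noncrossing tree on $[n+1]$, let $T_1,\dots,T_k$ be the distinct noncrossing alternating spanning trees of $\overline T$, and let $f_T=k$. Let $\mathcal F_T$ be the set of noncrossing alternating spanning forests $F$ of $\overline T$ that contain the edge $(1,n+1)$, contain an edge $(i_1,j)$ with $i_1\le i$ for each right pseudo-component of $T$ on $[i,j]$, and contain an edge $(i,j_1)$ with $j\le j_1$ for each left pseudo-component of $T$ on $[i,j]$. Let $f_{T,i}$ be the number of $F\in\mathcal F_T$ with exactly $i$ edges.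 1. $\mathcal P(T_1),\dots,\mathcal P(T_k)$ are $n$-dimensional simplices with pairwise disjoint interiors, and their union is $\mathcal P(T)$. 2. They form a triangulation of $\mathcal P(T)$: the origin is a vertex of each of them, all their vertices are vertices of $\mathcal P(T)$, and the intersection of any nonempty subfamily of them is $\mathcal P(G)$, where $G$ is the graph of the common edges of the corresponding trees, and is a face of each of its members. 3. For $F\in\mathcal F_T$, $\mathcal P(F)$ is a simplex whose dimension is the number of edges of $F$. The intersections of nonempty subfamilies of $\mathcal P(T_1),\dots,\mathcal P(T_k)$ that meet the interior of $\mathcal P(T)$ are exactly the simplices $\mathcal P(F)$ with $F\in\mathcal F_T$. 4. $\displaystyle \mathrm{vol}\,\mathcal P(T)=\frac{f_T}{n!}=\frac{f_{T,n}}{n!}$. 5. For all integers $t\ge 0$, $\displaystyle L_{\mathcal P(T)}(t)=(-1)^n\sum_{i=0}^{n}(-1)^i f_{T,i}\binom{t+i}{i}$. -/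

import Mathlib

namespace RootPolytope

/-! ### Graphs on a linearly ordered vertex set

The vertex set `[n+1]` is `Fin (n + 1)`, so that the vertices `1` and `n + 1` are `0` and
`Fin.last n`. A spanning subgraph of `G` is a graph `H ≤ G` on the same vertex type. -/

/-- No edges `(i, k)`, `(j, l)` with `i < j < k < l`. -/
def IsNoncrossing {m : ℕ} (G : SimpleGraph (Fin m)) : Prop :=
  ∀ i j k l : Fin m, i < j → j < k → k < l → ¬ (G.Adj i k ∧ G.Adj j l)

/-- No edges `(i, j)`, `(j, k)` with `i < j < k`. -/
def IsAlternating {m : ℕ} (G : SimpleGraph (Fin m)) : Prop :=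
  ∀ i j k : Fin m, i < j → j < k → ¬ (G.Adj i j ∧ G.Adj j k)

/-- There is an increasing path from `i` to `j`, with at least one edge, in `G`. -/
def IncreasingRoute {m : ℕ} (G : SimpleGraph (Fin m)) (i j : Fin m) : Prop :=
  Relation.TransGen (fun a b => a < b ∧ G.Adj a b) i j

theorem IncreasingRoute.lt {m : ℕ} {G : SimpleGraph (Fin m)} {i j : Fin m}
    (h : IncreasingRoute G i j) : i < j := by
  unfold IncreasingRoute at h
  induction h with
  | single h => exact h.1
  | tail _ h ih => exact ih.trans h.1

/-- The transitive closure of `G`: the edges are the pairs `(i, j)`, `i < j`, joined by an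
increasing path of `G`. -/
def transClosure {m : ℕ} (G : SimpleGraph (Fin m)) : SimpleGraph (Fin m) where
  Adj i j := IncreasingRoute G i j ∨ IncreasingRoute G j i
  symm := ⟨fun _ _ h => h.symm⟩
  loopless := ⟨fun _ h => h.elim (fun h => lt_irrefl _ h.lt) (fun h => lt_irrefl _ h.lt)⟩

/-- The noncrossing alternating spanning trees of the transitive closure of `T`. -/
def ncAltTrees {m : ℕ} (T : SimpleGraph (Fin m)) : Set (SimpleGraph (Fin m)) :=
  {S | S ≤ transClosure T ∧ S.IsTree ∧ IsNoncrossing S ∧ IsAlternating S}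

/-! ### Pseudo-components

Trees on subsets of the vertex set, with at least one edge, are represented by their edges: the
vertex set of such a tree `H` is `H.support`. -/

/-- The edges of `H` form a tree (with at least one edge) on the vertex set `H.support`. -/
def IsSubtree {m : ℕ} (H : SimpleGraph (Fin m)) : Prop :=
  (H.induce H.support).IsTree

/-- `P` is the simple path of `H` from the least vertex `i` of `H` to its greatest vertex `j`. -/
def IsMainPath {m : ℕ} (H P : SimpleGraph (Fin m)) (i j : Fin m) : Prop :=
  IsLeast H.support i ∧ IsGreatest H.support j ∧
    ∃ p : H.Walk i j, p.IsPath ∧ P = SimpleGraph.fromEdgeSet {e | e ∈ p.edges}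

/-- `𝒟` is a set of edge-disjoint trees with union `H \ P`, such that every vertex of `P` that
belongs to one of these trees is its least or its greatest vertex. -/
def IsDecomposition {m : ℕ} (H P : SimpleGraph (Fin m)) (𝒟 : Set (SimpleGraph (Fin m))) : Prop :=
  (∀ D ∈ 𝒟, IsSubtree D) ∧ 𝒟.PairwiseDisjoint id ∧ sSup 𝒟 = H \ P ∧
    ∀ D ∈ 𝒟, ∀ v ∈ P.support, v ∈ D.support → IsLeast D.support v ∨ IsGreatest D.support v

/-- A decomposition into the least possible number of trees. -/
def IsMinDecomposition {m : ℕ} (H P : SimpleGraph (Fin m))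
    (𝒟 : Set (SimpleGraph (Fin m))) : Prop :=
  IsDecomposition H P 𝒟 ∧ ∀ 𝒟', IsDecomposition H P 𝒟' → 𝒟.ncard ≤ 𝒟'.ncard

/-- `IsPseudoComponent H Q i j`: the path `Q` is a pseudo-component of `H`, on `[i, j]`. -/
inductive IsPseudoComponent {m : ℕ} :
    SimpleGraph (Fin m) → SimpleGraph (Fin m) → Fin m → Fin m → Prop
  | main {H P : SimpleGraph (Fin m)} {i j : Fin m} :
      IsMainPath H P i j → IsPseudoComponent H P i j
  | sub {H P D Q : SimpleGraph (Fin m)} {𝒟 : Set (SimpleGraph (Fin m))} {i j a b : Fin m} :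
      IsMainPath H P i j → IsMinDecomposition H P 𝒟 → D ∈ 𝒟 →
        IsPseudoComponent D Q a b → IsPseudoComponent H Q a b

/-- `Q` is a left pseudo-component of `T`, on `[i, j]`. -/
def IsLeftPseudoComponent {m : ℕ} (T Q : SimpleGraph (Fin m)) (i j : Fin m) : Prop :=
  IsPseudoComponent T Q i j ∧ ∀ s, s < i → ¬ T.Adj s i

/-- `Q` is a right pseudo-component of `T`, on `[i, j]`. -/
def IsRightPseudoComponent {m : ℕ} (T Q : SimpleGraph (Fin m)) (i j : Fin m) : Prop :=
  IsPseudoComponent T Q i j ∧ ∀ s, j < s → ¬ T.Adj j s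

/-- The noncrossing alternating spanning forests of the transitive closure of `T` that contain the
edge `(1, n + 1)` and satisfy the conditions at the left and right pseudo-components of `T`. -/
def canonicalForests {n : ℕ} (T : SimpleGraph (Fin (n + 1))) :
    Set (SimpleGraph (Fin (n + 1))) :=
  {F | F ≤ transClosure T ∧ F.IsAcyclic ∧ IsNoncrossing F ∧ IsAlternating F ∧
    F.Adj 0 (Fin.last n) ∧
    (∀ Q i j, IsRightPseudoComponent T Q i j → ∃ i₁, i₁ ≤ i ∧ F.Adj i₁ j) ∧
    (∀ Q i j, IsLeftPseudoComponent T Q i j → ∃ j₁, j ≤ j₁ ∧ F.Adj i j₁)}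

/-- `f_{T, k}`: the number of canonical forests with `k` edges. -/
noncomputable def numForests {n : ℕ} (T : SimpleGraph (Fin (n + 1))) (k : ℕ) : ℕ :=
  {F | F ∈ canonicalForests T ∧ F.edgeSet.ncard = k}.ncard

/-! ### Root polytopes -/

/-- The vector `e_i - e_j`. -/
def root {n : ℕ} (i j : Fin (n + 1)) : Fin (n + 1) → ℝ :=
  Pi.single i 1 - Pi.single j 1

/-- The full root polytope, the convex hull of the origin and all `e_i - e_j` with `i < j`. -/
def fullPolytope (n : ℕ) : Set (Fin (n + 1) → ℝ) :=
  convexHull ℝ ({0} ∪ {v | ∃ i j : Fin (n + 1), i < j ∧ v = root i j})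

/-- The cone generated by the vectors `e_i - e_j` with `(i, j)` an edge of `G`, `i < j`. -/
def cone {n : ℕ} (G : SimpleGraph (Fin (n + 1))) : PointedCone ℝ (Fin (n + 1) → ℝ) :=
  PointedCone.hull ℝ {v | ∃ i j : Fin (n + 1), i < j ∧ G.Adj i j ∧ v = root i j}

/-- The root polytope `P(G)`. -/
def polytope {n : ℕ} (G : SimpleGraph (Fin (n + 1))) : Set (Fin (n + 1) → ℝ) :=
  fullPolytope n ∩ (cone G : Set (Fin (n + 1) → ℝ))

/-- `S` is a `d`-dimensional simplex. -/
def IsSimplex {n : ℕ} (d : ℕ) (S : Set (Fin (n + 1) → ℝ)) : Prop :=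
  ∃ s : Affine.Simplex ℝ (Fin (n + 1) → ℝ) d, S = convexHull ℝ (Set.range s.points)

/-- The `n`-dimensional volume of a subset `S` of the hyperplane `x_1 + ⋯ + x_{n+1} = 0`,
normalized with respect to the lattice of integer points of that hyperplane: Lebesgue measure in
the chart `y ↦ (y_1, …, y_n, -(y_1 + ⋯ + y_n))`, which is a linear isomorphism of `ℝⁿ` onto the
hyperplane and maps `ℤⁿ` onto the integer points. -/
noncomputable def relVolume {n : ℕ} (S : Set (Fin (n + 1) → ℝ)) : ENNReal :=
  MeasureTheory.volume {y : Fin n → ℝ | Fin.snoc (α := fun _ => ℝ) y (-∑ i, y i) ∈ S}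

open scoped Pointwise in
/-- The integer points of the dilate `t S`. -/
def latticePoints {n : ℕ} (S : Set (Fin (n + 1) → ℝ)) (t : ℕ) : Set (Fin (n + 1) → ℝ) :=
  {x | x ∈ (t : ℝ) • S ∧ ∀ i, ∃ z : ℤ, x i = z}

end RootPolytope

/-! ### Combinations of roots, heights, and uniqueness of noncrossing alternating representations.
-/

namespace RootPolytope

open Finset

variable {n : ℕ}

/-! Two functions of a vector carry the proof. The first is `height`, which on vectors of coordinate
sum zero is half the ℓ¹ norm. Over an alternating graph a nonnegative combination of roots has no
cancellation, so its height is its total weight; hence `polytope G` is the part of `cone G` of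
height at most 1 (`mem_polytope_iff`). The second is `prefixSum`: at `k` it gives the total weight
of the pairs that straddle the cut between the vertices `k - 1` and `k`.

For nonnegative noncrossing alternating weights, the weight of the pairs passing over a whole range
of cuts is the minimum of the prefix sums on that range (`nestSum_eq_minPrefix`). Second differences
of these minima recover the weights, so the representation is unique and continuous in the vector
(`ncWeight`). It exists because a representation maximizing `∑ d (i, j) (j - i)²` admits no
uncrossing move and no transitivity move (`exists_isNCAlt_rep`); for a noncrossing tree `T` these
moves stay inside the transitive closure. So the cones of the noncrossing alternating subgraphs of
the closure form a simplicial fan filling `cone T`, and a generic perturbation shows that its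
maximal cones come from trees (`exists_ncAltTree_of_mem_cone`). This gives the triangulation.

A vector of `cone T` of height less than 1 is interior to `polytope T` when all its `T`-coefficients
are positive. Removing the outermost edges of an interval splits it into smaller intervals, the
supports of the pseudo-components, and along this recursion each coefficient is a difference of two
prefix sums. Each edge demanded of a canonical forest is also equivalent to inequalities between
prefix sums. Matching the two descriptions gives `mem_canonicalForests_iff`, and with it the
description of the interior faces.

Coefficients with respect to a tree are partial sums of coordinates, hence integral on lattice
points; so each simplex is unimodular, of volume `1 / n!`. The integer points in the interior of
`cone T` of height at most `N`, sorted by canonical forest, number `∑ f_i (N choose i)`. Replacing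
`(i, j), (j, k)` by pairs `(i, k)` subdivides the closed and the open cone in parallel into
half-open unimodular simplices (`exists_weights_reciprocity`), and the substitution `N ↦ -N - 1`
turns the interior count into the Ehrhart formula (`sum_choose_reciprocity`). -/

/-- The linear combination `∑ d (i, j) • (e_i - e_j)`. -/
noncomputable def comb : (Fin (n + 1) × Fin (n + 1) → ℝ) →ₗ[ℝ] (Fin (n + 1) → ℝ) :=
  Fintype.linearCombination ℝ (fun p => root p.1 p.2)

/-- The weights `d` are supported on the edges `(i, j)`, `i < j`, of `G`. -/
def SupportedOn (d : Fin (n + 1) × Fin (n + 1) → ℝ) (G : SimpleGraph (Fin (n + 1))) : Prop :=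
  ∀ p, d p ≠ 0 → p.1 < p.2 ∧ G.Adj p.1 p.2

/-- Noncrossing alternating graphs. -/
def IsNCAlt {m : ℕ} (G : SimpleGraph (Fin m)) : Prop := IsNoncrossing G ∧ IsAlternating G

/-- The sum of the positive parts of the coordinates. -/
noncomputable def height (x : Fin (n + 1) → ℝ) : ℝ := ∑ v, max (x v) 0

/-- The sum of the coordinates with index less than `k`. -/
noncomputable def prefixSum (x : Fin (n + 1) → ℝ) (k : ℕ) : ℝ :=
  ∑ v ∈ univ.filter (fun v : Fin (n + 1) => v.val < k), x v

theorem comb_apply (d : Fin (n + 1) × Fin (n + 1) → ℝ) :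
    comb d = ∑ p, d p • root p.1 p.2 := by
  simp [comb, Fintype.linearCombination_apply]

theorem root_apply (i j v : Fin (n + 1)) :
    root i j v = (if v = i then 1 else 0) - (if v = j then 1 else 0) := by
  simp [root, Pi.single_apply]

theorem sum_root (A : Finset (Fin (n + 1))) (i j : Fin (n + 1)) :
    ∑ v ∈ A, root i j v = (if i ∈ A then 1 else 0) - (if j ∈ A then 1 else 0) := by
  simp [root_apply, Finset.sum_sub_distrib]

theorem sum_comb (A : Finset (Fin (n + 1))) (d : Fin (n + 1) × Fin (n + 1) → ℝ) :
    ∑ v ∈ A, comb d v =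
      ∑ p, d p * ((if p.1 ∈ A then 1 else 0) - (if p.2 ∈ A then 1 else 0)) := by
  simp_rw [comb_apply, Finset.sum_apply, Pi.smul_apply, smul_eq_mul]
  rw [Finset.sum_comm]
  refine Finset.sum_congr rfl fun p _ => ?_
  rw [← sum_root A, Finset.mul_sum]

theorem comb_single (p : Fin (n + 1) × Fin (n + 1)) (c : ℝ) :
    comb (Pi.single p c) = c • root p.1 p.2 := by
  simp [comb]

theorem sum_comb_univ (d : Fin (n + 1) × Fin (n + 1) → ℝ) : ∑ v, comb d v = 0 := by
  simp [sum_comb]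

theorem prefixSum_zero (x : Fin (n + 1) → ℝ) : prefixSum x 0 = 0 := by simp [prefixSum]

theorem prefixSum_last (x : Fin (n + 1) → ℝ) : prefixSum x (n + 1) = ∑ v, x v := by
  unfold prefixSum
  rw [Finset.filter_true_of_mem]
  intro v _; exact v.2

/-- A root has entry 1 at its left end and -1 at its right end, so only pairs separated by the cut
survive. -/
theorem prefixSum_comb {d : Fin (n + 1) × Fin (n + 1) → ℝ} (hd : ∀ p, d p ≠ 0 → p.1 < p.2)
    (k : ℕ) :
    prefixSum (comb d) k =
      ∑ p ∈ univ.filter (fun p : Fin (n + 1) × Fin (n + 1) => p.1.val < k ∧ k ≤ p.2.val), d p := by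
  unfold prefixSum
  rw [sum_comb, Finset.sum_filter]
  refine Finset.sum_congr rfl fun p _ => ?_
  by_cases hp : d p = 0
  · simp [hp]
  · have := hd p hp
    rw [Fin.lt_def] at this
    simp only [Finset.mem_filter, Finset.mem_univ, true_and]
    split_ifs <;> first | omega | simp

theorem SupportedOn.mono {d : Fin (n + 1) × Fin (n + 1) → ℝ} {G H : SimpleGraph (Fin (n + 1))}
    (h : SupportedOn d G) (hGH : G ≤ H) : SupportedOn d H :=
  fun p hp => ⟨(h p hp).1, hGH (h p hp).2⟩

theorem SupportedOn.add {d d' : Fin (n + 1) × Fin (n + 1) → ℝ} {G : SimpleGraph (Fin (n + 1))}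
    (h : SupportedOn d G) (h' : SupportedOn d' G) : SupportedOn (d + d') G := by
  intro p hp
  by_cases h0 : d p = 0
  · exact h' p (by simpa [h0] using hp)
  · exact h p h0

theorem SupportedOn.smul {d : Fin (n + 1) × Fin (n + 1) → ℝ} {G : SimpleGraph (Fin (n + 1))}
    (h : SupportedOn d G) (c : ℝ) : SupportedOn (c • d) G := by
  intro p hp
  exact h p (fun h0 => hp (by simp [h0]))

theorem SupportedOn.sub {d d' : Fin (n + 1) × Fin (n + 1) → ℝ} {G : SimpleGraph (Fin (n + 1))}
    (h : SupportedOn d G) (h' : SupportedOn d' G) : SupportedOn (d - d') G := by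
  intro p hp
  by_cases h0 : d p = 0
  · exact h' p (fun h1 => hp (by simp [h0, h1]))
  · exact h p h0

theorem supportedOn_zero (G : SimpleGraph (Fin (n + 1))) :
    SupportedOn (0 : Fin (n + 1) × Fin (n + 1) → ℝ) G := fun _ hp => absurd rfl hp

theorem supportedOn_single {G : SimpleGraph (Fin (n + 1))} {p : Fin (n + 1) × Fin (n + 1)}
    (h : p.1 < p.2) (hG : G.Adj p.1 p.2) (c : ℝ) : SupportedOn (Pi.single p c) G := by
  intro q hq
  have : q = p := by
    by_contra hne
    exact hq (by simp [hne])
  subst this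
  exact ⟨h, hG⟩

theorem mem_cone_iff {G : SimpleGraph (Fin (n + 1))} {x : Fin (n + 1) → ℝ} :
    x ∈ cone G ↔ ∃ d, 0 ≤ d ∧ SupportedOn d G ∧ comb d = x := by
  constructor
  · intro hx
    unfold cone PointedCone.hull at hx
    induction hx using Submodule.span_induction with
    | mem x h =>
      obtain ⟨i, j, hij, hG, rfl⟩ := h
      refine ⟨Pi.single (i, j) 1, ?_, supportedOn_single hij hG 1, by simp [comb_single]⟩
      exact Pi.single_nonneg.2 zero_le_one
    | zero => exact ⟨0, le_refl _, supportedOn_zero G, by simp⟩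
    | add x y _ _ hx hy =>
      obtain ⟨d, h1, h2, rfl⟩ := hx
      obtain ⟨d', h1', h2', rfl⟩ := hy
      exact ⟨d + d', add_nonneg h1 h1', h2.add h2', by simp⟩
    | smul a x _ hx =>
      obtain ⟨d, h1, h2, rfl⟩ := hx
      exact ⟨(a : ℝ) • d, smul_nonneg a.2 h1, h2.smul _, by rw [map_smul]; rfl⟩
  · rintro ⟨d, h1, h2, rfl⟩
    rw [comb_apply]
    refine Submodule.sum_mem _ fun p _ => ?_
    by_cases hp : d p = 0
    · simp [hp]
    · have := Submodule.smul_mem (cone G) (⟨d p, h1 p⟩ : {c : ℝ // 0 ≤ c})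
        (Submodule.subset_span ⟨p.1, p.2, (h2 p hp).1, (h2 p hp).2, rfl⟩)
      exact this

theorem comb_mem_cone {G : SimpleGraph (Fin (n + 1))} {d : Fin (n + 1) × Fin (n + 1) → ℝ}
    (h : 0 ≤ d) (h' : SupportedOn d G) : comb d ∈ cone G := mem_cone_iff.2 ⟨d, h, h', rfl⟩

theorem cone_mono {G H : SimpleGraph (Fin (n + 1))} (h : G ≤ H) : cone G ≤ cone H := by
  intro x hx
  obtain ⟨d, h1, h2, rfl⟩ := mem_cone_iff.1 hx
  exact comb_mem_cone h1 (h2.mono h)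

/-! ### Height -/

theorem height_smul {c : ℝ} (hc : 0 ≤ c) (x : Fin (n + 1) → ℝ) :
    height (c • x) = c * height x := by
  unfold height
  rw [Finset.mul_sum]
  refine Finset.sum_congr rfl fun v _ => ?_
  rw [Pi.smul_apply, smul_eq_mul, mul_max_of_nonneg _ _ hc, mul_zero]

theorem height_add_le (x y : Fin (n + 1) → ℝ) : height (x + y) ≤ height x + height y := by
  unfold height
  rw [← Finset.sum_add_distrib]
  refine Finset.sum_le_sum fun v _ => ?_
  have h1 := le_max_left (x v) 0
  have h2 := le_max_left (y v) 0
  have h3 := le_max_right (x v) 0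
  have h4 := le_max_right (y v) 0
  rw [Pi.add_apply]
  exact max_le (by linarith) (by linarith)

theorem height_nonneg (x : Fin (n + 1) → ℝ) : 0 ≤ height x :=
  Finset.sum_nonneg fun _ _ => le_max_right _ _

theorem continuous_height : Continuous (height (n := n)) := by
  unfold height
  fun_prop

theorem height_root {i j : Fin (n + 1)} (h : i ≠ j) : height (root i j) = 1 := by
  unfold height
  rw [Finset.sum_eq_single i]
  · simp [root_apply, h]
  · intro v _ hv
    simp only [root_apply, hv, if_false]
    split_ifs <;> simp
  · simp

theorem comb_eq_sub (d : Fin (n + 1) × Fin (n + 1) → ℝ) (v : Fin (n + 1)) :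
    comb d v = ∑ j, d (v, j) - ∑ i, d (i, v) := by
  have := sum_comb {v} d
  rw [Finset.sum_singleton] at this
  rw [this]
  simp only [mul_sub, Finset.sum_sub_distrib, Finset.mem_singleton, mul_ite, mul_one, mul_zero]
  congr 1
  · rw [Fintype.sum_prod_type, Finset.sum_eq_single v]
    · simp
    · intro b _ hb; simp [hb]
    · simp
  · rw [Fintype.sum_prod_type_right, Finset.sum_eq_single v]
    · simp
    · intro b _ hb; simp [hb]
    · simp

/-- In an alternating graph all edges at a vertex go to the same side. Hence the positive part of a
coordinate is exactly the weight leaving that vertex to the right. -/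
theorem height_comb {d : Fin (n + 1) × Fin (n + 1) → ℝ} {G : SimpleGraph (Fin (n + 1))}
    (h : 0 ≤ d) (hd : SupportedOn d G) (hG : IsAlternating G) :
    height (comb d) = ∑ p, d p := by
  rw [Fintype.sum_prod_type]
  refine Finset.sum_congr rfl fun v _ => ?_
  rw [comb_eq_sub]
  by_cases hv : ∃ j, d (v, j) ≠ 0
  · obtain ⟨j, hj⟩ := hv
    have h0 : ∑ i, d (i, v) = 0 := by
      refine Finset.sum_eq_zero fun i _ => ?_
      by_contra hi
      exact hG i v j (hd _ hi).1 (hd _ hj).1 ⟨(hd _ hi).2, (hd _ hj).2⟩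
    rw [h0, sub_zero]
    exact max_eq_left (Finset.sum_nonneg fun j _ => h _)
  · push Not at hv
    have h0 : ∑ j, d (v, j) = 0 := Finset.sum_eq_zero fun i _ => hv i
    have h1 : 0 ≤ ∑ i, d (i, v) := Finset.sum_nonneg fun j _ => h _
    rw [h0, max_eq_right (by linarith)]

/-! ### Noncrossing alternating weights -/

/-- The total weight of the pairs `(a, b)` with `a < p` and `q ≤ b`. -/
noncomputable def nestSum (d : Fin (n + 1) × Fin (n + 1) → ℝ) (p q : ℕ) : ℝ :=
  ∑ e ∈ univ.filter (fun e : Fin (n + 1) × Fin (n + 1) => e.1.val < p ∧ q ≤ e.2.val), d e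

/-- The minimum of the prefix sums over `[p, q]`, where `p ≤ q`. -/
noncomputable def minPrefix (x : Fin (n + 1) → ℝ) (p q : ℕ) : ℝ :=
  (insert p (Finset.Icc p q)).inf' (Finset.insert_nonempty _ _) (prefixSum x)

theorem minPrefix_le (x : Fin (n + 1) → ℝ) {p q k : ℕ} (h1 : p ≤ k) (h2 : k ≤ q) :
    minPrefix x p q ≤ prefixSum x k :=
  Finset.inf'_le _ (by simp [h1, h2])

theorem exists_minPrefix_eq (x : Fin (n + 1) → ℝ) {p q : ℕ} (hpq : p ≤ q) :
    ∃ k, p ≤ k ∧ k ≤ q ∧ minPrefix x p q = prefixSum x k := by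
  obtain ⟨k, hk, h⟩ := Finset.exists_mem_eq_inf' (Finset.insert_nonempty p (Finset.Icc p q))
    (prefixSum x)
  refine ⟨k, ?_, ?_, h⟩ <;> simp at hk <;> omega

theorem lt_minPrefix_iff (x : Fin (n + 1) → ℝ) {p q : ℕ} (hpq : p ≤ q) {c : ℝ} :
    c < minPrefix x p q ↔ ∀ k, p ≤ k → k ≤ q → c < prefixSum x k := by
  constructor
  · intro h k h1 h2
    exact h.trans_le (minPrefix_le x h1 h2)
  · intro h
    obtain ⟨k, h1, h2, h3⟩ := exists_minPrefix_eq x hpq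
    rw [h3]; exact h k h1 h2

theorem minPrefix_succ_right (x : Fin (n + 1) → ℝ) {p q : ℕ} (hpq : p ≤ q) :
    minPrefix x p (q + 1) = min (minPrefix x p q) (prefixSum x (q + 1)) := by
  apply le_antisymm
  · obtain ⟨k, h1, h2, h3⟩ := exists_minPrefix_eq x hpq
    exact le_min (h3 ▸ minPrefix_le x h1 (by omega)) (minPrefix_le x (by omega) le_rfl)
  · obtain ⟨k, h1, h2, h3⟩ := exists_minPrefix_eq x (Nat.le_succ_of_le hpq)
    rw [Nat.succ_eq_add_one] at h3 h2
    rw [h3]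
    rcases Nat.lt_or_ge q k with h | h
    · obtain rfl : k = q + 1 := by omega
      exact min_le_right _ _
    · exact (min_le_left _ _).trans (minPrefix_le x h1 h)

theorem minPrefix_succ_left (x : Fin (n + 1) → ℝ) {p q : ℕ} (hpq : p + 1 ≤ q) :
    minPrefix x p q = min (prefixSum x p) (minPrefix x (p + 1) q) := by
  apply le_antisymm
  · obtain ⟨k, h1, h2, h3⟩ := exists_minPrefix_eq x hpq
    exact le_min (minPrefix_le x le_rfl (by omega)) (h3 ▸ minPrefix_le x (by omega) (by omega))
  · obtain ⟨k, h1, h2, h3⟩ := exists_minPrefix_eq x (show p ≤ q by omega)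
    rw [h3]
    rcases Nat.lt_or_ge p k with h | h
    · exact (min_le_right _ _).trans (minPrefix_le x h h2)
    · obtain rfl : k = p := by omega
      exact min_le_left _ _

/-- The weights of the noncrossing alternating representation of `x`. -/
noncomputable def ncWeight (x : Fin (n + 1) → ℝ) (e : Fin (n + 1) × Fin (n + 1)) : ℝ :=
  if e.1 < e.2 then
    minPrefix x (e.1 + 1) e.2 - minPrefix x e.1 e.2 - minPrefix x (e.1 + 1) (e.2 + 1)
      + minPrefix x e.1 (e.2 + 1)
  else 0

/-- A pair reaching over all of `[p, q]` straddles every cut in that range, which gives one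
inequality. For the other, some cut `k` in the range must be straddled by no further pairs. -/
theorem nestSum_eq_minPrefix {d : Fin (n + 1) × Fin (n + 1) → ℝ} {G : SimpleGraph (Fin (n + 1))}
    (h : 0 ≤ d) (hd : SupportedOn d G) (hG : IsNCAlt G) {p q : ℕ} (hpq : p ≤ q) :
    nestSum d p q = minPrefix (comb d) p q := by
  have hpre := fun k => prefixSum_comb (fun p hp => (hd p hp).1) k
  apply le_antisymm
  · obtain ⟨k, h1, h2, h3⟩ := exists_minPrefix_eq (comb d) hpq
    rw [h3, hpre]
    refine Finset.sum_le_sum_of_subset_of_nonneg ?_ fun e _ _ => h e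
    intro e he
    simp only [Finset.mem_filter, Finset.mem_univ, true_and] at he ⊢
    omega
  · obtain ⟨k, hpk, hkq, hk⟩ : ∃ k, p ≤ k ∧ k ≤ q ∧ ∀ e, d e ≠ 0 → e.1.val < k → k ≤ e.2.val →
        e.1.val < p ∧ q ≤ e.2.val := by
      -- The good cut lies just after the last vertex `b` of `[p, q)` that is the right end of a
      -- pair `(a, b)` starting before `p`. A pair over this cut cannot start at `b` (alternating)
      -- nor in `[p, b)` (noncrossing), so it starts before `p`, and maximality of `b` makes it end
      -- at or beyond `q`. Without such a `b`, the cut `p` itself works.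
      set B := univ.filter (fun b : Fin (n + 1) => ∃ a, a.val < p ∧ p ≤ b.val ∧ b.val < q ∧
        d (a, b) ≠ 0) with hB
      by_cases hne : B.Nonempty
      · obtain ⟨b, hbB, hbmax⟩ := B.exists_max_image id hne
        simp only [hB, Finset.mem_filter, Finset.mem_univ, true_and, id] at hbB hbmax
        obtain ⟨a, hap, hpb, hbq, hab⟩ := hbB
        refine ⟨b + 1, by omega, by omega, fun e he h1 h2 => ?_⟩
        have hb' : e.1 ≠ b := by
          rintro rfl
          exact hG.2 a e.1 e.2 (hd _ hab).1 (hd _ he).1 ⟨(hd _ hab).2, (hd _ he).2⟩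
        have h1' : e.1 < b := lt_of_le_of_ne (Fin.le_def.2 (by omega)) hb'
        have hp : e.1.val < p := by
          by_contra hcon
          exact hG.1 a e.1 b e.2 (Fin.lt_def.2 (by omega)) h1' (Fin.lt_def.2 (by omega))
            ⟨(hd _ hab).2, (hd _ he).2⟩
        refine ⟨hp, ?_⟩
        by_contra hcon
        have := hbmax e.2 ⟨e.1, hp, by omega, by omega, he⟩
        rw [Fin.le_def] at this
        omega
      · refine ⟨p, le_rfl, hpq, fun e he h1 h2 => ⟨h1, ?_⟩⟩
        by_contra hcon
        apply hne
        refine ⟨e.2, ?_⟩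
        simp only [hB, Finset.mem_filter, Finset.mem_univ, true_and]
        exact ⟨e.1, h1, h2, by omega, he⟩
    refine (minPrefix_le _ hpk hkq).trans ?_
    rw [hpre, nestSum, Finset.sum_filter, Finset.sum_filter]
    refine Finset.sum_le_sum fun e _ => ?_
    by_cases he : d e = 0
    · simp [he]
    · by_cases hc : e.1.val < k ∧ k ≤ e.2.val
      · rw [if_pos hc, if_pos (hk e he hc.1 hc.2)]
      · rw [if_neg hc]
        split_ifs
        · exact h e
        · exact le_rfl

/-- The mixed second difference of `nestSum` isolates the single pair `e`, and `nestSum` depends on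
the vector only. -/
theorem ncWeight_comb {d : Fin (n + 1) × Fin (n + 1) → ℝ} {G : SimpleGraph (Fin (n + 1))}
    (h : 0 ≤ d) (hd : SupportedOn d G) (hG : IsNCAlt G) : ncWeight (comb d) = d := by
  funext e
  unfold ncWeight
  split_ifs with he
  · rw [Fin.lt_def] at he
    rw [← nestSum_eq_minPrefix h hd hG (by omega), ← nestSum_eq_minPrefix h hd hG (by omega),
      ← nestSum_eq_minPrefix h hd hG (by omega), ← nestSum_eq_minPrefix h hd hG (by omega)]
    unfold nestSum
    simp only [Finset.sum_filter]
    rw [← Finset.sum_sub_distrib, ← Finset.sum_sub_distrib, ← Finset.sum_add_distrib,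
      Finset.sum_eq_single e]
    · simp
    · intro f _ hf
      have : ¬ (f.1.val = e.1.val ∧ f.2.val = e.2.val) := fun h =>
        hf (Prod.ext (Fin.ext h.1) (Fin.ext h.2))
      split_ifs <;> first | omega | ring
    · simp
  · by_contra hne
    exact he (hd e (Ne.symm hne)).1

/-- For signed weights `f` in the kernel, `f + |f|` and `|f|` are both nonnegative with the same
image, so `ncWeight` recovers both from one vector and they agree. Thus uniqueness for nonnegative
weights already gives linear independence. -/
theorem comb_injOn {d d' : Fin (n + 1) × Fin (n + 1) → ℝ} {G : SimpleGraph (Fin (n + 1))}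
    (hd : SupportedOn d G) (hd' : SupportedOn d' G) (hG : IsNCAlt G) (h : comb d = comb d') :
    d = d' := by
  have key : ∀ f, SupportedOn f G → comb f = 0 → f = 0 := by
    intro f hf h0
    have h1 : ncWeight (comb (f + |f|)) = f + |f| := by
      refine ncWeight_comb (fun p => ?_) (hf.add fun p hp => hf p ?_) hG
      · have := neg_abs_le (f p)
        simp only [Pi.zero_apply, Pi.add_apply, Pi.abs_apply]; linarith
      · intro h0; simp [h0] at hp
    have h2 : ncWeight (comb |f|) = |f| := by
      refine ncWeight_comb (fun p => ?_) (fun p hp => hf p ?_) hG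
      · simp
      · intro h0; simp [h0] at hp
    rw [map_add, h0, zero_add, h2] at h1
    simpa using h1.symm
  rw [← sub_eq_zero]
  exact key _ (hd.sub hd') (by rw [map_sub, h, sub_self])

theorem continuous_ncWeight : Continuous (ncWeight (n := n)) := by
  have h1 : ∀ k, Continuous fun x : Fin (n + 1) → ℝ => prefixSum x k := by
    intro k; unfold prefixSum; fun_prop
  have h2 : ∀ p q, Continuous fun x : Fin (n + 1) → ℝ => minPrefix x p q := by
    intro p q
    unfold minPrefix
    exact Continuous.finset_inf'_apply _ fun i _ => h1 i
  refine continuous_pi fun e => ?_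
  unfold ncWeight
  split_ifs
  · exact (((h2 _ _).sub (h2 _ _)).sub (h2 _ _)).add (h2 _ _)
  · exact continuous_const

end RootPolytope

/-! ### Uncrossing, transitive closures, and root polytopes as truncated cones. -/

namespace RootPolytope

open Finset Filter Topology

variable {n : ℕ}

/-! ### Existence of noncrossing alternating representations -/

/-- Graphs closed under transitivity and under uncrossing of edges. -/
structure IsUncrossable (G : SimpleGraph (Fin (n + 1))) : Prop where
  trans : ∀ i j k, i < j → j < k → G.Adj i j → G.Adj j k → G.Adj i k
  uncross : ∀ i j k l, i < j → j < k → k < l → G.Adj i k → G.Adj j l → G.Adj i l ∧ G.Adj j k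

theorem isUncrossable_top : IsUncrossable (⊤ : SimpleGraph (Fin (n + 1))) where
  trans _ _ _ h1 h2 _ _ := (h1.trans h2).ne
  uncross _ _ _ _ h1 h2 h3 _ _ := ⟨(h1.trans (h2.trans h3)).ne, h2.ne⟩

/-- The graph of the pairs with nonzero weight. -/
def supportGraph (d : Fin (n + 1) × Fin (n + 1) → ℝ) : SimpleGraph (Fin (n + 1)) where
  Adj i j := (i < j ∧ d (i, j) ≠ 0) ∨ (j < i ∧ d (j, i) ≠ 0)
  symm := ⟨fun _ _ h => h.symm⟩
  loopless := ⟨fun _ h => h.elim (fun h => lt_irrefl _ h.1) (fun h => lt_irrefl _ h.1)⟩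

theorem supportGraph_adj_of_lt {d : Fin (n + 1) × Fin (n + 1) → ℝ} {i j : Fin (n + 1)}
    (h : i < j) : (supportGraph d).Adj i j ↔ d (i, j) ≠ 0 := by
  simp [supportGraph, h, h.not_gt]

theorem supportGraph_le {d : Fin (n + 1) × Fin (n + 1) → ℝ} {G : SimpleGraph (Fin (n + 1))}
    (h : SupportedOn d G) : supportGraph d ≤ G := by
  rintro i j (⟨_, h1⟩ | ⟨_, h1⟩)
  · exact (h _ h1).2
  · exact (h _ h1).2.symm

theorem SupportedOn.supportGraph {d : Fin (n + 1) × Fin (n + 1) → ℝ}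
    {G : SimpleGraph (Fin (n + 1))} (h : SupportedOn d G) : SupportedOn d (supportGraph d) :=
  fun p hp => ⟨(h p hp).1, (supportGraph_adj_of_lt (h p hp).1).2 hp⟩

theorem SimpleGraph_le_iff_lt {m : ℕ} {G H : SimpleGraph (Fin m)} :
    G ≤ H ↔ ∀ i j, i < j → G.Adj i j → H.Adj i j := by
  refine ⟨fun h i j _ hij => h hij, fun h i j hij => ?_⟩
  rcases lt_trichotomy i j with h1 | h1 | h1
  · exact h i j h1 hij
  · exact absurd (h1 ▸ hij) (G.irrefl)
  · exact (h j i h1 hij.symm).symm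

theorem eventually_nonneg_add_smul {ι : Type*} [Finite ι] {d c : ι → ℝ} (hd : 0 ≤ d)
    (hc : ∀ p, c p < 0 → 0 < d p) : ∀ᶠ ε in 𝓝[>] (0 : ℝ), 0 ≤ d + ε • c := by
  have : ∀ p, ∀ᶠ ε in 𝓝[>] (0 : ℝ), 0 ≤ d p + ε * c p := by
    intro p
    rcases lt_or_ge (c p) 0 with h | h
    · have h1 : Tendsto (fun ε : ℝ => d p + ε * c p) (𝓝[>] 0) (𝓝 (d p + 0 * c p)) := by
        apply Tendsto.mono_left _ nhdsWithin_le_nhds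
        exact (Continuous.tendsto (by fun_prop) 0)
      have h2 : (0 : ℝ) < d p + 0 * c p := by simpa using hc p h
      exact (h1.eventually_const_lt h2).mono fun _ h => h.le
    · filter_upwards [self_mem_nhdsWithin] with ε hε
      exact add_nonneg (hd p) (mul_nonneg (le_of_lt hε) h)
  exact eventually_all.2 this

/-- The nonnegative representations on `G` form a compact set, on which `∑ d (i, j) (j - i)²` has a
maximum. Replacing a crossing by the nested pair, or a chain by its long edge, preserves the vector
and strictly increases this sum, so the maximizer is noncrossing and alternating. -/
theorem exists_isNCAlt_rep {G : SimpleGraph (Fin (n + 1))} (hG : IsUncrossable G)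
    {d : Fin (n + 1) × Fin (n + 1) → ℝ} (hd : 0 ≤ d) (hdG : SupportedOn d G) :
    ∃ d', 0 ≤ d' ∧ SupportedOn d' G ∧ comb d' = comb d ∧ IsNCAlt (supportGraph d') := by
  set K : Set (Fin (n + 1) × Fin (n + 1) → ℝ) :=
    {d' | 0 ≤ d' ∧ SupportedOn d' G ∧ comb d' = comb d} with hK
  have hcomb : Continuous (comb (n := n)) := LinearMap.continuous_of_finiteDimensional _
  have hclosed : IsClosed K := by
    have h1 : K = {d' | 0 ≤ d'} ∩ (⋂ p, ⋂ (_ : ¬ (p.1 < p.2 ∧ G.Adj p.1 p.2)), {d' | d' p = 0}) ∩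
        {d' | comb d' = comb d} := by
      ext d'
      simp only [hK, Set.mem_ofPred_eq, Set.mem_inter_iff, Set.mem_iInter, SupportedOn, and_assoc]
      refine and_congr_right fun _ => and_congr_left fun _ => forall_congr' fun p => ?_
      tauto
    rw [h1]
    refine (isClosed_Ici.inter ?_).inter (isClosed_eq hcomb continuous_const)
    exact isClosed_iInter fun p => isClosed_iInter fun _ =>
      isClosed_eq (continuous_apply p) continuous_const
  set f : (Fin (n + 1) × Fin (n + 1) → ℝ) → ℝ :=
    fun d' => ∑ p, d' p * ((p.2 : ℝ) - (p.1 : ℝ)) ^ 2 with hf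
  -- Pairing the vector with the vertex labels gives minus the weighted sum of edge lengths. These
  -- lengths are at least 1, so every weight is bounded by a constant of the vector, which yields
  -- compactness.
  have hlin : ∀ d' : Fin (n + 1) × Fin (n + 1) → ℝ,
      ∑ v : Fin (n + 1), (v : ℝ) * comb d' v = ∑ p, d' p * ((p.1 : ℝ) - (p.2 : ℝ)) := by
    intro d'
    simp_rw [comb_apply, Finset.sum_apply, Pi.smul_apply, smul_eq_mul, Finset.mul_sum]
    rw [Finset.sum_comm]
    refine Finset.sum_congr rfl fun p _ => ?_
    simp_rw [root_apply, mul_sub, Finset.sum_sub_distrib]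
    simp
    ring
  have hbdd : K ⊆ Set.Icc 0 (fun _ => - ∑ v : Fin (n + 1), (v : ℝ) * comb d v) := by
    rintro d' ⟨h1, h2, h3⟩
    refine ⟨h1, fun p => ?_⟩
    rw [← h3, hlin, ← Finset.sum_neg_distrib]
    have hterm : ∀ q, 0 ≤ -(d' q * ((q.1 : ℝ) - (q.2 : ℝ))) ∧
        d' q ≤ -(d' q * ((q.1 : ℝ) - (q.2 : ℝ))) := by
      intro q
      by_cases hq : d' q = 0
      · simp [hq]
      · have h4 := (h2 q hq).1
        rw [Fin.lt_def] at h4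
        have h5 : (q.1 : ℝ) + 1 ≤ (q.2 : ℝ) := by exact_mod_cast h4
        have h6 : 0 ≤ d' q := h1 q
        constructor <;> nlinarith
    exact (hterm p).2.trans (Finset.single_le_sum (f := fun q : Fin (n + 1) × Fin (n + 1) =>
      -(d' q * ((q.1 : ℝ) - (q.2 : ℝ)))) (fun q _ => (hterm q).1) (Finset.mem_univ p))
  have hcomp : IsCompact K := isCompact_Icc.of_isClosed_subset hclosed hbdd
  obtain ⟨m, ⟨hm0, hmG, hmc⟩, hmax⟩ := hcomp.exists_isMaxOn ⟨d, hd, hdG, rfl⟩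
    (f := f) (by rw [hf]; fun_prop)
  -- First-order optimality: a kernel direction that decreases only positive weights can be followed
  -- for a short time.
  have key : ∀ c, comb c = 0 → SupportedOn c G → (∀ p, c p < 0 → m p ≠ 0) → f c ≤ 0 := by
    intro c hc0 hcG hcm
    obtain ⟨ε, hε, hε0⟩ := ((eventually_nonneg_add_smul hm0
      (fun p hp => lt_of_le_of_ne (hm0 p) (hcm p hp).symm)).and self_mem_nhdsWithin).exists
    have hmem : m + ε • c ∈ K :=
      ⟨hε, hmG.add (hcG.smul ε), by rw [map_add, map_smul, hc0, smul_zero, add_zero, hmc]⟩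
    have h1 : f (m + ε • c) ≤ f m := hmax hmem
    have h2 : f (m + ε • c) = f m + ε * f c := by
      simp only [hf, Finset.mul_sum, ← Finset.sum_add_distrib]
      refine Finset.sum_congr rfl fun p _ => ?_
      simp only [Pi.add_apply, Pi.smul_apply, smul_eq_mul]; ring
    have h3 : (0 : ℝ) < ε := hε0
    by_contra hcon
    push Not at hcon
    have := mul_pos h3 hcon
    linarith
  have hfadd : ∀ c c', f (c + c') = f c + f c' := by
    intro c c'
    simp only [hf, ← Finset.sum_add_distrib]
    refine Finset.sum_congr rfl fun p _ => ?_
    simp only [Pi.add_apply]; ring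
  have hfsub : ∀ c c', f (c - c') = f c - f c' := by
    intro c c'
    simp only [hf, ← Finset.sum_sub_distrib]
    refine Finset.sum_congr rfl fun p _ => ?_
    simp only [Pi.sub_apply]; ring
  have hfsingle : ∀ p : Fin (n + 1) × Fin (n + 1),
      f (Pi.single p 1) = ((p.2 : ℝ) - (p.1 : ℝ)) ^ 2 := by
    intro p
    simp only [hf]
    rw [Finset.sum_eq_single p]
    · simp
    · intro q _ hq; simp [hq]
    · simp
  have hneg : ∀ p a : Fin (n + 1) × Fin (n + 1),
      (0 : ℝ) ≤ (Pi.single p 1 : Fin (n + 1) × Fin (n + 1) → ℝ) a := by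
    intro p a
    exact (Pi.single_nonneg.2 zero_le_one :
      (0 : Fin (n + 1) × Fin (n + 1) → ℝ) ≤ Pi.single p (1 : ℝ)) a
  refine ⟨m, hm0, hmG, hmc, ?_, ?_⟩
  · intro i j k l hij hjk hkl ⟨h1, h2⟩
    have hik := hij.trans hjk
    have hjl := hjk.trans hkl
    rw [supportGraph_adj_of_lt hik] at h1
    rw [supportGraph_adj_of_lt hjl] at h2
    have hu := hG.uncross i j k l hij hjk hkl (hmG _ h1).2 (hmG _ h2).2
    have := key (Pi.single (i, l) 1 + Pi.single (j, k) 1 -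
      (Pi.single (i, k) 1 + Pi.single (j, l) 1)) ?_ ?_ ?_
    · rw [hfsub, hfadd, hfadd, hfsingle, hfsingle, hfsingle, hfsingle] at this
      rw [Fin.lt_def] at hij hjk hkl
      have h3 : (i : ℝ) < j := by exact_mod_cast hij
      have h4 : (k : ℝ) < l := by exact_mod_cast hkl
      nlinarith
    · simp only [map_sub, map_add, comb_single, root, one_smul]; abel
    · exact ((supportedOn_single (hik.trans hkl) hu.1 1).add
        (supportedOn_single hjk hu.2 1)).sub ((supportedOn_single hik (hmG _ h1).2 1).add
        (supportedOn_single hjl (hmG _ h2).2 1))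
    · intro p hp h0
      have e1 : p ≠ (i, k) := by rintro rfl; exact h1 h0
      have e2 : p ≠ (j, l) := by rintro rfl; exact h2 h0
      simp only [Pi.sub_apply, Pi.add_apply, Pi.single_eq_of_ne e1, Pi.single_eq_of_ne e2] at hp
      have := hneg (i, l) p
      have := hneg (j, k) p
      linarith
  · intro i j k hij hjk ⟨h1, h2⟩
    have hik := hij.trans hjk
    rw [supportGraph_adj_of_lt hij] at h1
    rw [supportGraph_adj_of_lt hjk] at h2
    have hu := hG.trans i j k hij hjk (hmG _ h1).2 (hmG _ h2).2
    have := key (Pi.single (i, k) 1 - (Pi.single (i, j) 1 + Pi.single (j, k) 1)) ?_ ?_ ?_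
    · rw [hfsub, hfadd, hfsingle, hfsingle, hfsingle] at this
      rw [Fin.lt_def] at hij hjk
      have h3 : (i : ℝ) < j := by exact_mod_cast hij
      have h4 : (j : ℝ) < k := by exact_mod_cast hjk
      nlinarith
    · simp only [map_sub, map_add, comb_single, root, one_smul]; abel
    · exact (supportedOn_single hik hu 1).sub ((supportedOn_single hij (hmG _ h1).2 1).add
        (supportedOn_single hjk (hmG _ h2).2 1))
    · intro p hp h0
      have e1 : p ≠ (i, j) := by rintro rfl; exact h1 h0
      have e2 : p ≠ (j, k) := by rintro rfl; exact h2 h0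
      simp only [Pi.sub_apply, Pi.add_apply, Pi.single_eq_of_ne e1, Pi.single_eq_of_ne e2] at hp
      have := hneg (i, k) p
      linarith

/-- The formula for `ncWeight` does not involve `G`. Hence representations of one vector relative to
different uncrossable graphs, in particular the complete graph, coincide. -/
theorem ncWeight_of_mem_cone {G : SimpleGraph (Fin (n + 1))} (hG : IsUncrossable G)
    {x : Fin (n + 1) → ℝ} (hx : x ∈ cone G) :
    0 ≤ ncWeight x ∧ SupportedOn (ncWeight x) G ∧ comb (ncWeight x) = x ∧
      IsNCAlt (supportGraph (ncWeight x)) := by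
  obtain ⟨d, h1, h2, rfl⟩ := mem_cone_iff.1 hx
  obtain ⟨d', h3, h4, h5, h6⟩ := exists_isNCAlt_rep hG h1 h2
  have h7 : ncWeight (comb d) = d' := by rw [← h5]; exact ncWeight_comb h3 h4.supportGraph h6
  rw [h7]
  exact ⟨h3, h4, h5, h6⟩

/-! ### The transitive closure -/

theorem le_transClosure {m : ℕ} (T : SimpleGraph (Fin m)) : T ≤ transClosure T := by
  rw [SimpleGraph_le_iff_lt]
  intro i j hij h
  exact Or.inl (Relation.TransGen.single ⟨hij, h⟩)

theorem transClosure_adj_of_lt {m : ℕ} {T : SimpleGraph (Fin m)} {i j : Fin m} (h : i < j) :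
    (transClosure T).Adj i j ↔ IncreasingRoute T i j :=
  ⟨fun h' => h'.resolve_right fun h'' => lt_asymm h h''.lt, Or.inl⟩

theorem cone_transClosure (T : SimpleGraph (Fin (n + 1))) : cone (transClosure T) = cone T := by
  refine le_antisymm ?_ (cone_mono (le_transClosure T))
  refine Submodule.span_le.2 ?_
  rintro _ ⟨i, j, hij, h, rfl⟩
  rw [transClosure_adj_of_lt hij] at h
  clear hij
  unfold IncreasingRoute at h
  induction h with
  | single h => exact Submodule.subset_span ⟨_, _, h.1, h.2, rfl⟩
  | tail _ h ih =>
    rename_i b c _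
    have : root i c = root i b + root b c := by simp [root]
    rw [this]
    exact (cone T).add_mem ih (Submodule.subset_span ⟨_, _, h.1, h.2, rfl⟩)

theorem reflTransGen_le {m : ℕ} {T : SimpleGraph (Fin m)} {i j : Fin m}
    (h : Relation.ReflTransGen (fun a b => a < b ∧ T.Adj a b) i j) : i ≤ j := by
  rcases Relation.reflTransGen_iff_eq_or_transGen.1 h with h | h
  · exact h.ge
  · exact (IncreasingRoute.lt h).le

/-- An increasing path starting strictly under an edge cannot jump over its right end without
crossing it, so it visits that end. -/
theorem reflTransGen_through_edge {m : ℕ} {T : SimpleGraph (Fin m)} (hT : IsNoncrossing T)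
    {i b j l : Fin m} (hib : T.Adj i b) (hij : i < j) (hjb : j < b) (hbl : b ≤ l)
    (h : Relation.ReflTransGen (fun a b => a < b ∧ T.Adj a b) j l) :
    Relation.ReflTransGen (fun a b => a < b ∧ T.Adj a b) j b ∧
      Relation.ReflTransGen (fun a b => a < b ∧ T.Adj a b) b l := by
  induction h using Relation.ReflTransGen.head_induction_on with
  | refl => exact absurd hjb hbl.not_gt
  | head h h' ih =>
    rename_i a c
    rcases lt_trichotomy c b with hc | hc | hc
    · obtain ⟨h1, h2⟩ := ih (hij.trans h.1) hc
      exact ⟨h1.head h, h2⟩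
    · subst hc
      exact ⟨Relation.ReflTransGen.single h, h'⟩
    · exact absurd ⟨hib, h.2⟩ (hT i a b c hij hjb hc)

/-- Following the first path until it reaches or jumps over `j`: in the latter case the second path
starts under the jumping edge and must visit its end. The shared vertex lets the two paths exchange
their tails, which is what uncrossing in the transitive closure requires. -/
theorem exists_common_of_crossing {m : ℕ} {T : SimpleGraph (Fin m)} (hT : IsNoncrossing T)
    {i j k l : Fin m} (hij : i < j) (hjk : j < k) (hkl : k < l)
    (h1 : Relation.ReflTransGen (fun a b => a < b ∧ T.Adj a b) i k)
    (h2 : Relation.ReflTransGen (fun a b => a < b ∧ T.Adj a b) j l) :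
    ∃ v, Relation.ReflTransGen (fun a b => a < b ∧ T.Adj a b) i v ∧
      Relation.ReflTransGen (fun a b => a < b ∧ T.Adj a b) v k ∧
      Relation.ReflTransGen (fun a b => a < b ∧ T.Adj a b) j v ∧
      Relation.ReflTransGen (fun a b => a < b ∧ T.Adj a b) v l := by
  induction h1 using Relation.ReflTransGen.head_induction_on with
  | refl => exact absurd hij hjk.not_gt
  | head h h' ih =>
    rename_i a b
    rcases lt_trichotomy b j with hb | hb | hb
    · obtain ⟨v, e1, e2, e3, e4⟩ := ih hb
      exact ⟨v, e1.head h, e2, e3, e4⟩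
    · subst hb
      exact ⟨b, Relation.ReflTransGen.single h, h', Relation.ReflTransGen.refl, h2⟩
    · obtain ⟨e1, e2⟩ := reflTransGen_through_edge hT h.2 hij hb
        ((reflTransGen_le h').trans hkl.le) h2
      exact ⟨b, Relation.ReflTransGen.single h, h', e1, e2⟩

theorem isUncrossable_transClosure {T : SimpleGraph (Fin (n + 1))} (hT : IsNoncrossing T) :
    IsUncrossable (transClosure T) where
  trans i j k hij hjk h1 h2 := by
    rw [transClosure_adj_of_lt hij] at h1
    rw [transClosure_adj_of_lt hjk] at h2
    exact Or.inl (Relation.TransGen.trans h1 h2)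
  uncross i j k l hij hjk hkl h1 h2 := by
    have key : ∀ {a b}, a < b → Relation.ReflTransGen (fun a b => a < b ∧ T.Adj a b) a b →
        (transClosure T).Adj a b := by
      intro a b hab h
      exact Or.inl ((Relation.reflTransGen_iff_eq_or_transGen.1 h).resolve_left hab.ne')
    rw [transClosure_adj_of_lt (hij.trans hjk)] at h1
    rw [transClosure_adj_of_lt (hjk.trans hkl)] at h2
    obtain ⟨v, e1, e2, e3, e4⟩ :=
      exists_common_of_crossing hT hij hjk hkl h1.to_reflTransGen h2.to_reflTransGen
    exact ⟨key (hij.trans (hjk.trans hkl)) (e1.trans e4), key hjk (e3.trans e2)⟩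

/-! ### The root polytope as a truncated cone -/

theorem convex_height_le : Convex ℝ {x : Fin (n + 1) → ℝ | height x ≤ 1} := by
  intro x hx y hy a b ha hb hab
  simp only [Set.mem_ofPred_eq] at *
  refine (height_add_le _ _).trans ?_
  rw [height_smul ha, height_smul hb]
  nlinarith

theorem height_zero : height (0 : Fin (n + 1) → ℝ) = 0 := by simp [height]

theorem height_le_one_of_mem_fullPolytope {x : Fin (n + 1) → ℝ} (hx : x ∈ fullPolytope n) :
    height x ≤ 1 := by
  refine convexHull_min (t := {x : Fin (n + 1) → ℝ | height x ≤ 1}) ?_ convex_height_le hx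
  rintro _ (rfl | ⟨i, j, hij, rfl⟩)
  · simp [height_zero]
  · exact (height_root hij.ne).le

/-- The missing mass `1 - ∑ d` is placed on the origin, represented by the index `none`. -/
theorem comb_mem_convexHull {s : Set (Fin (n + 1) → ℝ)} (hs : (0 : Fin (n + 1) → ℝ) ∈ s)
    {d : Fin (n + 1) × Fin (n + 1) → ℝ} (hd : 0 ≤ d) (h1 : ∑ p, d p ≤ 1)
    (hsup : ∀ p, d p ≠ 0 → root p.1 p.2 ∈ s) : comb d ∈ convexHull ℝ s := by
  have := (convex_convexHull ℝ s).sum_mem (t := Finset.univ)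
    (w := fun o : Option (Fin (n + 1) × Fin (n + 1)) => o.elim (1 - ∑ p, d p) d)
    (z := fun o => o.elim 0 (fun p => if d p = 0 then 0 else root p.1 p.2)) ?_ ?_ ?_
  · convert! this using 1
    rw [Fintype.sum_option, comb_apply]
    simp only [Option.elim, smul_zero, zero_add]
    refine Finset.sum_congr rfl fun p _ => ?_
    split_ifs with h <;> simp [h]
  · rintro (_ | p) _
    · simpa using h1
    · exact hd p
  · rw [Fintype.sum_option]; simp
  · rintro (_ | p) _
    · exact subset_convexHull ℝ s hs
    · simp only [Option.elim]
      split_ifs with h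
      · exact subset_convexHull ℝ s hs
      · exact subset_convexHull ℝ s (hsup p h)

/-- Height is convex and at most 1 on the generators. Conversely, the noncrossing alternating
representation over the complete graph has total weight equal to the height, hence at most 1, so it
exhibits a convex combination of the origin and roots. -/
theorem mem_polytope_iff {G : SimpleGraph (Fin (n + 1))} {x : Fin (n + 1) → ℝ} :
    x ∈ polytope G ↔ x ∈ cone G ∧ height x ≤ 1 := by
  constructor
  · rintro ⟨h1, h2⟩
    exact ⟨h2, height_le_one_of_mem_fullPolytope h1⟩
  · rintro ⟨h1, h2⟩
    refine ⟨?_, h1⟩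
    obtain ⟨h3, h4, h5, h6⟩ := ncWeight_of_mem_cone isUncrossable_top (cone_mono le_top h1)
    rw [← h5, height_comb h3 h4.supportGraph h6.2] at h2
    rw [← h5]
    refine comb_mem_convexHull (Or.inl rfl) h3 h2 fun p hp => Or.inr ⟨p.1, p.2, (h4 p hp).1, rfl⟩

theorem zero_mem_polytope (G : SimpleGraph (Fin (n + 1))) : 0 ∈ polytope G :=
  mem_polytope_iff.2 ⟨(cone G).zero_mem, by simp [height_zero]⟩

theorem root_mem_polytope {G : SimpleGraph (Fin (n + 1))} {i j : Fin (n + 1)} (h : i < j)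
    (hG : G.Adj i j) : root i j ∈ polytope G :=
  mem_polytope_iff.2 ⟨Submodule.subset_span ⟨i, j, h, hG, rfl⟩, (height_root h.ne).le⟩

theorem polytope_eq_convexHull {G : SimpleGraph (Fin (n + 1))} (hG : IsAlternating G) :
    polytope G = convexHull ℝ ({0} ∪ {v | ∃ i j, i < j ∧ G.Adj i j ∧ v = root i j}) := by
  apply Set.Subset.antisymm
  · intro x hx
    obtain ⟨h1, h2⟩ := mem_polytope_iff.1 hx
    obtain ⟨d, h3, h4, rfl⟩ := mem_cone_iff.1 h1
    rw [height_comb h3 h4 hG] at h2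
    exact comb_mem_convexHull (Or.inl rfl) h3 h2
      fun p hp => Or.inr ⟨p.1, p.2, (h4 p hp).1, (h4 p hp).2, rfl⟩
  · refine convexHull_min ?_ ((convex_convexHull ℝ _).inter (cone G).toConvexCone.convex)
    rintro _ (rfl | ⟨i, j, hij, h, rfl⟩)
    · exact zero_mem_polytope G
    · exact root_mem_polytope hij h

end RootPolytope

/-! ### Coefficients along trees, and generic completion of forests to trees. -/

namespace RootPolytope

open Finset Filter Topology

variable {n : ℕ}

/-! ### Coefficients with respect to a tree -/

theorem sum_eq_zero_of_comb {d : Fin (n + 1) × Fin (n + 1) → ℝ} {A : Finset (Fin (n + 1))}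
    (h : ∀ p, d p ≠ 0 → (p.1 ∈ A ↔ p.2 ∈ A)) : ∑ v ∈ A, comb d v = 0 := by
  rw [sum_comb]
  refine Finset.sum_eq_zero fun p _ => ?_
  by_cases hp : d p = 0
  · simp [hp]
  · have := h p hp
    by_cases h1 : p.1 ∈ A <;> simp_all

theorem root_add_root (i j k : Fin (n + 1)) : root i j + root j k = root i k := by
  simp [root]

theorem exists_comb_of_reachable {G : SimpleGraph (Fin (n + 1))} {i j : Fin (n + 1)}
    (h : G.Reachable i j) : ∃ d, SupportedOn d G ∧ comb d = root i j := by
  obtain ⟨w⟩ := h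
  induction w with
  | nil => exact ⟨0, supportedOn_zero G, by simp [root]⟩
  | cons h _ ih =>
    rename_i u v w _
    obtain ⟨d, hd, hc⟩ := ih
    rcases lt_or_gt_of_ne h.ne with huv | huv
    · refine ⟨d + Pi.single (u, v) 1, hd.add (supportedOn_single huv h 1), ?_⟩
      rw [map_add, comb_single, hc, one_smul, ← root_add_root u v w]
      exact add_comm _ _
    · refine ⟨d - Pi.single (v, u) 1, hd.sub (supportedOn_single huv h.symm 1), ?_⟩
      rw [map_sub, comb_single, hc, one_smul]
      simp [root]

theorem exists_comb_of_connected {G : SimpleGraph (Fin (n + 1))} (hG : G.Connected)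
    {x : Fin (n + 1) → ℝ} (hx : ∑ v, x v = 0) : ∃ d, SupportedOn d G ∧ comb d = x := by
  choose d hd hc using fun v => exists_comb_of_reachable (hG.preconnected v 0)
  refine ⟨∑ v, x v • d v, ?_, ?_⟩
  · have : ∀ s : Finset (Fin (n + 1)), SupportedOn (∑ v ∈ s, x v • d v) G := by
      intro s
      induction s using Finset.induction_on with
      | empty => exact supportedOn_zero G
      | insert a s ha ih => rw [Finset.sum_insert ha]; exact ((hd a).smul _).add ih
    exact this _
  · simp only [map_sum, map_smul, hc, root, smul_sub, Finset.sum_sub_distrib]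
    rw [← Finset.sum_smul, hx, zero_smul, sub_zero]
    ext v
    simp [Finset.sum_apply, Pi.single_apply]

/-- If an edge were not a bridge, its root would also be a combination of the roots along a path
avoiding it, against `comb_injOn`. -/
theorem isAcyclic_of_isNCAlt {G : SimpleGraph (Fin (n + 1))} (hG : IsNCAlt G) : G.IsAcyclic := by
  have key : ∀ u v, u < v → G.Adj u v → ¬ (G.deleteEdges {s(u, v)}).Reachable u v := by
    intro u v huv h hr
    obtain ⟨d, hd, hc⟩ := exists_comb_of_reachable hr
    have := comb_injOn (hd.mono (SimpleGraph.deleteEdges_le _)) (supportedOn_single (p := (u, v)) huv h 1) hG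
      (by rw [hc, comb_single, one_smul])
    have h1 : d (u, v) ≠ 0 := by rw [this]; simp
    have := (hd _ h1).2
    simp at this
  rw [SimpleGraph.isAcyclic_iff_forall_adj_isBridge]
  intro u v h
  rw [SimpleGraph.isBridge_iff]
  rcases lt_or_gt_of_ne h.ne with huv | huv
  · exact key u v huv h
  · rw [Sym2.eq_swap]
    exact fun hr => key v u huv h.symm hr.symm

open Classical in
/-- The vertices on the side of `p.1` after removing the edge `p`. -/
noncomputable def edgeSide (G : SimpleGraph (Fin (n + 1))) (p : Fin (n + 1) × Fin (n + 1)) :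
    Finset (Fin (n + 1)) :=
  univ.filter fun v => (G.deleteEdges {s(p.1, p.2)}).Reachable p.1 v

open Classical in
/-- The coefficients of a linear combination of the roots of an acyclic graph. -/
noncomputable def edgeCoeff (G : SimpleGraph (Fin (n + 1))) :
    (Fin (n + 1) → ℝ) →ₗ[ℝ] (Fin (n + 1) × Fin (n + 1) → ℝ) :=
  LinearMap.pi fun p => if p.1 < p.2 ∧ G.Adj p.1 p.2 then ∑ v ∈ edgeSide G p, LinearMap.proj v
    else 0

theorem edgeCoeff_apply_of_adj {G : SimpleGraph (Fin (n + 1))} {p : Fin (n + 1) × Fin (n + 1)}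
    (h : p.1 < p.2 ∧ G.Adj p.1 p.2) (x : Fin (n + 1) → ℝ) :
    edgeCoeff G x p = ∑ v ∈ edgeSide G p, x v := by
  simp [edgeCoeff, h]

theorem supportedOn_edgeCoeff (G : SimpleGraph (Fin (n + 1))) (x : Fin (n + 1) → ℝ) :
    SupportedOn (edgeCoeff G x) G := by
  intro p hp
  by_contra h
  exact hp (by simp [edgeCoeff, h])

theorem continuous_edgeCoeff (G : SimpleGraph (Fin (n + 1))) : Continuous (edgeCoeff G) :=
  LinearMap.continuous_of_finiteDimensional _

/-- Deleting `p` separates its endpoints in a forest. Summing coordinates over the side of `p.1`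
cancels every other edge, whose ends lie on the same side, and leaves the weight of `p`. -/
theorem edgeCoeff_comb {G : SimpleGraph (Fin (n + 1))} (hG : G.IsAcyclic)
    {d : Fin (n + 1) × Fin (n + 1) → ℝ} (hd : SupportedOn d G) : edgeCoeff G (comb d) = d := by
  funext p
  by_cases hp : p.1 < p.2 ∧ G.Adj p.1 p.2
  · rw [edgeCoeff_apply_of_adj hp, sum_comb, Finset.sum_eq_single p]
    · have h1 : p.1 ∈ edgeSide G p := by simp [edgeSide]
      have h2 : p.2 ∉ edgeSide G p := by
        have := SimpleGraph.isAcyclic_iff_forall_adj_isBridge.1 hG hp.2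
        rw [SimpleGraph.isBridge_iff] at this
        simpa [edgeSide] using this
      simp [h1, h2]
    · intro q _ hq
      by_cases h0 : d q = 0
      · simp [h0]
      · have h1 := hd q h0
        have hadj : (G.deleteEdges {s(p.1, p.2)}).Adj q.1 q.2 := by
          rw [SimpleGraph.deleteEdges_adj]
          refine ⟨h1.2, fun h => ?_⟩
          simp only [Set.mem_singleton_iff, Sym2.eq_iff] at h
          rcases h with h | h
          · exact hq (Prod.ext h.1 h.2)
          · exact lt_asymm h1.1 (h.1 ▸ h.2 ▸ hp.1)
        have : q.1 ∈ edgeSide G p ↔ q.2 ∈ edgeSide G p := by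
          simp only [edgeSide, Finset.mem_filter, Finset.mem_univ, true_and]
          exact ⟨fun h => h.trans hadj.reachable, fun h => h.trans hadj.reachable.symm⟩
        by_cases h2 : q.1 ∈ edgeSide G p <;> simp_all
    · simp
  · have h1 : d p = 0 := by
      by_contra h; exact hp (hd p h)
    rw [h1]; simp [edgeCoeff, hp]

theorem comb_edgeCoeff {G : SimpleGraph (Fin (n + 1))} (hG : G.IsTree)
    {x : Fin (n + 1) → ℝ} (hx : ∑ v, x v = 0) : comb (edgeCoeff G x) = x := by
  obtain ⟨d, hd, rfl⟩ := exists_comb_of_connected hG.connected hx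
  rw [edgeCoeff_comb hG.isAcyclic hd]

theorem sum_eq_zero_of_mem_cone {G : SimpleGraph (Fin (n + 1))} {x : Fin (n + 1) → ℝ}
    (hx : x ∈ cone G) : ∑ v, x v = 0 := by
  obtain ⟨d, _, _, rfl⟩ := mem_cone_iff.1 hx
  exact sum_comb_univ d

theorem edgeCoeff_nonneg {G : SimpleGraph (Fin (n + 1))} (hG : G.IsAcyclic)
    {x : Fin (n + 1) → ℝ} (hx : x ∈ cone G) : 0 ≤ edgeCoeff G x := by
  obtain ⟨d, h1, h2, rfl⟩ := mem_cone_iff.1 hx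
  rwa [edgeCoeff_comb hG h2]

theorem mem_cone_iff_edgeCoeff {G : SimpleGraph (Fin (n + 1))} (hG : G.IsTree)
    {x : Fin (n + 1) → ℝ} : x ∈ cone G ↔ ∑ v, x v = 0 ∧ 0 ≤ edgeCoeff G x := by
  refine ⟨fun h => ⟨sum_eq_zero_of_mem_cone h, edgeCoeff_nonneg hG.isAcyclic h⟩, fun h => ?_⟩
  rw [← comb_edgeCoeff hG h.1]
  exact comb_mem_cone h.2 (supportedOn_edgeCoeff G x)

/-- This integrality is the unimodularity behind both the volume and the lattice point count. -/
theorem exists_int_edgeCoeff {G : SimpleGraph (Fin (n + 1))} {x : Fin (n + 1) → ℝ}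
    (hx : ∀ v, ∃ z : ℤ, x v = z) (p : Fin (n + 1) × Fin (n + 1)) :
    ∃ z : ℤ, edgeCoeff G x p = z := by
  choose z hz using hx
  by_cases hp : p.1 < p.2 ∧ G.Adj p.1 p.2
  · exact ⟨∑ v ∈ edgeSide G p, z v, by rw [edgeCoeff_apply_of_adj hp]; simp [hz]⟩
  · exact ⟨0, by simp [edgeCoeff, hp]⟩

/-! ### Extension to trees -/

theorem exists_adj_crossing {G : SimpleGraph (Fin (n + 1))} (hG : G.Connected)
    {A : Finset (Fin (n + 1))} (hne : A.Nonempty) (hA : A ≠ univ) :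
    ∃ p : Fin (n + 1) × Fin (n + 1), p.1 < p.2 ∧ G.Adj p.1 p.2 ∧ ¬ (p.1 ∈ A ↔ p.2 ∈ A) := by
  by_contra hcon
  push Not at hcon
  have hcl : ∀ u v, G.Adj u v → (u ∈ A ↔ v ∈ A) := by
    intro u v h
    rcases lt_or_gt_of_ne h.ne with huv | huv
    · exact hcon (u, v) huv h
    · exact (hcon (v, u) huv h.symm).symm
  obtain ⟨a, ha⟩ := hne
  apply hA
  rw [Finset.eq_univ_iff_forall]
  intro v
  obtain ⟨w⟩ := hG.preconnected a v
  induction w with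
  | nil => exact ha
  | cons h _ ih => exact ih ((hcl _ _ h).1 ha)

-- Every edge of `T` is weighted by its own power of `t`. A coordinate sum over a proper nonempty
-- set is then a polynomial in `t`; connectedness supplies an edge leaving the set, whose private
-- monomial has coefficient ±1. So each of the finitely many polynomials is nonzero and has no roots
-- for small `t > 0`.
open Polynomial in
theorem exists_generic {T : SimpleGraph (Fin (n + 1))} (hT : T.Connected)
    (x : Fin (n + 1) → ℝ) : ∃ y : ℝ → Fin (n + 1) → ℝ, Continuous y ∧ y 0 = x ∧
      (∀ t, 0 < t → y t - x ∈ cone T) ∧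
      ∀ᶠ t in 𝓝[>] 0, ∀ A : Finset (Fin (n + 1)), A.Nonempty → A ≠ univ → ∑ v ∈ A, y t v ≠ 0 := by
  classical
  let k := Fintype.equivFin (Fin (n + 1) × Fin (n + 1))
  let w : ℝ → Fin (n + 1) × Fin (n + 1) → ℝ := fun t p =>
    if p.1 < p.2 ∧ T.Adj p.1 p.2 then t ^ ((k p : ℕ) + 1) else 0
  have hwc : Continuous w := by
    refine continuous_pi fun p => ?_
    simp only [w]
    split_ifs <;> fun_prop
  have hcomb : Continuous (comb (n := n)) := LinearMap.continuous_of_finiteDimensional _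
  refine ⟨fun t => x + comb (w t), continuous_const.add (hcomb.comp hwc), ?_, ?_, ?_⟩
  · have : w 0 = 0 := by ext p; simp [w]
    simp [this]
  · intro t ht
    rw [add_sub_cancel_left]
    refine comb_mem_cone (fun p => ?_) (fun p hp => ?_)
    · simp only [w]; split_ifs
      · positivity
      · exact le_rfl
    · by_contra h; exact hp (by simp only [w]; rw [if_neg h])
  · rw [eventually_all]
    intro A
    by_cases hA : A.Nonempty ∧ A ≠ univ
    swap
    · exact Eventually.of_forall fun t h1 h2 => absurd ⟨h1, h2⟩ hA
    obtain ⟨p, hp1, hp2, hp3⟩ := exists_adj_crossing hT hA.1 hA.2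
    let s : Fin (n + 1) × Fin (n + 1) → ℝ := fun q =>
      (if q.1 ∈ A then 1 else 0) - (if q.2 ∈ A then 1 else 0)
    let P : ℝ[X] := C (∑ v ∈ A, x v) +
      ∑ q, if q.1 < q.2 ∧ T.Adj q.1 q.2 then C (s q) * X ^ ((k q : ℕ) + 1) else 0
    have hP : ∀ t, P.eval t = ∑ v ∈ A, (x + comb (w t)) v := by
      intro t
      simp only [P, Pi.add_apply, Finset.sum_add_distrib, sum_comb, eval_add, eval_C,
        eval_finsetSum]
      congr 1
      refine Finset.sum_congr rfl fun q _ => ?_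
      simp only [w, s]
      split_ifs <;> simp
    have hP0 : P ≠ 0 := by
      intro h0
      have h1 : P.coeff ((k p : ℕ) + 1) = s p := by
        simp only [P, coeff_add, coeff_C_succ, zero_add, finsetSum_coeff]
        rw [Finset.sum_eq_single p]
        · simp [hp1, hp2]
        · intro q _ hq
          split_ifs
          · rw [coeff_C_mul_X_pow, if_neg]
            intro h
            exact hq (k.injective (Fin.ext (by omega)))
          · simp
        · simp
      rw [h0, coeff_zero] at h1
      apply hp3
      by_cases h2 : p.1 ∈ A <;> by_cases h3 : p.2 ∈ A <;> simp [s, h2, h3] at h1 ⊢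
    have hfin : {t | P.IsRoot t}ᶜ ∈ (cofinite : Filter ℝ) :=
      (Polynomial.finite_setOfPred_isRoot hP0).compl_mem_cofinite
    filter_upwards [(nhdsGT_le_nhdsNE (0 : ℝ)).trans (nhdsNE_le_cofinite 0) hfin] with t ht _ _
    rw [← hP]
    exact ht

/-- Perturb `x` generically inside `cone T`. By continuity of `ncWeight` the support of the
perturbed vector contains that of `x`, and genericity makes it connected. -/
theorem exists_ncAltTree_of_mem_cone {T : SimpleGraph (Fin (n + 1))} (hT : T.IsTree)
    (hnc : IsNoncrossing T) {x : Fin (n + 1) → ℝ} (hx : x ∈ cone T) :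
    ∃ S ∈ ncAltTrees T, supportGraph (ncWeight x) ≤ S := by
  obtain ⟨y, hyc, hy0, hyT, hy⟩ := exists_generic hT.connected x
  have h1 : ∀ᶠ t in 𝓝[>] (0 : ℝ), ∀ p, ncWeight x p ≠ 0 → ncWeight (y t) p ≠ 0 := by
    rw [eventually_all]
    intro p
    by_cases hp : ncWeight x p = 0
    · exact Eventually.of_forall fun _ h => absurd hp h
    · have h2 : Tendsto (fun t => ncWeight (y t) p) (𝓝[>] 0) (𝓝 (ncWeight x p)) := by
        have := ((continuous_apply p).comp (continuous_ncWeight.comp hyc)).tendsto 0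
        simp only [Function.comp_apply, hy0] at this
        exact this.mono_left nhdsWithin_le_nhds
      filter_upwards [h2.eventually_ne hp] with t ht _
      exact ht
  obtain ⟨t, ⟨ht1, ht2⟩, ht0⟩ := ((hy.and h1).and self_mem_nhdsWithin).exists
  have hyt : y t ∈ cone T := by
    have := (cone T).add_mem hx (hyT t ht0)
    simpa using this
  rw [← cone_transClosure] at hyt
  obtain ⟨h3, h4, h5, h6⟩ := ncWeight_of_mem_cone (isUncrossable_transClosure hnc) hyt
  refine ⟨supportGraph (ncWeight (y t)), ⟨supportGraph_le h4, ⟨⟨?_⟩, isAcyclic_of_isNCAlt h6⟩, h6⟩,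
    ?_⟩
  · intro u v
    classical
    by_contra hcon
    -- No weight leaves the component of `u`, so the coordinates sum to zero over it. Genericity
    -- permits this only for the whole vertex set.
    refine ht1 (univ.filter fun w => (supportGraph (ncWeight (y t))).Reachable u w)
      ⟨u, by simp⟩ (fun h => hcon ?_) ?_
    · have := Finset.mem_univ v
      rw [← h] at this
      simpa using this
    · rw [← h5]
      refine sum_eq_zero_of_comb fun p hp => ?_
      rw [h5] at *
      have := (h4.supportGraph p hp).2.reachable
      simp only [Finset.mem_filter, Finset.mem_univ, true_and]
      exact ⟨fun h => h.trans this, fun h => h.trans this.symm⟩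
  · rw [SimpleGraph_le_iff_lt]
    intro i j hij h
    rw [supportGraph_adj_of_lt hij] at h ⊢
    exact ht2 _ h

end RootPolytope

/-! ### Simplices, relative interiors, vertices and faces of the triangulation. -/

namespace RootPolytope

open Finset Filter Topology

variable {n : ℕ}

/-! ### Simplices -/

open Classical in
/-- The edges `(i, j)`, `i < j`, of `G`. -/
noncomputable def edgePairs (G : SimpleGraph (Fin (n + 1))) :
    Finset (Fin (n + 1) × Fin (n + 1)) :=
  univ.filter fun p => p.1 < p.2 ∧ G.Adj p.1 p.2

theorem mem_edgePairs {G : SimpleGraph (Fin (n + 1))} {p : Fin (n + 1) × Fin (n + 1)} :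
    p ∈ edgePairs G ↔ p.1 < p.2 ∧ G.Adj p.1 p.2 := by
  simp [edgePairs]

theorem card_edgePairs (G : SimpleGraph (Fin (n + 1))) :
    (edgePairs G).card = G.edgeSet.ncard := by
  have h : G.edgeSet = (fun p : Fin (n + 1) × Fin (n + 1) => s(p.1, p.2)) '' (edgePairs G) := by
    ext e
    induction e with | h u v =>
    simp only [SimpleGraph.mem_edgeSet, Set.mem_image, Finset.mem_coe, mem_edgePairs, Prod.exists]
    constructor
    · intro h
      rcases lt_or_gt_of_ne h.ne with huv | huv
      · exact ⟨u, v, ⟨huv, h⟩, rfl⟩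
      · exact ⟨v, u, ⟨huv, h.symm⟩, Sym2.eq_swap⟩
    · rintro ⟨a, b, h, hab⟩
      rw [← SimpleGraph.mem_edgeSet, ← hab]
      exact h.2
  rw [h, Set.InjOn.ncard_image, Set.ncard_coe_finset]
  intro p hp q hq hpq
  rw [Finset.mem_coe, mem_edgePairs] at hp hq
  simp only [Sym2.eq_iff] at hpq
  rcases hpq with h | h
  · exact Prod.ext h.1 h.2
  · exact absurd hp.1 (h.1 ▸ h.2 ▸ hq.1.not_gt)

theorem linearIndependent_root {G : SimpleGraph (Fin (n + 1))} (hG : G.IsAcyclic) :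
    LinearIndependent ℝ (fun p : edgePairs G => (root p.1.1 p.1.2 : Fin (n + 1) → ℝ)) := by
  classical
  rw [Fintype.linearIndependent_iff]
  intro g hg p
  let d : Fin (n + 1) × Fin (n + 1) → ℝ := fun q => if h : q ∈ edgePairs G then g ⟨q, h⟩ else 0
  have hd : SupportedOn d G := by
    intro q hq
    rw [← mem_edgePairs]
    by_contra h
    exact hq (by simp [d, h])
  have hc : comb d = 0 := by
    rw [comb_apply, ← hg, ← Finset.sum_subset (Finset.subset_univ (edgePairs G)),
      ← Finset.sum_coe_sort]
    · refine Finset.sum_congr rfl fun q _ => ?_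
      simp [d]
    · intro q _ hq; simp [d, hq]
  have := edgeCoeff_comb hG hd
  rw [hc, map_zero] at this
  have h1 := congrFun this p.1
  simpa [d] using h1.symm

theorem isSimplex_polytope {G : SimpleGraph (Fin (n + 1))} (hG : G.IsAcyclic)
    (halt : IsAlternating G) : IsSimplex G.edgeSet.ncard (polytope G) := by
  have hcard : Fintype.card (edgePairs G) = G.edgeSet.ncard := by
    rw [Fintype.card_coe, card_edgePairs]
  let e : Fin G.edgeSet.ncard ≃ edgePairs G := (Fintype.equivFinOfCardEq hcard).symm
  let pts : Fin (G.edgeSet.ncard + 1) → Fin (n + 1) → ℝ :=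
    Fin.cons 0 (fun k => root (e k).1.1 (e k).1.2)
  have hind : AffineIndependent ℝ pts := by
    rw [affineIndependent_iff_linearIndependent_vsub ℝ pts 0]
    have h1 := (linearIndependent_root hG).comp
      (fun i : {x : Fin (G.edgeSet.ncard + 1) // x ≠ 0} => e (i.1.pred i.2)) (by
        intro i j h
        have := e.injective h
        rw [Fin.pred_inj] at this
        exact Subtype.ext this)
    convert! h1 using 1
    funext i
    obtain ⟨k, hk⟩ := Fin.exists_succ_eq.2 i.2
    simp only [Function.comp_apply, pts, Fin.cons_zero, vsub_eq_sub, sub_zero]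
    simp only [← hk, Fin.cons_succ, Fin.pred_succ]
  refine ⟨⟨pts, hind⟩, ?_⟩
  rw [polytope_eq_convexHull halt]
  congr 1
  ext x
  simp only [pts, Fin.range_cons, Set.mem_insert_iff, Set.mem_range, Set.singleton_union,
    Set.mem_ofPred_eq]
  refine or_congr_right ⟨?_, ?_⟩
  · rintro ⟨i, j, hij, h, rfl⟩
    exact ⟨e.symm ⟨(i, j), mem_edgePairs.2 ⟨hij, h⟩⟩, by simp⟩
  · rintro ⟨k, rfl⟩
    have := mem_edgePairs.1 (e k).2
    exact ⟨_, _, this.1, this.2, rfl⟩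

theorem ncard_edgeSet_of_isTree {G : SimpleGraph (Fin (n + 1))} (hG : G.IsTree) :
    G.edgeSet.ncard = n := by
  classical
  have := hG.card_edgeFinset
  rw [Fintype.card_fin] at this
  rw [← SimpleGraph.coe_edgeFinset, Set.ncard_coe_finset]
  omega

/-! ### Relative interiors -/

/-- The segment from `y` to `x` can be prolonged beyond `x` inside `s`. If `l x ≤ 0 < l y`, then `l`
would be negative on the prolongation. -/
theorem pos_of_mem_intrinsicInterior {E : Type*} [NormedAddCommGroup E] [NormedSpace ℝ E]
    {s : Set E} {x y : E} (hx : x ∈ intrinsicInterior ℝ s) (hy : y ∈ s) (l : E →ₗ[ℝ] ℝ)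
    (hl : ∀ z ∈ s, 0 ≤ l z) (hly : 0 < l y) : 0 < l x := by
  obtain ⟨z, hz, rfl⟩ := mem_intrinsicInterior.1 hx
  have hys := subset_affineSpan ℝ s hy
  let γ : ℝ → affineSpan ℝ s := fun t =>
    ⟨AffineMap.lineMap y (z : E) t, AffineMap.lineMap_mem _ hys z.2⟩
  have hγ : Continuous γ := by
    refine Continuous.subtype_mk ?_ _
    exact AffineMap.lineMap_continuous
  have hγ1 : γ 1 = z := Subtype.ext (by simp [γ])
  have hmem : γ ⁻¹' interior ((↑) ⁻¹' s) ∈ 𝓝 (1 : ℝ) :=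
    hγ.continuousAt.preimage_mem_nhds (by rw [hγ1]; exact isOpen_interior.mem_nhds hz)
  have h2 : ∀ᶠ t in 𝓝[>] (1 : ℝ), t ∈ γ ⁻¹' interior ((↑) ⁻¹' s) := nhdsWithin_le_nhds hmem
  obtain ⟨t, ht, ht1⟩ := (h2.and self_mem_nhdsWithin).exists
  have h0 : γ t ∈ ((↑) ⁻¹' s : Set (affineSpan ℝ s)) := interior_subset ht
  have h3 := hl _ h0
  simp only [γ, AffineMap.lineMap_apply, vsub_eq_sub, vadd_eq_add, map_add, map_smul, map_sub,
    smul_eq_mul] at h3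
  have h4 : (1 : ℝ) < t := ht1
  by_contra hcon
  push Not at hcon
  nlinarith

theorem edgeCoeff_pos_of_mem_intrinsicInterior {G H : SimpleGraph (Fin (n + 1))}
    (hG : G.IsAcyclic) (hcone : cone H ≤ cone G) (hGH : G ≤ H)
    {x : Fin (n + 1) → ℝ} (hx : x ∈ intrinsicInterior ℝ (polytope H))
    {p : Fin (n + 1) × Fin (n + 1)} (hp : p.1 < p.2) (hpG : G.Adj p.1 p.2) :
    0 < edgeCoeff G x p := by
  refine pos_of_mem_intrinsicInterior hx (root_mem_polytope hp (hGH hpG))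
    ((LinearMap.proj p).comp (edgeCoeff G))
    (fun z hz => edgeCoeff_nonneg hG (hcone (mem_polytope_iff.1 hz).1) p) ?_
  have h1 := edgeCoeff_comb hG (supportedOn_single hp hpG 1)
  rw [comb_single, one_smul] at h1
  simp [h1]

/-- The affine span lies in the hyperplane of coordinate sum zero. There the strict inequalities
define an open set contained in the polytope. -/
theorem mem_intrinsicInterior_polytope {T : SimpleGraph (Fin (n + 1))} (hT : T.IsTree)
    {x : Fin (n + 1) → ℝ} (hx : ∑ v, x v = 0)
    (hpos : ∀ p : Fin (n + 1) × Fin (n + 1), p.1 < p.2 → T.Adj p.1 p.2 → 0 < edgeCoeff T x p)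
    (hh : height x < 1) : x ∈ intrinsicInterior ℝ (polytope T) := by
  have hmem : ∀ y : Fin (n + 1) → ℝ, ∑ v, y v = 0 →
      (∀ p : Fin (n + 1) × Fin (n + 1), p.1 < p.2 → T.Adj p.1 p.2 → 0 < edgeCoeff T y p) →
      height y < 1 → y ∈ polytope T := by
    intro y h1 h2 h3
    refine mem_polytope_iff.2 ⟨(mem_cone_iff_edgeCoeff hT).2 ⟨h1, fun p => ?_⟩, h3.le⟩
    by_cases hp : p.1 < p.2 ∧ T.Adj p.1 p.2
    · exact (h2 p hp.1 hp.2).le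
    · simp [edgeCoeff, hp]
  have hxs := subset_affineSpan ℝ _ (hmem x hx hpos hh)
  refine mem_intrinsicInterior.2 ⟨⟨x, hxs⟩, ?_, rfl⟩
  let U : Set (Fin (n + 1) → ℝ) := {y | ∀ p : Fin (n + 1) × Fin (n + 1), p.1 < p.2 →
    T.Adj p.1 p.2 → 0 < edgeCoeff T y p} ∩ {y | height y < 1}
  have hU : IsOpen U := by
    refine IsOpen.inter ?_ (isOpen_lt continuous_height continuous_const)
    simp only [Set.ofPred_forall]
    refine isOpen_iInter_of_finite fun p => isOpen_iInter_of_finite fun _ =>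
      isOpen_iInter_of_finite fun _ => ?_
    exact isOpen_lt continuous_const ((continuous_apply p).comp (continuous_edgeCoeff T))
  refine mem_interior.2 ⟨((↑) ⁻¹' U : Set (affineSpan ℝ (polytope T))), ?_, ?_, ?_⟩
  rotate_left
  · exact hU.preimage continuous_subtype_val
  · exact (show x ∈ U from ⟨hpos, hh⟩)
  intro y hy
  refine hmem _ ?_ hy.1 hy.2
  have hspan : affineSpan ℝ (polytope T) ≤
      (LinearMap.ker (∑ v, LinearMap.proj v : (Fin (n + 1) → ℝ) →ₗ[ℝ] ℝ)).toAffineSubspace := by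
    rw [affineSpan_le]
    intro z hz
    simpa using sum_eq_zero_of_mem_cone (mem_polytope_iff.1 hz).1
  simpa using hspan y.2

/-! ### The triangulation -/

theorem cone_le_of_mem_ncAltTrees {T S : SimpleGraph (Fin (n + 1))} (hS : S ∈ ncAltTrees T) :
    cone S ≤ cone T := by
  rw [← cone_transClosure T]
  exact cone_mono hS.1

theorem ncWeight_eq_edgeCoeff {G : SimpleGraph (Fin (n + 1))} (hG : IsNCAlt G)
    {x : Fin (n + 1) → ℝ} (hx : x ∈ cone G) : ncWeight x = edgeCoeff G x := by
  obtain ⟨d, h1, h2, rfl⟩ := mem_cone_iff.1 hx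
  rw [ncWeight_comb h1 h2 hG, edgeCoeff_comb (isAcyclic_of_isNCAlt hG) h2]

/-- On both polytopes `ncWeight` is the coefficient map. At a common interior point all edges of
either graph carry positive weight, so each graph contains the other. -/
theorem disjoint_intrinsicInterior_polytope {S S' : SimpleGraph (Fin (n + 1))} (hS : IsNCAlt S)
    (hS' : IsNCAlt S') (hne : S ≠ S') :
    Disjoint (intrinsicInterior ℝ (polytope S)) (intrinsicInterior ℝ (polytope S')) := by
  rw [Set.disjoint_left]
  intro x hx hx'
  apply hne
  have key : ∀ {A B : SimpleGraph (Fin (n + 1))}, IsNCAlt A → IsNCAlt B →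
      x ∈ intrinsicInterior ℝ (polytope A) → x ∈ intrinsicInterior ℝ (polytope B) → A ≤ B := by
    intro A B hA hB h1 h2
    have e1 := ncWeight_eq_edgeCoeff hA (mem_polytope_iff.1 (intrinsicInterior_subset h1)).1
    have e2 := ncWeight_eq_edgeCoeff hB (mem_polytope_iff.1 (intrinsicInterior_subset h2)).1
    rw [SimpleGraph_le_iff_lt]
    intro i j hij h
    have h3 := edgeCoeff_pos_of_mem_intrinsicInterior (isAcyclic_of_isNCAlt hA) le_rfl le_rfl h1
      (p := (i, j)) hij h
    rw [← e1, e2] at h3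
    exact (supportedOn_edgeCoeff B x (i, j) h3.ne').2
  exact le_antisymm (key hS hS' hx hx') (key hS' hS hx' hx)

theorem iUnion_polytope {T : SimpleGraph (Fin (n + 1))} (hT : T.IsTree) (hnc : IsNoncrossing T) :
    (⋃ S ∈ ncAltTrees T, polytope S) = polytope T := by
  apply Set.Subset.antisymm
  · refine Set.iUnion₂_subset fun S hS x hx => ?_
    rw [mem_polytope_iff] at hx ⊢
    exact ⟨cone_le_of_mem_ncAltTrees hS hx.1, hx.2⟩
  · intro x hx
    rw [mem_polytope_iff] at hx
    obtain ⟨S, hS, hle⟩ := exists_ncAltTree_of_mem_cone hT hnc hx.1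
    refine Set.mem_iUnion₂.2 ⟨S, hS, mem_polytope_iff.2 ⟨?_, hx.2⟩⟩
    obtain ⟨h1, h2, h3, _⟩ := ncWeight_of_mem_cone isUncrossable_top (cone_mono le_top hx.1)
    rw [← h3]
    exact comb_mem_cone h1 (h2.supportGraph.mono hle)

theorem eq_zero_of_height_eq_zero {x : Fin (n + 1) → ℝ} (hx : ∑ v, x v = 0)
    (h : height x = 0) : x = 0 := by
  have h1 : ∀ v, x v ≤ 0 := by
    intro v
    have := (Finset.sum_eq_zero_iff_of_nonneg (fun v _ => le_max_right (x v) 0)).1 h v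
      (Finset.mem_univ v)
    exact this ▸ le_max_left _ _
  funext v
  have := (Finset.sum_eq_zero_iff_of_nonpos (fun v _ => h1 v)).1 hx v (Finset.mem_univ v)
  simpa using this

/-- Prefix sums are nonnegative on the cone; if a convex combination of two points is zero, no pair
can carry weight in the first. -/
theorem zero_mem_extremePoints (G : SimpleGraph (Fin (n + 1))) :
    (0 : Fin (n + 1) → ℝ) ∈ (polytope G).extremePoints ℝ := by
  rw [mem_extremePoints_iff_left]
  refine ⟨zero_mem_polytope G, ?_⟩
  rintro x hx y hy ⟨a, b, ha, hb, hab, h0⟩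
  obtain ⟨d, h1, h2, rfl⟩ := mem_cone_iff.1 (mem_polytope_iff.1 hx).1
  obtain ⟨d', h1', h2', rfl⟩ := mem_cone_iff.1 (mem_polytope_iff.1 hy).1
  rw [← map_smul, ← map_smul, ← map_add] at h0
  have hlin : ∀ k : ℕ, prefixSum (comb (a • d + b • d')) k = 0 := by
    intro k; rw [h0]; simp [prefixSum]
  have hsup := (h2.smul a).add (h2'.smul b)
  have hd : d = 0 := by
    funext p
    by_contra hp
    have hp1 := (h2 p hp).1
    -- The cut right after the left end of `p` is straddled by `p`.
    have := hlin (p.1 + 1)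
    rw [prefixSum_comb (fun p hp => (hsup p hp).1)] at this
    have h3 := (Finset.sum_eq_zero_iff_of_nonneg (fun q _ => ?_)).1 this p ?_
    · have h4 : 0 < d p := lt_of_le_of_ne (h1 p) (Ne.symm hp)
      have h5 : 0 ≤ d' p := h1' p
      simp only [Pi.add_apply, Pi.smul_apply, smul_eq_mul] at h3
      nlinarith [mul_pos ha h4, mul_nonneg hb.le h5]
    · exact add_nonneg (mul_nonneg ha.le (h1 q)) (mul_nonneg hb.le (h1' q))
    · rw [Fin.lt_def] at hp1
      simp only [Finset.mem_filter, Finset.mem_univ, true_and]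
      omega
  rw [hd, map_zero]

/-- When the coordinates sum to zero, `2 * height x` is the ℓ¹ norm. So among points of height at
most 1 the functional `x i - x j` reaches its maximum 2 only at `root i j`, which makes the root a
vertex of any root polytope containing it. -/
theorem sub_le_two_mul_height {x : Fin (n + 1) → ℝ} (hx : ∑ v, x v = 0) {i j : Fin (n + 1)}
    (hij : i ≠ j) : x i - x j ≤ 2 * height x ∧ (x i - x j = 2 * height x → height x = 1 →
      x = root i j) := by
  have h1 : ∑ v, |x v| = 2 * height x := by
    have : ∀ v, |x v| = 2 * max (x v) 0 - x v := by
      intro v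
      rcases le_total 0 (x v) with h | h
      · rw [abs_of_nonneg h, max_eq_left h]; ring
      · rw [abs_of_nonpos h, max_eq_right h]; ring
    simp_rw [this, Finset.sum_sub_distrib, hx, sub_zero, ← Finset.mul_sum]
    rfl
  have h2 : |x i| + |x j| + ∑ v ∈ (univ.erase i).erase j, |x v| = 2 * height x := by
    rw [← h1, ← Finset.add_sum_erase univ _ (Finset.mem_univ i),
      ← Finset.add_sum_erase (univ.erase i) _ (Finset.mem_erase.2 ⟨hij.symm, Finset.mem_univ j⟩)]
    ring
  have h3 : 0 ≤ ∑ v ∈ (univ.erase i).erase j, |x v| := Finset.sum_nonneg fun _ _ => abs_nonneg _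
  have h4 := le_abs_self (x i)
  have h5 := neg_abs_le (x j)
  refine ⟨by linarith, fun h h6 => ?_⟩
  have h7 : ∑ v ∈ (univ.erase i).erase j, |x v| = 0 := by linarith
  have h8 : ∀ v, v ≠ i → v ≠ j → x v = 0 := by
    intro v hi hj
    have := (Finset.sum_eq_zero_iff_of_nonneg (fun v _ => abs_nonneg (x v))).1 h7 v
      (by simp [hi, hj])
    simpa using this
  have h9 : x i + x j = 0 := by
    rw [← hx, ← Finset.add_sum_erase univ _ (Finset.mem_univ i),
      ← Finset.add_sum_erase (univ.erase i) _ (Finset.mem_erase.2 ⟨hij.symm, Finset.mem_univ j⟩),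
      Finset.sum_eq_zero (s := (univ.erase i).erase j)]
    · ring
    · intro v hv
      simp only [Finset.mem_erase] at hv
      exact h8 v hv.2.1 hv.1
  funext v
  rw [root_apply]
  by_cases hi : v = i
  · subst hi; simp [hij]; linarith
  · by_cases hj : v = j
    · subst hj; simp [hi]; linarith
    · simp [hi, hj, h8 v hi hj]

theorem root_mem_extremePoints {G : SimpleGraph (Fin (n + 1))} {i j : Fin (n + 1)} (hij : i < j)
    (h : root i j ∈ polytope G) : root i j ∈ (polytope G).extremePoints ℝ := by
  rw [mem_extremePoints_iff_left]
  refine ⟨h, ?_⟩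
  rintro x hx y hy ⟨a, b, ha, hb, hab, h0⟩
  rw [mem_polytope_iff] at hx hy
  have hx1 := sub_le_two_mul_height (sum_eq_zero_of_mem_cone hx.1) hij.ne
  have hy1 := sub_le_two_mul_height (sum_eq_zero_of_mem_cone hy.1) hij.ne
  have e1 := congrFun h0 i
  have e2 := congrFun h0 j
  simp only [Pi.add_apply, Pi.smul_apply, smul_eq_mul, root_apply, hij.ne, hij.ne', if_true,
    if_false] at e1 e2
  have h3 : a * (x i - x j) + b * (y i - y j) = 2 := by linarith
  have h4 : 2 ≤ x i - x j := by
    by_contra hcon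
    push Not at hcon
    nlinarith [hx1.1, hy1.1, hx.2, hy.2]
  have h5 : height x = 1 := by linarith [hx1.1, hx.2]
  exact hx1.2 (by linarith [hx1.1]) h5

theorem extremePoints_polytope_subset {T S : SimpleGraph (Fin (n + 1))} (hS : S ∈ ncAltTrees T) :
    (polytope S).extremePoints ℝ ⊆ (polytope T).extremePoints ℝ := by
  intro x hx
  rw [polytope_eq_convexHull hS.2.2.2] at hx
  rcases extremePoints_convexHull_subset hx with h | ⟨i, j, hij, h, rfl⟩
  · rw [Set.mem_singleton_iff] at h
    rw [h]; exact zero_mem_extremePoints T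
  · refine root_mem_extremePoints hij (mem_polytope_iff.2 ⟨?_, (height_root hij.ne).le⟩)
    exact cone_le_of_mem_ncAltTrees hS (Submodule.subset_span ⟨i, j, hij, h, rfl⟩)

/-- For a common point, `ncWeight` is the coefficient map of every member, so its support consists
of common edges. -/
theorem iInter_polytope {T : SimpleGraph (Fin (n + 1))} {𝒮 : Set (SimpleGraph (Fin (n + 1)))}
    (h𝒮 : 𝒮 ⊆ ncAltTrees T) (hne : 𝒮.Nonempty) :
    (⋂ S ∈ 𝒮, polytope S) = polytope (sInf 𝒮) := by
  apply Set.Subset.antisymm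
  · intro x hx
    rw [Set.mem_iInter₂] at hx
    have hx' := fun S hS => mem_polytope_iff.1 (hx S hS)
    obtain ⟨S₀, hS₀⟩ := hne
    refine mem_polytope_iff.2 ⟨?_, (hx' S₀ hS₀).2⟩
    have hS := fun S hS => ncWeight_eq_edgeCoeff (h𝒮 hS).2.2 (hx' S hS).1
    obtain ⟨h1, h2, h3, _⟩ := ncWeight_of_mem_cone isUncrossable_top
      (cone_mono le_top (hx' S₀ hS₀).1)
    rw [← h3]
    refine comb_mem_cone h1 fun p hp => ⟨(h2 p hp).1, ?_⟩
    rw [SimpleGraph.sInf_adj_of_nonempty ⟨S₀, hS₀⟩]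
    intro S hSS
    rw [hS S hSS] at hp
    exact (supportedOn_edgeCoeff S x p hp).2
  · refine Set.subset_iInter₂ fun S hS x hx => ?_
    rw [mem_polytope_iff] at hx ⊢
    exact ⟨cone_mono (sInf_le hS) hx.1, hx.2⟩

/-- The exposing functional is minus the sum of the coefficients on the edges outside `G`. Its
maximum on the larger polytope is 0, reached exactly where these coefficients vanish. -/
theorem isExposed_polytope {G S : SimpleGraph (Fin (n + 1))} (hS : S.IsAcyclic) (hGS : G ≤ S) :
    IsExposed ℝ (polytope S) (polytope G) := by
  classical
  intro _
  let l : (Fin (n + 1) → ℝ) →ₗ[ℝ] ℝ :=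
    -∑ p, (if p ∈ edgePairs G then 0 else (LinearMap.proj p).comp (edgeCoeff S))
  have hl : ∀ x, l x = -∑ p, if p ∈ edgePairs G then 0 else edgeCoeff S x p := by
    intro x
    simp only [l, LinearMap.neg_apply, LinearMap.sum_apply]
    congr 1
    refine Finset.sum_congr rfl fun p _ => ?_
    split_ifs <;> simp
  have hnonneg : ∀ x ∈ polytope S, ∀ p, 0 ≤ if p ∈ edgePairs G then 0 else edgeCoeff S x p := by
    intro x hx p
    split_ifs
    · exact le_rfl
    · exact edgeCoeff_nonneg hS (mem_polytope_iff.1 hx).1 p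
  refine ⟨LinearMap.toContinuousLinearMap l, ?_⟩
  ext x
  simp only [LinearMap.coe_toContinuousLinearMap', Set.mem_ofPred_eq]
  constructor
  · intro hx
    rw [mem_polytope_iff] at hx
    refine ⟨mem_polytope_iff.2 ⟨cone_mono hGS hx.1, hx.2⟩, fun y hy => ?_⟩
    obtain ⟨d, _, h2, rfl⟩ := mem_cone_iff.1 hx.1
    have : l (comb d) = 0 := by
      rw [hl, edgeCoeff_comb hS (h2.mono hGS), neg_eq_zero]
      refine Finset.sum_eq_zero fun p _ => ?_
      split_ifs with hp
      · rfl
      · by_contra h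
        exact hp (mem_edgePairs.2 (h2 p h))
    rw [this, hl, neg_nonpos]
    exact Finset.sum_nonneg fun p _ => hnonneg y hy p
  · rintro ⟨hx, hmax⟩
    have h1 := hmax 0 (zero_mem_polytope S)
    rw [map_zero, hl, neg_nonneg] at h1
    have h2 := (Finset.sum_eq_zero_iff_of_nonneg (fun p _ => hnonneg x hx p)).1
      (le_antisymm h1 (Finset.sum_nonneg fun p _ => hnonneg x hx p))
    rw [mem_polytope_iff] at hx ⊢
    refine ⟨?_, hx.2⟩
    obtain ⟨d, h3, h4, rfl⟩ := mem_cone_iff.1 hx.1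
    refine comb_mem_cone h3 fun p hp => ?_
    have h5 := h2 p (Finset.mem_univ p)
    rw [edgeCoeff_comb hS h4] at h5
    by_contra h
    rw [← mem_edgePairs] at h
    rw [if_neg h] at h5
    exact hp h5

end RootPolytope

/-! ### Connected intervals, outermost edges, and the cut below an edge. -/

namespace RootPolytope

variable {m : ℕ}

/-! ### Restrictions of a noncrossing forest to intervals -/

/-- The edges of `T` within the interval `[i, j]`. -/
def restr (T : SimpleGraph (Fin m)) (i j : Fin m) : SimpleGraph (Fin m) where
  Adj a b := T.Adj a b ∧ (i ≤ a ∧ a ≤ j) ∧ i ≤ b ∧ b ≤ j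
  symm := ⟨fun _ _ h => ⟨h.1.symm, h.2.2, h.2.1⟩⟩
  loopless := ⟨fun _ h => T.irrefl h.1⟩

/-- The interval `[i, j]` is connected in `T`. -/
def ConnIn (T : SimpleGraph (Fin m)) (i j : Fin m) : Prop :=
  ∀ a b, i ≤ a → a ≤ j → i ≤ b → b ≤ j → (restr T i j).Reachable a b

/-- The edge `(p, q)` is not contained in another edge within `[i, j]`. -/
def IsOuter (T : SimpleGraph (Fin m)) (i j p q : Fin m) : Prop :=
  i ≤ p ∧ p < q ∧ q ≤ j ∧ T.Adj p q ∧
    ∀ a b, i ≤ a → a ≤ p → q ≤ b → b ≤ j → T.Adj a b → a = p ∧ b = q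

/-- The edge `(p, q)` is the only one within `[p, q]` that passes from `[p, w]` to `[w', q]`,
where `w'` is the successor of `w`, and both of these intervals are connected. -/
def IsCut (T : SimpleGraph (Fin m)) (p q w w' : Fin m) : Prop :=
  p ≤ w ∧ w'.val = w.val + 1 ∧ w' ≤ q ∧ ConnIn T p w ∧ ConnIn T w' q ∧
    ∀ a b, p ≤ a → a ≤ w → w' ≤ b → b ≤ q → T.Adj a b → a = p ∧ b = q

theorem restr_le (T : SimpleGraph (Fin m)) (i j : Fin m) : restr T i j ≤ T := fun _ _ h => h.1

theorem reachable_of_closed {V : Type*} {G H : SimpleGraph V} {C : V → Prop} {x y : V}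
    (h : G.Reachable x y) (hx : C x) (hC : ∀ u v, C u → G.Adj u v → C v ∧ H.Adj u v) :
    C y ∧ H.Reachable x y := by
  obtain ⟨w⟩ := h
  induction w with
  | nil => exact ⟨hx, SimpleGraph.Reachable.refl _⟩
  | cons h _ ih =>
    have h1 := hC _ _ hx h
    have h2 := ih h1.1
    exact ⟨h2.1, h1.2.reachable.trans h2.2⟩

theorem exists_adj_of_reachable {V : Type*} {G : SimpleGraph V} {C : V → Prop} {x y : V}
    (h : G.Reachable x y) (hx : C x) (hy : ¬ C y) :
    ∃ u v, G.Reachable x u ∧ C u ∧ ¬ C v ∧ G.Adj u v := by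
  by_contra hcon
  push Not at hcon
  refine hy (reachable_of_closed (H := G) (C := fun v => C v ∧ G.Reachable x v) h
    ⟨hx, SimpleGraph.Reachable.refl _⟩ ?_).1.1
  intro u v hu huv
  have hr := hu.2.trans huv.reachable
  refine ⟨⟨?_, hr⟩, huv⟩
  by_contra hv
  exact hcon u v hu.2 hu.1 hv huv

theorem exists_adj_across {T : SimpleGraph (Fin m)} {i j k : Fin m} (h : ConnIn T i j)
    (hik : i ≤ k) (hkj : k < j) :
    ∃ a b, i ≤ a ∧ a ≤ k ∧ k < b ∧ b ≤ j ∧ T.Adj a b := by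
  have h1 := h i j le_rfl (hik.trans hkj.le) (hik.trans hkj.le) le_rfl
  obtain ⟨u, v, _, hu, hv, huv⟩ := exists_adj_of_reachable (C := fun v => v ≤ k) h1 hik
    (not_le.2 hkj)
  exact ⟨u, v, huv.2.1.1, hu, not_le.1 hv, huv.2.2.2, huv.1⟩

theorem mem_support_restr {T : SimpleGraph (Fin m)} {i j v : Fin m} (h : ConnIn T i j)
    (hij : i < j) : v ∈ (restr T i j).support ↔ i ≤ v ∧ v ≤ j := by
  rw [SimpleGraph.mem_support]
  constructor
  · rintro ⟨w, hw⟩; exact hw.2.1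
  · rintro ⟨h1, h2⟩
    obtain ⟨u, hu1, hu2, hne⟩ : ∃ u, i ≤ u ∧ u ≤ j ∧ u ≠ v := by
      rcases eq_or_ne i v with h3 | h3
      · exact ⟨j, hij.le, le_rfl, fun h4 => hij.ne (h3.trans h4.symm)⟩
      · exact ⟨i, le_rfl, hij.le, h3⟩
    obtain ⟨x, y, _, hx, _, hxy⟩ := exists_adj_of_reachable (C := fun x => x = v)
      (h v u h1 h2 hu1 hu2) rfl hne
    exact ⟨y, hx ▸ hxy⟩

/-- A longest edge over the gap after `k` is outer, since any edge containing it would also cover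
that gap. -/
theorem exists_isOuter {T : SimpleGraph (Fin m)} {i j k : Fin m} (h : ConnIn T i j)
    (hik : i ≤ k) (hkj : k < j) : ∃ p q, IsOuter T i j p q ∧ p ≤ k ∧ k < q := by
  classical
  set E := (Finset.univ : Finset (Fin m × Fin m)).filter fun e =>
    i ≤ e.1 ∧ e.1 ≤ k ∧ k < e.2 ∧ e.2 ≤ j ∧ T.Adj e.1 e.2 with hE
  obtain ⟨a, b, hab⟩ := exists_adj_across h hik hkj
  obtain ⟨e, he, hmax⟩ := E.exists_max_image (fun e => e.2.val - e.1.val)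
    ⟨(a, b), by simpa [hE] using hab⟩
  simp only [hE, Finset.mem_filter, Finset.mem_univ, true_and, Prod.forall] at he hmax
  obtain ⟨h1, h2, h3, h4, h5⟩ := he
  refine ⟨e.1, e.2, ⟨h1, h2.trans_lt h3, h4, h5, ?_⟩, h2, h3⟩
  intro a b ha hae heb hb hab
  have := hmax a b ⟨ha, hae.trans h2, h3.trans_le heb, hb, hab⟩
  have h6 := h2.trans_lt h3
  simp only [Fin.le_def, Fin.lt_def, Fin.ext_iff] at *
  omega

theorem IsOuter.eq_of_overlap {T : SimpleGraph (Fin m)} (hnc : IsNoncrossing T)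
    {i j p q p' q' : Fin m} (h : IsOuter T i j p q) (h' : IsOuter T i j p' q')
    (h1 : p < q') (h2 : p' < q) : p = p' ∧ q = q' := by
  obtain ⟨a1, a2, a3, a4, a5⟩ := h
  obtain ⟨b1, b2, b3, b4, b5⟩ := h'
  rcases lt_trichotomy p p' with hp | hp | hp
  · rcases lt_or_ge q q' with hq | hq
    · exact absurd ⟨a4, b4⟩ (hnc p p' q q' hp h2 hq)
    · exact b5 p q a1 hp.le hq a3 a4
  · subst hp
    rcases le_total q q' with hq | hq
    · have := a5 p q' a1 le_rfl hq b3 b4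
      exact ⟨rfl, this.2.symm⟩
    · exact ⟨rfl, (b5 p q a1 le_rfl hq a3 a4).2⟩
  · rcases lt_or_ge q' q with hq | hq
    · exact absurd ⟨b4, a4⟩ (hnc p' p q' q hp h1 hq)
    · have := a5 p' q' b1 hp.le hq b3 b4
      exact ⟨this.1.symm, this.2.symm⟩

/-- Every edge of `T` within `[i, j]` is nested in or disjoint from an outer edge. -/
theorem IsOuter.nested {T : SimpleGraph (Fin m)} (hnc : IsNoncrossing T)
    {i j p q a b : Fin m} (h : IsOuter T i j p q) (hia : i ≤ a) (hbj : b ≤ j)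
    (hT : T.Adj a b) (h1 : p < b) (h2 : a < q) : p ≤ a ∧ b ≤ q := by
  obtain ⟨a1, a2, a3, a4, a5⟩ := h
  rcases lt_trichotomy p a with hp | hp | hp
  · refine ⟨hp.le, ?_⟩
    by_contra hq
    exact hnc p a q b hp h2 (not_le.1 hq) ⟨a4, hT⟩
  · refine ⟨hp.le, ?_⟩
    by_contra hq
    have := a5 a b hia hp.ge (not_le.1 hq).le hbj hT
    exact hq this.2.le
  · rcases lt_or_ge b q with hq | hq
    · exact absurd ⟨hT, a4⟩ (hnc a p b q hp h1 hq)
    · have := a5 a b hia hp.le hq hbj hT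
      exact ⟨this.1.ge, this.2.le⟩

/-- The graph of the outer edges within `[i, j]`. -/
def outerGraph (T : SimpleGraph (Fin m)) (i j : Fin m) : SimpleGraph (Fin m) where
  Adj a b := IsOuter T i j a b ∨ IsOuter T i j b a
  symm := ⟨fun _ _ h => h.symm⟩
  loopless := ⟨fun _ h => h.elim (fun h => lt_irrefl _ h.2.1) (fun h => lt_irrefl _ h.2.1)⟩

theorem outerGraph_adj_of_lt {T : SimpleGraph (Fin m)} {i j a b : Fin m} (h : a < b) :
    (outerGraph T i j).Adj a b ↔ IsOuter T i j a b :=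
  ⟨fun h' => h'.resolve_right fun h'' => lt_asymm h h''.2.1, Or.inl⟩

/-- The walk climbs along outer edges. The outer edge covering the gap after `v` starts at `v`:
otherwise it would overlap the outer edge ending at `v`, or start before `i`. -/
theorem exists_outer_walk {T : SimpleGraph (Fin m)} (hnc : IsNoncrossing T) {i j : Fin m}
    (h : ConnIn T i j) (k : ℕ) : ∀ v : Fin m, j.val - v.val = k → i ≤ v → v ≤ j →
      (v = i ∨ ∃ p, IsOuter T i j p v) →
      ∃ w : (restr T i j).Walk v j, w.IsPath ∧ (∀ u ∈ w.support, v ≤ u) ∧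
        ∀ e, e ∈ w.edges ↔ ∃ p q, IsOuter T i j p q ∧ v ≤ p ∧ e = s(p, q) := by
  induction k using Nat.strong_induction_on with
  | _ k ih =>
    intro v hk hiv hvj hv
    rcases eq_or_lt_of_le hvj with rfl | hlt
    · refine ⟨SimpleGraph.Walk.nil, SimpleGraph.Walk.IsPath.nil, by simp, ?_⟩
      intro e
      simp only [SimpleGraph.Walk.edges_nil, List.not_mem_nil, false_iff]
      rintro ⟨p, q, hpq, hp, _⟩
      exact absurd (hpq.2.1.trans_le hpq.2.2.1) hp.not_gt
    · obtain ⟨p, q, hpq, hpv, hvq⟩ := exists_isOuter h hiv hlt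
      obtain rfl : p = v := by
        rcases hv with rfl | ⟨p', hp'⟩
        · exact le_antisymm hpv hpq.1
        · by_contra hne
          have := hpq.eq_of_overlap hnc hp' (lt_of_le_of_ne hpv hne) (hp'.2.1.trans hvq)
          exact hvq.ne' this.2
      obtain ⟨w, hw1, hw2, hw3⟩ := ih (j.val - q.val)
        (by rw [Fin.lt_def] at hvq hlt; omega) q rfl (hiv.trans hvq.le) hpq.2.2.1
        (Or.inr ⟨p, hpq⟩)
      have hadj : (restr T i j).Adj p q :=
        ⟨hpq.2.2.2.1, ⟨hiv, hvj⟩, hiv.trans hvq.le, hpq.2.2.1⟩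
      refine ⟨SimpleGraph.Walk.cons hadj w, ?_, ?_, ?_⟩
      · rw [SimpleGraph.Walk.cons_isPath_iff]
        exact ⟨hw1, fun hmem => (hw2 p hmem).not_gt hvq⟩
      · intro u hu
        rw [SimpleGraph.Walk.support_cons, List.mem_cons] at hu
        rcases hu with rfl | hu
        · exact le_rfl
        · exact hvq.le.trans (hw2 u hu)
      · intro e
        rw [SimpleGraph.Walk.edges_cons, List.mem_cons, hw3]
        constructor
        · rintro (rfl | ⟨p', q', h1, h2, rfl⟩)
          · exact ⟨p, q, hpq, le_rfl, rfl⟩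
          · exact ⟨p', q', h1, hvq.le.trans h2, rfl⟩
        · rintro ⟨p', q', h1, h2, rfl⟩
          rcases lt_or_ge p' q with h3 | h3
          · obtain ⟨rfl, rfl⟩ := hpq.eq_of_overlap hnc h1 (h2.trans_lt h1.2.1) h3
            exact Or.inl rfl
          · exact Or.inr ⟨p', q', h1, h3, rfl⟩

/-- The outer edges form a path from `i` to `j`, and paths in a forest are unique. -/
theorem isMainPath_restr_iff {T P : SimpleGraph (Fin m)} (hT : T.IsAcyclic)
    (hnc : IsNoncrossing T) {i j a b : Fin m} (hij : i < j) (h : ConnIn T i j) :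
    IsMainPath (restr T i j) P a b ↔ a = i ∧ b = j ∧ P = outerGraph T i j := by
  have hl : IsLeast (restr T i j).support i :=
    ⟨(mem_support_restr h hij).2 ⟨le_rfl, hij.le⟩, fun v hv => ((mem_support_restr h hij).1 hv).1⟩
  have hg : IsGreatest (restr T i j).support j :=
    ⟨(mem_support_restr h hij).2 ⟨hij.le, le_rfl⟩, fun v hv => ((mem_support_restr h hij).1 hv).2⟩
  obtain ⟨w, hw1, -, hw3⟩ := exists_outer_walk hnc h _ i rfl le_rfl hij.le (Or.inl rfl)
  have hP : SimpleGraph.fromEdgeSet {e | e ∈ w.edges} = outerGraph T i j := by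
    ext u v
    simp only [SimpleGraph.fromEdgeSet_adj, Set.mem_ofPred_eq, hw3, outerGraph]
    constructor
    · rintro ⟨⟨p, q, h1, _, h2⟩, _⟩
      rw [Sym2.eq_iff] at h2
      rcases h2 with ⟨rfl, rfl⟩ | ⟨rfl, rfl⟩
      · exact Or.inl h1
      · exact Or.inr h1
    · rintro (h1 | h1)
      · exact ⟨⟨u, v, h1, h1.1, rfl⟩, h1.2.1.ne⟩
      · exact ⟨⟨v, u, h1, h1.1, Sym2.eq_swap⟩, h1.2.1.ne'⟩
  constructor
  · rintro ⟨ha, hb, p, hp, rfl⟩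
    obtain rfl := ha.unique hl
    obtain rfl := hb.unique hg
    refine ⟨rfl, rfl, ?_⟩
    have := ((hT.anti (restr_le T a b)).subsingleton_path a b).elim ⟨p, hp⟩ ⟨w, hw1⟩
    rw [Subtype.mk.injEq] at this
    rw [this, hP]
  · rintro ⟨rfl, rfl, rfl⟩
    exact ⟨hl, hg, w, hw1, hP.symm⟩

/-- Edges leaving `[p, q]` must leave it from `p` or `q`, or else cross `(p, q)`. Hence the vertices
of `[p, q]` not joined to `p` inside it would remain isolated from `p` in all of `[i, j]`. -/
theorem ConnIn.of_adj {T : SimpleGraph (Fin m)} (hnc : IsNoncrossing T) {i j p q : Fin m}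
    (h : ConnIn T i j) (hip : i ≤ p) (hpq : p < q) (hqj : q ≤ j) (hadj : T.Adj p q) :
    ConnIn T p q := by
  have hpq' : (restr T p q).Adj p q := ⟨hadj, ⟨le_rfl, hpq.le⟩, hpq.le, le_rfl⟩
  have key : ∀ v, p ≤ v → v ≤ q → (restr T p q).Reachable v p := by
    intro v hpv hvq
    by_contra hcon
    have := (reachable_of_closed (H := restr T i j)
      (C := fun u => p ≤ u ∧ u ≤ q ∧ ¬ (restr T p q).Reachable u p)
      (h v p (hip.trans hpv) (hvq.trans hqj) hip (hpq.le.trans hqj)) ⟨hpv, hvq, hcon⟩ ?_).1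
    · exact this.2.2 (SimpleGraph.Reachable.refl _)
    · rintro u x ⟨h1, h2, h3⟩ hux
      refine ⟨?_, hux⟩
      have hup : p < u := lt_of_le_of_ne h1 (by
        rintro rfl; exact h3 (SimpleGraph.Reachable.refl _))
      have huq : u < q := lt_of_le_of_ne h2 (by
        rintro rfl; exact h3 hpq'.symm.reachable)
      have hx1 : p ≤ x := by
        by_contra hx
        exact hnc x p u q (not_le.1 hx) hup huq ⟨hux.1.symm, hadj⟩
      have hx2 : x ≤ q := by
        by_contra hx
        exact hnc p u q x hup huq (not_le.1 hx) ⟨hadj, hux.1⟩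
      have hux' : (restr T p q).Adj u x := ⟨hux.1, ⟨h1, h2⟩, hx1, hx2⟩
      exact ⟨hx1, hx2, fun hr => h3 (hux'.reachable.trans hr)⟩
  intro a b ha1 ha2 hb1 hb2
  exact (key a ha1 ha2).trans (key b hb1 hb2).symm

/-- The edge is a bridge, so deleting it splits `[p, q]` into the components of `p` and of `q`. By
noncrossing, all vertices of the first precede all vertices of the second, so both are intervals. -/
theorem exists_isCut {T : SimpleGraph (Fin m)} (hT : T.IsAcyclic) (hnc : IsNoncrossing T)
    {i j p q : Fin m} (h : ConnIn T i j) (hip : i ≤ p) (hpq : p < q) (hqj : q ≤ j)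
    (hadj : T.Adj p q) : ∃ w w', IsCut T p q w w' := by
  classical
  have hc := h.of_adj hnc hip hpq hqj hadj
  set H := (restr T p q).deleteEdges {s(p, q)} with hH
  have hHadj : ∀ u v, H.Adj u v ↔ (restr T p q).Adj u v ∧ s(u, v) ≠ s(p, q) := by
    intro u v; rw [hH, SimpleGraph.deleteEdges_adj]; rfl
  have hnr : ¬ H.Reachable p q := by
    intro hr
    have := SimpleGraph.isAcyclic_iff_forall_adj_isBridge.1 hT hadj
    rw [SimpleGraph.isBridge_iff] at this
    refine this (hr.mono ?_)
    intro u v huv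
    rw [hHadj] at huv
    rw [SimpleGraph.deleteEdges_adj]
    exact ⟨huv.1.1, huv.2⟩
  have hdich : ∀ v, p ≤ v → v ≤ q → H.Reachable p v ∨ H.Reachable q v := by
    intro v h1 h2
    refine (reachable_of_closed (H := restr T p q)
      (C := fun v => H.Reachable p v ∨ H.Reachable q v) (hc p v le_rfl hpq.le h1 h2)
      (Or.inl (SimpleGraph.Reachable.refl _)) ?_).1
    intro u v hu huv
    refine ⟨?_, huv⟩
    by_cases he : s(u, v) = s(p, q)
    · rw [Sym2.eq_iff] at he
      rcases he with ⟨_, rfl⟩ | ⟨_, rfl⟩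
      · exact Or.inr (SimpleGraph.Reachable.refl _)
      · exact Or.inl (SimpleGraph.Reachable.refl _)
    · have := ((hHadj u v).2 ⟨huv, he⟩).reachable
      exact hu.imp (fun h => h.trans this) (fun h => h.trans this)
  have hbounds : ∀ v, H.Reachable p v → p ≤ v ∧ v ≤ q := by
    intro v hv
    exact (reachable_of_closed (H := H) (C := fun v => p ≤ v ∧ v ≤ q) hv ⟨le_rfl, hpq.le⟩
      fun u v _ huv => ⟨((hHadj u v).1 huv).1.2.2, huv⟩).1
  -- If `b` preceded `a`, some edge `(u, v)` of the first component would pass over `b`. The second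
  -- component would then be trapped strictly between `u` and `v`, whereas `v ≤ q`.
  have hlt : ∀ a b, H.Reachable p a → H.Reachable q b → p ≤ b → a < b := by
    intro a b ha hb hpb
    by_contra hcon
    have hna : ¬ H.Reachable p b := fun h => hnr (h.trans hb.symm)
    have hba : b < a := lt_of_le_of_ne (not_lt.1 hcon) (by rintro rfl; exact hna ha)
    have hpb' : p < b := lt_of_le_of_ne hpb (by
      rintro rfl; exact hna (SimpleGraph.Reachable.refl _))
    obtain ⟨u, v, hu, hub, hvb, huv⟩ :=
      exists_adj_of_reachable (C := fun v => v < b) ha hpb' hba.le.not_gt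
    have hv := hu.trans huv.reachable
    have hbv : b < v := lt_of_le_of_ne (not_lt.1 hvb) (by rintro rfl; exact hna hv)
    have hq := (reachable_of_closed (H := H) (C := fun x => u < x ∧ x < v ∧ H.Reachable q x)
      hb.symm ⟨hub, hbv, hb⟩ ?_).1
    · exact absurd (hbounds v hv).2 hq.2.1.not_ge
    · rintro x y ⟨h1, h2, h3⟩ hxy
      have hy := h3.trans hxy.reachable
      have hyn : ¬ H.Reachable p y := fun h => hnr (h.trans hy.symm)
      have hTuv := ((hHadj _ _).1 huv).1.1
      have hTxy := ((hHadj _ _).1 hxy).1.1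
      refine ⟨⟨?_, ?_, hy⟩, hxy⟩
      · by_contra hyu
        have : y ≠ u := by rintro rfl; exact hyn hu
        exact hnc y u x v (lt_of_le_of_ne (not_lt.1 hyu) this) h1 h2 ⟨hTxy.symm, hTuv⟩
      · by_contra hyv
        have : v ≠ y := by rintro rfl; exact hyn hv
        exact hnc u x v y h1 h2 (lt_of_le_of_ne (not_lt.1 hyv) this) ⟨hTuv, hTxy⟩
  obtain ⟨w, hw, hwmax⟩ := (Finset.univ.filter fun v => H.Reachable p v).exists_max_image id
    ⟨p, by simp⟩
  simp only [Finset.mem_filter, Finset.mem_univ, true_and, id] at hw hwmax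
  have hwq : w < q := hlt w q hw (SimpleGraph.Reachable.refl _) hpq.le
  have hw' : w.val + 1 < m := by have := q.2; rw [Fin.lt_def] at hwq; omega
  have hA : ∀ v, p ≤ v → v ≤ w → H.Reachable p v := by
    intro v h1 h2
    refine (hdich v h1 (h2.trans hwq.le)).resolve_right fun h3 => ?_
    exact (hlt w v hw h3 h1).not_ge h2
  have hB : ∀ v, w < v → v ≤ q → H.Reachable q v := by
    intro v h1 h2
    refine (hdich v ((hbounds w hw).1.trans h1.le) h2).resolve_left fun h3 => ?_
    exact h1.not_ge (hwmax v h3)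
  have hsucc : ∀ v : Fin m, (⟨w + 1, hw'⟩ : Fin m) ≤ v ↔ w < v := by
    intro v; exact Nat.succ_le_iff
  refine ⟨w, ⟨w + 1, hw'⟩, (hbounds w hw).1, rfl, (hsucc q).2 hwq, ?_, ?_, ?_⟩
  · have key : ∀ v, p ≤ v → v ≤ w → (restr T p w).Reachable p v := by
      intro v h1 h2
      refine (reachable_of_closed (C := fun v => H.Reachable p v) (hA v h1 h2)
        (SimpleGraph.Reachable.refl _) ?_).2
      intro x y hx hxy
      have hy := hx.trans hxy.reachable
      exact ⟨hy, ((hHadj _ _).1 hxy).1.1, ⟨(hbounds x hx).1, hwmax x hx⟩,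
        (hbounds y hy).1, hwmax y hy⟩
    intro a b ha1 ha2 hb1 hb2
    exact (key a ha1 ha2).symm.trans (key b hb1 hb2)
  · have hB' : ∀ x, H.Reachable q x → w < x ∧ x ≤ q := by
      intro x hx
      have h1 : p ≤ x ∧ x ≤ q :=
        (reachable_of_closed (H := H) (C := fun v => p ≤ v ∧ v ≤ q) hx ⟨hpq.le, le_rfl⟩
          fun u v _ huv => ⟨((hHadj u v).1 huv).1.2.2, huv⟩).1
      exact ⟨hlt w x hw hx h1.1, h1.2⟩
    have key : ∀ v, w < v → v ≤ q → (restr T ⟨w + 1, hw'⟩ q).Reachable q v := by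
      intro v h1 h2
      refine (reachable_of_closed (C := fun v => H.Reachable q v) (hB v h1 h2)
        (SimpleGraph.Reachable.refl _) ?_).2
      intro x y hx hxy
      have hy := hx.trans hxy.reachable
      exact ⟨hy, ((hHadj _ _).1 hxy).1.1, ⟨(hsucc x).2 (hB' x hx).1, (hB' x hx).2⟩,
        (hsucc y).2 (hB' y hy).1, (hB' y hy).2⟩
    intro a b ha1 ha2 hb1 hb2
    exact (key a ((hsucc a).1 ha1) ha2).symm.trans (key b ((hsucc b).1 hb1) hb2)
  · intro a b h1 h2 h3 h4 hab
    rw [hsucc] at h3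
    have ha := hA a h1 h2
    have hb := hB b h3 h4
    by_contra hne
    refine hnr ((ha.trans (SimpleGraph.Adj.reachable ?_)).trans hb.symm)
    rw [hHadj]
    refine ⟨⟨hab, ⟨h1, h2.trans hwq.le⟩, h1.trans (h2.trans h3.le), h4⟩, fun he => ?_⟩
    rw [Sym2.eq_iff] at he
    rcases he with he | he
    · exact hne he
    · exact absurd h2 (he.1 ▸ hwq.not_ge)

end RootPolytope

/-! ### Blocks as the unique minimal decomposition, and the intervals of pseudo-components. -/

namespace RootPolytope

variable {m : ℕ}

/-! ### The decomposition at the main path -/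

/-- `[c, d]` is one of the intervals into which the edges of `T` within `[i, j]` decompose after
removing the outer edges. -/
def IsBlock (T : SimpleGraph (Fin m)) (i j c d : Fin m) : Prop :=
  c < d ∧ ∃ p q w w', IsOuter T i j p q ∧ IsCut T p q w w' ∧ ((c = p ∧ d = w) ∨ (c = w' ∧ d = q))

/-- The trees into which the edges of `T` within `[i, j]` decompose after removing the outer
edges. -/
def blocks (T : SimpleGraph (Fin m)) (i j : Fin m) : Set (SimpleGraph (Fin m)) :=
  {D | ∃ c d, IsBlock T i j c d ∧ D = restr T c d}

theorem IsCut.lt {T : SimpleGraph (Fin m)} {p q w w' : Fin m} (h : IsCut T p q w w') : w < w' := by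
  have := h.2.1; rw [Fin.lt_def]; omega

theorem IsCut.le_of_lt {T : SimpleGraph (Fin m)} {p q w w' a : Fin m} (h : IsCut T p q w w')
    (ha : w < a) : w' ≤ a := by
  have := h.2.1; rw [Fin.lt_def] at ha; rw [Fin.le_def]; omega

theorem IsCut.unique {T : SimpleGraph (Fin m)} {p q w w' v v' : Fin m} (h : IsCut T p q w w')
    (h' : IsCut T p q v v') : w = v ∧ w' = v' := by
  have key : ∀ {w w' v v' : Fin m}, IsCut T p q w w' → IsCut T p q v v' → ¬ w < v := by
    intro w w' v v' h h' hlt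
    obtain ⟨a, b, h1, h2, h3, h4, h5⟩ := exists_adj_across h'.2.2.2.1 h.1 hlt
    have hvq : v < q := h'.lt.trans_le h'.2.2.1
    have := h.2.2.2.2.2 a b h1 h2 (h.le_of_lt h3) (h4.trans hvq.le) h5
    exact absurd h4 (this.2 ▸ hvq.not_ge)
  have hw : w = v := le_antisymm (not_lt.1 (key h' h)) (not_lt.1 (key h h'))
  refine ⟨hw, Fin.ext ?_⟩
  rw [h.2.1, h'.2.1, hw]

theorem IsBlock.connIn {T : SimpleGraph (Fin m)} {i j c d : Fin m} (h : IsBlock T i j c d) :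
    ConnIn T c d := by
  obtain ⟨_, p, q, w, w', _, hcut, (⟨rfl, rfl⟩ | ⟨rfl, rfl⟩)⟩ := h
  · exact hcut.2.2.2.1
  · exact hcut.2.2.2.2.1

theorem IsBlock.bounds {T : SimpleGraph (Fin m)} {i j c d : Fin m} (h : IsBlock T i j c d) :
    i ≤ c ∧ d ≤ j ∧ (i < c ∨ d < j) := by
  obtain ⟨hcd, p, q, w, w', hout, hcut, (⟨rfl, rfl⟩ | ⟨rfl, rfl⟩)⟩ := h
  · have : d < j := hcut.lt.trans_le (hcut.2.2.1.trans hout.2.2.1)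
    exact ⟨hout.1, this.le, Or.inr this⟩
  · have : i < c := (hout.1.trans hcut.1).trans_lt hcut.lt
    exact ⟨this.le, hout.2.2.1, Or.inl this⟩

theorem IsBlock.eq_of_common_edge {T : SimpleGraph (Fin m)} (hnc : IsNoncrossing T)
    {i j c d c' d' a b : Fin m} (h : IsBlock T i j c d) (h' : IsBlock T i j c' d') (hab : a < b)
    (hca : c ≤ a) (hbd : b ≤ d) (hca' : c' ≤ a) (hbd' : b ≤ d') : c = c' ∧ d = d' := by
  obtain ⟨_, p, q, w, w', hout, hcut, hc⟩ := h
  obtain ⟨_, p', q', v, v', hout', hcut', hc'⟩ := h'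
  have hb : p ≤ a ∧ b ≤ q := by
    rcases hc with ⟨rfl, rfl⟩ | ⟨rfl, rfl⟩
    · exact ⟨hca, hbd.trans (hcut.lt.le.trans hcut.2.2.1)⟩
    · exact ⟨(hcut.1.trans hcut.lt.le).trans hca, hbd⟩
  have hb' : p' ≤ a ∧ b ≤ q' := by
    rcases hc' with ⟨rfl, rfl⟩ | ⟨rfl, rfl⟩
    · exact ⟨hca', hbd'.trans (hcut'.lt.le.trans hcut'.2.2.1)⟩
    · exact ⟨(hcut'.1.trans hcut'.lt.le).trans hca', hbd'⟩
  obtain ⟨rfl, rfl⟩ := hout.eq_of_overlap hnc hout' (hb.1.trans_lt (hab.trans_le hb'.2))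
    (hb'.1.trans_lt (hab.trans_le hb.2))
  obtain ⟨rfl, rfl⟩ := hcut.unique hcut'
  have := hcut.lt
  rcases hc with ⟨rfl, rfl⟩ | ⟨rfl, rfl⟩ <;> rcases hc' with ⟨rfl, rfl⟩ | ⟨rfl, rfl⟩
  · exact ⟨rfl, rfl⟩
  · exact absurd (hca'.trans (hab.le.trans hbd)) this.not_ge
  · exact absurd (hca.trans (hab.le.trans hbd')) this.not_ge
  · exact ⟨rfl, rfl⟩

theorem isSubtree_restr {T : SimpleGraph (Fin m)} (hT : T.IsAcyclic) {c d : Fin m} (hcd : c < d)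
    (h : ConnIn T c d) : IsSubtree (restr T c d) := by
  have key : ∀ {u v : Fin m} (_ : (restr T c d).Walk u v) (hu : u ∈ (restr T c d).support)
      (hv : v ∈ (restr T c d).support),
      ((restr T c d).induce (restr T c d).support).Reachable ⟨u, hu⟩ ⟨v, hv⟩ := by
    intro u v w
    induction w with
    | nil => exact fun _ _ => SimpleGraph.Reachable.refl _
    | cons h _ ih =>
      rename_i a b c' _
      intro hu hv
      have hb : b ∈ (restr T c d).support := ⟨a, h.symm⟩
      have : ((restr T c d).induce (restr T c d).support).Adj ⟨a, hu⟩ ⟨b, hb⟩ := h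
      exact this.reachable.trans (ih hb hv)
  have : Nonempty (restr T c d).support := ⟨⟨c, (mem_support_restr h hcd).2 ⟨le_rfl, hcd.le⟩⟩⟩
  refine ⟨⟨?_⟩, (hT.anti (restr_le T c d)).induce _⟩
  rintro ⟨u, hu⟩ ⟨v, hv⟩
  have h1 := (mem_support_restr h hcd).1 hu
  have h2 := (mem_support_restr h hcd).1 hv
  obtain ⟨w⟩ := h u v h1.1 h1.2 h2.1 h2.2
  exact key w hu hv

theorem mem_support_outerGraph {T : SimpleGraph (Fin m)} (hnc : IsNoncrossing T)
    {i j p q v : Fin m} (h : IsOuter T i j p q) (hv : v ∈ (outerGraph T i j).support)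
    (h1 : p < v) (h2 : v < q) : False := by
  obtain ⟨x, hx | hx⟩ := hv
  · have := h.eq_of_overlap hnc hx (h1.trans hx.2.1) h2
    exact h1.ne this.1
  · have := h.eq_of_overlap hnc hx h1 (hx.2.1.trans h2)
    exact h2.ne this.2.symm

/-- A non-outer edge lies under some outer edge and cannot cross its cut, because only the outer
edge itself does. -/
theorem exists_block_of_adj {T : SimpleGraph (Fin m)} (hT : T.IsAcyclic) (hnc : IsNoncrossing T)
    {i j : Fin m} (h : ConnIn T i j) {a b : Fin m} (hab : a < b) (hia : i ≤ a) (hbj : b ≤ j)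
    (hadj : T.Adj a b) (hno : ¬ IsOuter T i j a b) :
    ∃ c d, IsBlock T i j c d ∧ c ≤ a ∧ b ≤ d := by
  obtain ⟨p, q, hout, hpa, haq⟩ := exists_isOuter h hia (hab.trans_le hbj)
  obtain ⟨_, hbq⟩ := hout.nested hnc hia hbj hadj (hpa.trans_lt hab) haq
  obtain ⟨w, w', hcut⟩ := exists_isCut hT hnc h hout.1 hout.2.1 hout.2.2.1 hout.2.2.2.1
  rcases le_or_gt b w with hbw | hbw
  · exact ⟨p, w, ⟨hpa.trans_lt (hab.trans_le hbw), p, q, w, w', hout, hcut, Or.inl ⟨rfl, rfl⟩⟩,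
      hpa, hbw⟩
  · rcases le_or_gt a w with haw | haw
    · have := hcut.2.2.2.2.2 a b hpa haw (hcut.le_of_lt hbw) hbq hadj
      exact absurd (this.1 ▸ this.2 ▸ hout) hno
    · exact ⟨w', q, ⟨(hcut.le_of_lt haw).trans_lt (hab.trans_le hbq), p, q, w, w', hout, hcut,
        Or.inr ⟨rfl, rfl⟩⟩, hcut.le_of_lt haw, hbq⟩

theorem IsBlock.not_isOuter {T : SimpleGraph (Fin m)} (hnc : IsNoncrossing T)
    {i j c d a b : Fin m} (h : IsBlock T i j c d) (hca : c ≤ a) (hbd : b ≤ d) (hab : a < b) :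
    ¬ IsOuter T i j a b := by
  intro ho
  obtain ⟨_, p, q, w, w', hout, hcut, hc⟩ := h
  have hw := hcut.lt
  rcases hc with ⟨rfl, rfl⟩ | ⟨rfl, rfl⟩
  · have hbq : b < q := hbd.trans_lt (hw.trans_le hcut.2.2.1)
    have := ho.eq_of_overlap hnc hout (hab.trans hbq) (hca.trans_lt hab)
    exact hbq.ne this.2
  · have hpa : p < a := (hcut.1.trans_lt hw).trans_le hca
    have := ho.eq_of_overlap hnc hout (hab.trans_le hbd) (hpa.trans hab)
    exact hpa.ne' this.1

theorem isDecomposition_blocks {T : SimpleGraph (Fin m)} (hT : T.IsAcyclic)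
    (hnc : IsNoncrossing T) {i j : Fin m} (h : ConnIn T i j) :
    IsDecomposition (restr T i j) (outerGraph T i j) (blocks T i j) := by
  refine ⟨?_, ?_, ?_, ?_⟩
  · rintro _ ⟨c, d, hb, rfl⟩
    exact isSubtree_restr hT hb.1 hb.connIn
  · rintro _ ⟨c, d, hb, rfl⟩ _ ⟨c', d', hb', rfl⟩ hne
    simp only [Function.onFun, id]
    rw [disjoint_iff_inf_le, SimpleGraph_le_iff_lt]
    rintro a b hab ⟨h1, h2⟩
    apply hne
    obtain ⟨rfl, rfl⟩ := hb.eq_of_common_edge hnc hb' hab h1.2.1.1 h1.2.2.2 h2.2.1.1 h2.2.2.2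
    rfl
  · have key : ∀ a b, a < b → ((sSup (blocks T i j)).Adj a b ↔
        (restr T i j \ outerGraph T i j).Adj a b) := by
      intro a b hab
      rw [SimpleGraph.sSup_adj, SimpleGraph.sdiff_adj, outerGraph_adj_of_lt hab]
      constructor
      · rintro ⟨_, ⟨c, d, hb, rfl⟩, hadj⟩
        obtain ⟨h1, h2, _⟩ := hb.bounds
        refine ⟨⟨hadj.1, ⟨h1.trans hadj.2.1.1, hadj.2.1.2.trans h2⟩, h1.trans hadj.2.2.1,
          hadj.2.2.2.trans h2⟩, hb.not_isOuter hnc hadj.2.1.1 hadj.2.2.2 hab⟩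
      · rintro ⟨hadj, hno⟩
        obtain ⟨c, d, hb, h1, h2⟩ :=
          exists_block_of_adj hT hnc h hab hadj.2.1.1 hadj.2.2.2 hadj.1 hno
        exact ⟨_, ⟨c, d, hb, rfl⟩, hadj.1, ⟨h1, hab.le.trans h2⟩, h1.trans hab.le, h2⟩
    apply le_antisymm
    · rw [SimpleGraph_le_iff_lt]; exact fun a b hab h => (key a b hab).1 h
    · rw [SimpleGraph_le_iff_lt]; exact fun a b hab h => (key a b hab).2 h
  · rintro _ ⟨c, d, hb, rfl⟩ v hvP hv
    have hbd := hb.connIn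
    rw [mem_support_restr hbd hb.1] at hv
    obtain ⟨hcd, p, q, w, w', hout, hcut, hc⟩ := hb
    have hw := hcut.lt
    rcases hc with ⟨rfl, rfl⟩ | ⟨rfl, rfl⟩
    · left
      have : v = c := by
        by_contra hne
        exact mem_support_outerGraph hnc hout hvP (lt_of_le_of_ne hv.1 (Ne.symm hne))
          (hv.2.trans_lt (hw.trans_le hcut.2.2.1))
      subst this
      exact ⟨(mem_support_restr hbd hcd).2 hv, fun u hu => ((mem_support_restr hbd hcd).1 hu).1⟩
    · right
      have : v = d := by
        by_contra hne
        exact mem_support_outerGraph hnc hout hvP ((hcut.1.trans_lt hw).trans_le hv.1)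
          (lt_of_le_of_ne hv.2 hne)
      subst this
      exact ⟨(mem_support_restr hbd hcd).2 hv, fun u hu => ((mem_support_restr hbd hcd).1 hu).2⟩

theorem IsSubtree.exists_adj {D : SimpleGraph (Fin m)} (h : IsSubtree D) :
    ∃ a b, a < b ∧ D.Adj a b := by
  obtain ⟨u, v, huv⟩ := h.connected.nonempty
  rcases lt_or_gt_of_ne huv.ne with h1 | h1
  · exact ⟨u, v, h1, huv⟩
  · exact ⟨v, u, h1, huv.symm⟩

theorem IsSubtree.support_closed {D : SimpleGraph (Fin m)} (h : IsSubtree D) {C : Fin m → Prop}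
    {x : Fin m} (hx : x ∈ D.support) (hCx : C x) (hC : ∀ u v, C u → D.Adj u v → C v) :
    ∀ v ∈ D.support, C v := by
  intro v hv
  exact (reachable_of_closed (H := D.induce D.support) (C := fun v => C v.1)
    (h.connected.preconnected ⟨x, hx⟩ ⟨v, hv⟩) hCx fun a b ha hab => ⟨hC _ _ ha hab, hab⟩).1

/-- A tree of any decomposition stays in the block of one of its edges. To leave across the cut it
would need the deleted outer edge. To leave at the other end it must pass through a vertex of the
main path, which would be neither its least nor its greatest vertex. -/
theorem exists_block_ge {T : SimpleGraph (Fin m)} (hT : T.IsAcyclic)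
    (hnc : IsNoncrossing T) {i j : Fin m} (h : ConnIn T i j) {𝒟 : Set (SimpleGraph (Fin m))}
    (h𝒟 : IsDecomposition (restr T i j) (outerGraph T i j) 𝒟) {D : SimpleGraph (Fin m)}
    (hD : D ∈ 𝒟) : ∃ B ∈ blocks T i j, D ≤ B := by
  obtain ⟨hsub, _, hsup, hends⟩ := h𝒟
  have hDle : D ≤ restr T i j \ outerGraph T i j := hsup ▸ le_sSup hD
  obtain ⟨a, b, hab, hadj⟩ := (hsub D hD).exists_adj
  have hR := hDle hadj
  rw [SimpleGraph.sdiff_adj, outerGraph_adj_of_lt hab] at hR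
  obtain ⟨c, d, hb, hca, hbd⟩ :=
    exists_block_of_adj hT hnc h hab hR.1.2.1.1 hR.1.2.2.2 hR.1.1 hR.2
  refine ⟨_, ⟨c, d, hb, rfl⟩, ?_⟩
  have ha : a ∈ D.support := ⟨b, hadj⟩
  have hbs : b ∈ D.support := ⟨a, hadj.symm⟩
  have hcl : ∀ v ∈ D.support, c ≤ v ∧ v ≤ d := by
    refine (hsub D hD).support_closed ha ⟨hca, hab.le.trans hbd⟩ ?_
    rintro x y ⟨hx1, hx2⟩ hxy
    have hxs : x ∈ D.support := ⟨y, hxy⟩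
    have hys : y ∈ D.support := ⟨x, hxy.symm⟩
    have hRxy := hDle hxy
    obtain ⟨⟨hTxy, ⟨hix, hxj⟩, hiy, hyj⟩, hno⟩ := hRxy
    obtain ⟨hcd, p, q, w, w', hout, hcut, hc⟩ := hb
    have hw := hcut.lt
    have hp : p ∈ (outerGraph T i j).support := ⟨q, Or.inl hout⟩
    have hq : q ∈ (outerGraph T i j).support := ⟨p, Or.inr hout⟩
    rcases hc with ⟨rfl, rfl⟩ | ⟨rfl, rfl⟩
    · have hdq : d < q := hw.trans_le hcut.2.2.1
      have hcy : c ≤ y := by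
        by_contra hyc
        rcases eq_or_lt_of_le hx1 with rfl | hx1
        · rcases hends D hD c hp hxs with h1 | h1
          · exact hyc (h1.2 hys)
          · exact absurd (h1.2 hbs) (hca.trans_lt hab).not_ge
        · exact hyc (hout.nested hnc hiy hxj hTxy.symm hx1
            (((not_le.1 hyc).trans hx1).trans (hx2.trans_lt hdq))).1
      refine ⟨hcy, ?_⟩
      by_contra hyd
      have hyd := not_le.1 hyd
      have hyq : y ≤ q := (hout.nested hnc hix hyj hTxy ((hx1.trans hx2).trans_lt hyd)
        (hx2.trans_lt hdq)).2
      obtain ⟨rfl, rfl⟩ := hcut.2.2.2.2.2 x y hx1 hx2 (hcut.le_of_lt hyd) hyq hTxy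
      exact hno (Or.inl hout)
    · have hpc : p < c := hcut.1.trans_lt hw
      have hyd : y ≤ d := by
        by_contra hyc
        rcases eq_or_lt_of_le hx2 with rfl | hx2
        · rcases hends D hD x hq hxs with h1 | h1
          · exact absurd (h1.2 ha) (hab.trans_le hbd).not_ge
          · exact hyc (h1.2 hys)
        · exact hyc (hout.nested hnc hix hyj hTxy
            ((hpc.trans_le hx1).trans (hx2.trans (not_le.1 hyc))) hx2).2
      refine ⟨?_, hyd⟩
      by_contra hyc
      have hyw : y ≤ w := by
        by_contra hyw; exact hyc (hcut.le_of_lt (not_le.1 hyw))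
      have hpy : p ≤ y := (hout.nested hnc hiy hxj hTxy.symm (hpc.trans_le hx1)
        ((not_le.1 hyc).trans_le (hx1.trans hx2))).1
      obtain ⟨rfl, rfl⟩ := hcut.2.2.2.2.2 y x hpy hyw hx1 hx2 hTxy.symm
      exact hno (Or.inr hout)
  intro x y hxy
  exact ⟨(hDle hxy).1.1, hcl x ⟨y, hxy⟩, hcl y ⟨x, hxy.symm⟩⟩

theorem IsDecomposition.exists_mem_of_adj {H P : SimpleGraph (Fin m)}
    {𝒟 𝒟' : Set (SimpleGraph (Fin m))} (h : IsDecomposition H P 𝒟) (h' : IsDecomposition H P 𝒟')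
    {D : SimpleGraph (Fin m)} (hD : D ∈ 𝒟) {a b : Fin m} (hab : D.Adj a b) :
    ∃ D' ∈ 𝒟', D'.Adj a b := by
  have : (sSup 𝒟').Adj a b := by
    rw [h'.2.2.1, ← h.2.2.1]
    exact SimpleGraph.sSup_adj.2 ⟨D, hD, hab⟩
  exact SimpleGraph.sSup_adj.1 this

theorem IsDecomposition.eq_of_adj {H P : SimpleGraph (Fin m)}
    {𝒟 : Set (SimpleGraph (Fin m))} (h : IsDecomposition H P 𝒟)
    {D D' : SimpleGraph (Fin m)} (hD : D ∈ 𝒟) (hD' : D' ∈ 𝒟) {a b : Fin m} (hab : D.Adj a b)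
    (hab' : D'.Adj a b) : D = D' := by
  by_contra hne
  have := disjoint_iff_inf_le.1 (h.2.1 hD hD' hne)
  exact this ⟨hab, hab'⟩

/-- If every tree of a second decomposition is contained in a tree of the first one, then the
first one has the least possible number of trees among the two. -/
theorem IsDecomposition.ncard_le {H P : SimpleGraph (Fin m)}
    {𝒟 𝒟' : Set (SimpleGraph (Fin m))} (h : IsDecomposition H P 𝒟) (h' : IsDecomposition H P 𝒟')
    (hle : ∀ D' ∈ 𝒟', ∃ D ∈ 𝒟, D' ≤ D) :
    𝒟.ncard ≤ 𝒟'.ncard ∧ (𝒟'.ncard ≤ 𝒟.ncard → 𝒟' = 𝒟) := by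
  classical
  choose! f hf hfle using hle
  have himg : f '' 𝒟' = 𝒟 := by
    apply Set.Subset.antisymm
    · rintro _ ⟨D', hD', rfl⟩; exact hf D' hD'
    · intro D hD
      obtain ⟨a, b, _, hab⟩ := (h.1 D hD).exists_adj
      obtain ⟨D', hD', hab'⟩ := h.exists_mem_of_adj h' hD hab
      exact ⟨D', hD', h.eq_of_adj (hf D' hD') hD (hfle D' hD' hab') hab⟩
  have hfin : 𝒟'.Finite := Set.toFinite _
  refine ⟨himg ▸ Set.ncard_image_le hfin, fun hcard => ?_⟩
  have hinj : Set.InjOn f 𝒟' :=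
    Set.injOn_of_ncard_image_eq (le_antisymm (Set.ncard_image_le hfin) (himg.symm ▸ hcard)) hfin
  have heq : ∀ D' ∈ 𝒟', f D' = D' := by
    intro D' hD'
    refine le_antisymm ?_ (hfle D' hD')
    intro a b hab
    obtain ⟨D'', hD'', hab''⟩ := h.exists_mem_of_adj h' (hf D' hD') hab
    have h1 := h.eq_of_adj (hf D'' hD'') (hf D' hD') (hfle D'' hD'' hab'') hab
    exact hinj hD'' hD' h1 ▸ hab''
  rw [← himg]
  ext D
  constructor
  · intro hD; exact ⟨D, hD, heq D hD⟩
  · rintro ⟨D', hD', rfl⟩; rwa [heq D' hD']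

/-- Every decomposition refines the blocks. So the blocks have the least number of members, and a
refinement with equally many members is equal to them. -/
theorem isMinDecomposition_restr_iff {T : SimpleGraph (Fin m)} (hT : T.IsAcyclic)
    (hnc : IsNoncrossing T) {i j : Fin m} (h : ConnIn T i j) {𝒟 : Set (SimpleGraph (Fin m))} :
    IsMinDecomposition (restr T i j) (outerGraph T i j) 𝒟 ↔ 𝒟 = blocks T i j := by
  have hb := isDecomposition_blocks hT hnc h
  constructor
  · rintro ⟨h1, h2⟩
    exact (hb.ncard_le h1 fun D hD => exists_block_ge hT hnc h h1 hD).2 (h2 _ hb)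
  · rintro rfl
    exact ⟨hb, fun 𝒟' h' => (hb.ncard_le h' fun D hD => exists_block_ge hT hnc h h' hD).1⟩

/-! ### Pseudo-components -/

/-- The interval `[i, j]` is connected, and the edges leaving it to one side pass over it unless
the endpoint on that side has an edge in this direction. -/
structure IsPseudoInterval (T : SimpleGraph (Fin m)) (i j : Fin m) : Prop where
  lt : i < j
  conn : ConnIn T i j
  right : (∀ s, j < s → ¬ T.Adj j s) → ∀ x y, T.Adj x y → x ≤ j → j < y → x ≤ i
  left : (∀ s, s < i → ¬ T.Adj s i) → ∀ x y, T.Adj x y → x < i → i ≤ y → j ≤ y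

/-- An edge leaving the block is stopped either by the outer edge above it or by the cut. The one
remaining exception, an edge at the common end of the block and the outer edge, is excluded by the
hypotheses in `right` and `left`. -/
theorem IsBlock.isPseudoInterval {T : SimpleGraph (Fin m)}
    (hnc : IsNoncrossing T) {i j c d : Fin m} (h : IsBlock T i j c d) :
    IsPseudoInterval T c d := by
  refine ⟨h.1, h.connIn, ?_, ?_⟩
  · intro hs x y hxy hxd hdy
    obtain ⟨hcd, p, q, w, w', hout, hcut, hc⟩ := h
    have hw := hcut.lt
    rcases hc with ⟨rfl, rfl⟩ | ⟨rfl, rfl⟩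
    · by_contra hcx
      have hcx := not_le.1 hcx
      have hyq : y ≤ q := by
        by_contra hyq
        exact hnc c x q y hcx (hxd.trans_lt (hw.trans_le hcut.2.2.1)) (not_le.1 hyq)
          ⟨hout.2.2.2.1, hxy⟩
      exact hcx.ne' (hcut.2.2.2.2.2 x y hcx.le hxd (hcut.le_of_lt hdy) hyq hxy).1
    · have hxd : x < d := lt_of_le_of_ne hxd (by rintro rfl; exact hs y hdy hxy)
      by_contra hcx
      exact hnc p x d y ((hcut.1.trans_lt hw).trans (not_le.1 hcx)) hxd hdy ⟨hout.2.2.2.1, hxy⟩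
  · intro hs x y hxy hxc hcy
    obtain ⟨hcd, p, q, w, w', hout, hcut, hc⟩ := h
    have hw := hcut.lt
    rcases hc with ⟨rfl, rfl⟩ | ⟨rfl, rfl⟩
    · have hcy : c < y := lt_of_le_of_ne hcy (by rintro rfl; exact hs x hxc hxy)
      by_contra hyd
      exact hnc x c y q hxc hcy ((not_le.1 hyd).trans (hw.trans_le hcut.2.2.1))
        ⟨hxy, hout.2.2.2.1⟩
    · by_contra hyd
      have hyd := not_le.1 hyd
      have hpx : p ≤ x := by
        by_contra hpx
        exact hnc x p y d (not_le.1 hpx) ((hcut.1.trans_lt hw).trans_le hcy) hyd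
          ⟨hxy, hout.2.2.2.1⟩
      have hxw : x ≤ w := by
        by_contra hxw; exact absurd (hcut.le_of_lt (not_le.1 hxw)) hxc.not_ge
      exact hyd.ne (hcut.2.2.2.2.2 x y hpx hxw hcy hyd.le hxy).2

/-- The recursion stays among restrictions of `T` to intervals, because main paths and minimal
decompositions of such restrictions are known explicitly. -/
theorem IsPseudoComponent.isPseudoInterval {T H Q : SimpleGraph (Fin m)} (hT : T.IsAcyclic)
    (hnc : IsNoncrossing T) {a b : Fin m} (h : IsPseudoComponent H Q a b) :
    ∀ i j, H = restr T i j → IsPseudoInterval T i j → IsPseudoInterval T a b := by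
  induction h with
  | main hP =>
    rintro i j rfl hij
    obtain ⟨rfl, rfl, _⟩ := (isMainPath_restr_iff hT hnc hij.lt hij.conn).1 hP
    exact hij
  | sub hP h𝒟 hD _ ih =>
    rintro i j rfl hij
    obtain ⟨rfl, rfl, rfl⟩ := (isMainPath_restr_iff hT hnc hij.lt hij.conn).1 hP
    rw [isMinDecomposition_restr_iff hT hnc hij.conn] at h𝒟
    rw [h𝒟] at hD
    obtain ⟨c, d, hb, rfl⟩ := hD
    exact ih c d rfl (hb.isPseudoInterval hnc)

theorem isPseudoComponent_of_block {T Q : SimpleGraph (Fin m)} (hT : T.IsAcyclic)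
    (hnc : IsNoncrossing T) {i j c d a b : Fin m} (hij : i < j) (h : ConnIn T i j)
    (hb : IsBlock T i j c d) (hQ : IsPseudoComponent (restr T c d) Q a b) :
    IsPseudoComponent (restr T i j) Q a b :=
  .sub ((isMainPath_restr_iff hT hnc hij h).2 ⟨rfl, rfl, rfl⟩)
    ((isMinDecomposition_restr_iff hT hnc h).2 rfl) ⟨c, d, hb, rfl⟩ hQ

end RootPolytope

/-! ### Canonical forests expressed by inequalities between prefix sums. -/

namespace RootPolytope

open Finset

variable {n : ℕ}

/-! ### Canonical forests and interior points -/

/-- The difference of the two sums is the weight of the pairs ending at `j` and starting at or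
before `i`. -/
theorem nestSum_lt_iff_right {d : Fin (n + 1) × Fin (n + 1) → ℝ} (hd : 0 ≤ d)
    (i j : Fin (n + 1)) :
    nestSum d (i + 1) (j + 1) < nestSum d (i + 1) j ↔ ∃ a, a ≤ i ∧ d (a, j) ≠ 0 := by
  have hsplit : nestSum d (i + 1) j = nestSum d (i + 1) (j + 1) +
      ∑ a ∈ univ.filter (fun a => a ≤ i), d (a, j) := by
    have h1 : ∑ a ∈ univ.filter (fun a => a ≤ i), d (a, j) =
        ∑ e : Fin (n + 1) × Fin (n + 1), if e.1 ≤ i ∧ e.2 = j then d e else 0 := by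
      rw [Fintype.sum_prod_type, Finset.sum_filter]
      refine Finset.sum_congr rfl fun a _ => ?_
      rw [Finset.sum_eq_single j]
      · simp
      · intro b _ hb; simp [hb]
      · simp
    rw [h1]
    simp only [nestSum, Finset.sum_filter, ← Finset.sum_add_distrib]
    refine Finset.sum_congr rfl fun e _ => ?_
    simp only [Fin.le_def, Fin.ext_iff]
    split_ifs <;> first | omega | simp
  rw [hsplit, lt_add_iff_pos_right,
    Finset.sum_pos_iff_of_nonneg (f := fun a => d (a, j)) fun a _ => hd _]
  simp only [Finset.mem_filter, Finset.mem_univ, true_and]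
  exact exists_congr fun a => and_congr_right fun _ => (hd (a, j)).lt_iff_ne.trans ne_comm

theorem nestSum_lt_iff_left {d : Fin (n + 1) × Fin (n + 1) → ℝ} (hd : 0 ≤ d)
    (i j : Fin (n + 1)) :
    nestSum d i j < nestSum d (i + 1) j ↔ ∃ b, j ≤ b ∧ d (i, b) ≠ 0 := by
  have hsplit : nestSum d (i + 1) j = nestSum d i j +
      ∑ b ∈ univ.filter (fun b => j ≤ b), d (i, b) := by
    have h1 : ∑ b ∈ univ.filter (fun b => j ≤ b), d (i, b) =
        ∑ e : Fin (n + 1) × Fin (n + 1), if e.1 = i ∧ j ≤ e.2 then d e else 0 := by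
      rw [Fintype.sum_prod_type_right, Finset.sum_filter]
      refine Finset.sum_congr rfl fun a _ => ?_
      rw [Finset.sum_eq_single i]
      · simp
      · intro b _ hb; simp [hb]
      · simp
    rw [h1]
    simp only [nestSum, Finset.sum_filter, ← Finset.sum_add_distrib]
    refine Finset.sum_congr rfl fun e _ => ?_
    simp only [Fin.le_def, Fin.ext_iff]
    split_ifs <;> first | omega | simp
  rw [hsplit, lt_add_iff_pos_right,
    Finset.sum_pos_iff_of_nonneg (f := fun b => d (i, b)) fun a _ => hd _]
  simp only [Finset.mem_filter, Finset.mem_univ, true_and]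
  exact exists_congr fun b => and_congr_right fun _ => (hd (i, b)).lt_iff_ne.trans ne_comm

section Weights

variable {F : SimpleGraph (Fin (n + 1))} {d : Fin (n + 1) × Fin (n + 1) → ℝ}

/-- With `nestSum` rewritten as a minimum of prefix sums, such an edge exists exactly when adding
the cut after `j` to the range `[i + 1, j]` strictly lowers the minimum. -/
theorem exists_adj_right_iff (hFn : IsNCAlt F) (hd0 : 0 ≤ d) (hd : SupportedOn d F)
    (hfull : ∀ p : Fin (n + 1) × Fin (n + 1), p.1 < p.2 → F.Adj p.1 p.2 → d p ≠ 0)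
    {i j : Fin (n + 1)} (hij : i < j) :
    (∃ i₁, i₁ ≤ i ∧ F.Adj i₁ j) ↔
      ∀ k : ℕ, i.val < k → k ≤ j.val → prefixSum (comb d) (j + 1) < prefixSum (comb d) k := by
  rw [Fin.lt_def] at hij
  have h1 := nestSum_lt_iff_right hd0 i j
  rw [nestSum_eq_minPrefix hd0 hd hFn (by omega), nestSum_eq_minPrefix hd0 hd hFn (by omega),
    minPrefix_succ_right _ (by omega), min_lt_iff, or_iff_right (lt_irrefl _),
    lt_minPrefix_iff _ (by omega)] at h1
  rw [show (∃ i₁, i₁ ≤ i ∧ F.Adj i₁ j) ↔ ∃ a, a ≤ i ∧ d (a, j) ≠ 0 from exists_congr fun a =>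
    and_congr_right fun ha => ⟨fun h => hfull (a, j) (ha.trans_lt hij) h, fun h => (hd _ h).2⟩, ← h1]
  exact Iff.rfl

theorem exists_adj_left_iff (hFn : IsNCAlt F) (hd0 : 0 ≤ d) (hd : SupportedOn d F)
    (hfull : ∀ p : Fin (n + 1) × Fin (n + 1), p.1 < p.2 → F.Adj p.1 p.2 → d p ≠ 0)
    {i j : Fin (n + 1)} (hij : i < j) :
    (∃ j₁, j ≤ j₁ ∧ F.Adj i j₁) ↔
      ∀ k : ℕ, i.val < k → k ≤ j.val → prefixSum (comb d) i < prefixSum (comb d) k := by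
  rw [Fin.lt_def] at hij
  have h1 := nestSum_lt_iff_left hd0 i j
  rw [nestSum_eq_minPrefix hd0 hd hFn (by omega), nestSum_eq_minPrefix hd0 hd hFn (by omega),
    minPrefix_succ_left _ (by omega), min_lt_iff, or_iff_left (lt_irrefl _),
    lt_minPrefix_iff _ (by omega)] at h1
  rw [show (∃ j₁, j ≤ j₁ ∧ F.Adj i j₁) ↔ ∃ b, j ≤ b ∧ d (i, b) ≠ 0 from exists_congr fun b =>
    and_congr_right fun hb => ⟨fun h => hfull (i, b) (lt_of_lt_of_le hij hb) h,
      fun h => (hd _ h).2⟩, ← h1]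
  exact Iff.rfl

theorem adj_zero_last_iff (hn : 1 ≤ n) (hFn : IsNCAlt F) (hd0 : 0 ≤ d) (hd : SupportedOn d F)
    (hfull : ∀ p : Fin (n + 1) × Fin (n + 1), p.1 < p.2 → F.Adj p.1 p.2 → d p ≠ 0) :
    F.Adj 0 (Fin.last n) ↔ ∀ k : ℕ, 1 ≤ k → k ≤ n → 0 < prefixSum (comb d) k := by
  have h0 : (0 : Fin (n + 1)) < Fin.last n := by rw [Fin.lt_def, Fin.val_last]; exact hn
  have h1 := exists_adj_right_iff hFn hd0 hd hfull h0
  rw [Fin.val_last, prefixSum_last, sum_comb_univ] at h1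
  rw [show F.Adj 0 (Fin.last n) ↔ ∃ i₁, i₁ ≤ (0 : Fin (n + 1)) ∧ F.Adj i₁ (Fin.last n) by simp, h1]
  exact Iff.rfl

end Weights

theorem prefixSum_comb_eq_add {d : Fin (n + 1) × Fin (n + 1) → ℝ} (hd : ∀ p, d p ≠ 0 → p.1 < p.2)
    {e : Fin (n + 1) × Fin (n + 1)} {k l : ℕ} (hk : e.1.val < k ∧ k ≤ e.2.val)
    (hl : ¬ (e.1.val < l ∧ l ≤ e.2.val))
    (h : ∀ p, d p ≠ 0 → p ≠ e → ((p.1.val < k ∧ k ≤ p.2.val) ↔ (p.1.val < l ∧ l ≤ p.2.val))) :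
    prefixSum (comb d) k = d e + prefixSum (comb d) l := by
  rw [prefixSum_comb hd, prefixSum_comb hd]
  have h1 : d e = ∑ p, if p = e then d p else 0 := by simp
  rw [h1, Finset.sum_filter, Finset.sum_filter, ← Finset.sum_add_distrib]
  refine Finset.sum_congr rfl fun p _ => ?_
  by_cases hp : d p = 0
  · simp [hp]
  · by_cases hpe : p = e
    · subst hpe; simp [hk, hl]
    · simp [hpe, h p hp hpe]

theorem connIn_univ {T : SimpleGraph (Fin (n + 1))} (hT : T.Connected) :
    ConnIn T 0 (Fin.last n) := by
  intro a b _ _ _ _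
  refine (hT.preconnected a b).mono fun u v h => ⟨h, ⟨Fin.zero_le _, Fin.le_last _⟩,
    Fin.zero_le _, Fin.le_last _⟩

theorem restr_univ (T : SimpleGraph (Fin (n + 1))) : restr T 0 (Fin.last n) = T := by
  refine le_antisymm (restr_le _ _ _) fun u v h => ⟨h, ⟨Fin.zero_le _, Fin.le_last _⟩,
    Fin.zero_le _, Fin.le_last _⟩

/-- The edges of `T` leaving the interval `[i, j]` leave it at `j` or pass over it to `j`. -/
def IsLeftInterval {m : ℕ} (T : SimpleGraph (Fin m)) (i j : Fin m) : Prop :=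
  (∀ x y, T.Adj x y → x < i → i ≤ y → j ≤ y) ∧ ∀ x y, T.Adj x y → i ≤ x → x < j → y ≤ j

/-- The edges of `T` leaving the interval `[i, j]` leave it at `i` or pass over it to `i`. -/
def IsRightInterval {m : ℕ} (T : SimpleGraph (Fin m)) (i j : Fin m) : Prop :=
  (∀ x y, T.Adj x y → x ≤ j → j < y → x ≤ i) ∧ ∀ x y, T.Adj x y → x < i → i < y → j < y

/-- The sides are exchanged: a block at the left end of its outer edge can be left to the right only
from that end, so it is a right interval, and symmetrically. -/
theorem IsBlock.left_or_right {m : ℕ} {T : SimpleGraph (Fin m)} (hnc : IsNoncrossing T)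
    {i j c d : Fin m} (h : IsBlock T i j c d) : IsLeftInterval T c d ∨ IsRightInterval T c d := by
  obtain ⟨hcd, p, q, w, w', hout, hcut, hc⟩ := h
  have hw := hcut.lt
  have hpq := hout.2.2.2.1
  rcases hc with ⟨rfl, rfl⟩ | ⟨rfl, rfl⟩
  · right
    have hdq := hw.trans_le hcut.2.2.1
    constructor
    · intro x y hxy hxd hdy
      by_contra hcx
      have hcx := not_le.1 hcx
      have hyq : y ≤ q := by
        by_contra hyq
        exact hnc c x q y hcx (hxd.trans_lt hdq) (not_le.1 hyq) ⟨hpq, hxy⟩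
      exact hcx.ne' (hcut.2.2.2.2.2 x y hcx.le hxd (hcut.le_of_lt hdy) hyq hxy).1
    · intro x y hxy hxc hcy
      by_contra hyd
      exact hnc x c y q hxc hcy ((not_lt.1 hyd).trans_lt hdq) ⟨hxy, hpq⟩
  · left
    have hpc := hcut.1.trans_lt hw
    constructor
    · intro x y hxy hxc hcy
      by_contra hyd
      have hyd := not_le.1 hyd
      have hpx : p ≤ x := by
        by_contra hpx
        exact hnc x p y d (not_le.1 hpx) (hpc.trans_le hcy) hyd ⟨hxy, hpq⟩
      have hxw : x ≤ w := by
        by_contra hxw; exact absurd (hcut.le_of_lt (not_le.1 hxw)) hxc.not_ge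
      exact hyd.ne (hcut.2.2.2.2.2 x y hpx hxw hcy hyd.le hxy).2
    · intro x y hxy hcx hxd
      by_contra hyd
      exact hnc p x d y (hpc.trans_le hcx) hxd (not_le.1 hyd) ⟨hpq, hxy⟩

theorem IsOuter.eq_of_cut {m : ℕ} {T : SimpleGraph (Fin m)} (hnc : IsNoncrossing T)
    {i j p q w w' a b : Fin m} (h : IsOuter T i j p q) (hcut : IsCut T p q w w') (hia : i ≤ a)
    (hbj : b ≤ j) (haw : a ≤ w) (hwb : w' ≤ b) (hab : T.Adj a b) : a = p ∧ b = q := by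
  have hw := hcut.lt
  obtain ⟨h1, h2⟩ := h.nested hnc hia hbj hab ((hcut.1.trans_lt hw).trans_le hwb)
    (haw.trans_lt (hw.trans_le hcut.2.2.1))
  exact hcut.2.2.2.2.2 a b h1 haw hwb h2 hab

/-- For an outer edge of `[i, j]`, the other edges of `T` over its cut pass over the whole interval.
They are the edges over the cut `i` for a left interval, over `j + 1` for a right interval, and none
for the full interval. The coefficient is thus a difference of prefix sums, made positive by the
condition at the pseudo-component on `[i, j]`. All other edges lie in blocks, handled by induction
on the length. -/
theorem edgeCoeff_pos_of_prefixSum {T : SimpleGraph (Fin (n + 1))} (hT : T.IsTree)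
    (hnc : IsNoncrossing T) {x : Fin (n + 1) → ℝ} (hx : ∑ v, x v = 0)
    (h0 : ∀ k : ℕ, 1 ≤ k → k ≤ n → 0 < prefixSum x k)
    (hright : ∀ Q i j, IsRightPseudoComponent T Q i j → i < j →
      ∀ k : ℕ, i.val < k → k ≤ j.val → prefixSum x (j + 1) < prefixSum x k)
    (hleft : ∀ Q i j, IsLeftPseudoComponent T Q i j → i < j →
      ∀ k : ℕ, i.val < k → k ≤ j.val → prefixSum x i < prefixSum x k) (k : ℕ) :
    ∀ i j : Fin (n + 1), j.val - i.val = k → i < j → ConnIn T i j →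
      (∀ Q a b, IsPseudoComponent (restr T i j) Q a b → IsPseudoComponent T Q a b) →
      ((i = 0 ∧ j = Fin.last n) ∨ IsLeftInterval T i j ∨ IsRightInterval T i j) →
      ∀ a b, i ≤ a → a < b → b ≤ j → T.Adj a b → 0 < edgeCoeff T x (a, b) := by
  induction k using Nat.strong_induction_on with
  | _ k ih =>
    intro i j hk hij hconn hpc htype a b hia hab hbj hadj
    by_cases hout : IsOuter T i j a b
    · obtain ⟨w, w', hcut⟩ := exists_isCut hT.isAcyclic hnc hconn hout.1 hout.2.1 hout.2.2.1 hadj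
      have hw := hcut.lt
      have hwval := hcut.2.1
      have haw := hcut.1
      have hwb := hcut.2.2.1
      have hmain := hpc _ i j (.main
        ((isMainPath_restr_iff hT.isAcyclic hnc hij hconn).2 ⟨rfl, rfl, rfl⟩))
      have hsupp := supportedOn_edgeCoeff T x
      -- The reference cut `l` is to be straddled by the same edges as the cut at `w'`, except for
      -- `(a, b)`.
      have hpre : ∀ l : ℕ, ¬ (a.val < l ∧ l ≤ b.val) →
          (∀ p q : Fin (n + 1), p < q → T.Adj p q → ¬ (p = a ∧ q = b) →
            ((p.val < w'.val ∧ w'.val ≤ q.val) ↔ (p.val < l ∧ l ≤ q.val))) →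
          prefixSum x w' = edgeCoeff T x (a, b) + prefixSum x l := by
        intro l hl h
        have := prefixSum_comb_eq_add (d := edgeCoeff T x) (e := (a, b)) (k := w') (l := l)
          (fun p hp => (hsupp p hp).1) ?_ hl ?_
        · rwa [comb_edgeCoeff hT hx] at this
        · simp only [Fin.le_def] at haw hwb
          simp only; omega
        · rintro ⟨p, q⟩ hp hne
          exact h p q (hsupp _ hp).1 (hsupp _ hp).2 fun hh => hne (Prod.ext hh.1 hh.2)
      have hcross : ∀ p q : Fin (n + 1), T.Adj p q → ¬ (p = a ∧ q = b) → i ≤ p → q ≤ j →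
          p.val < w'.val → w'.val ≤ q.val → False := by
        intro p q hpq hne hip hqj h1 h2
        exact hne (hout.eq_of_cut hnc hcut hip hqj (Fin.le_def.2 (by omega)) (Fin.le_def.2 h2) hpq)
      rcases htype with ⟨rfl, rfl⟩ | htype | htype
      · have h1 := hpre 0 (by omega) (fun p q _ hpq hne => ⟨fun h => (hcross p q hpq hne
          (Fin.zero_le _) (Fin.le_last _) h.1 h.2).elim, fun h => by omega⟩)
        rw [prefixSum_zero, add_zero] at h1
        rw [← h1]
        exact h0 _ (by omega) (by have := w'.2; omega)
      · have h1 := hpre i (by rw [Fin.le_def] at hia; omega) (fun p q hpq hTpq hne => ?_)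
        · have h2 := hleft _ i j ⟨hmain, fun s hs hTs => hij.not_ge (htype.1 s i hTs hs le_rfl)⟩ hij
            w' (by simp only [Fin.le_def] at hia haw; omega)
            (by simp only [Fin.le_def] at hbj hwb; omega)
          linarith
        · constructor
          · rintro ⟨h1, h2⟩
            by_contra hcon
            have hip : i ≤ p := by
              rw [Fin.le_def]; simp only [Fin.le_def] at hia haw; omega
            have hqj : q ≤ j := htype.2 p q hTpq hip (by
              rw [Fin.lt_def]; simp only [Fin.le_def] at hbj hwb; omega)
            exact hcross p q hTpq hne hip hqj h1 h2
          · rintro ⟨h1, h2⟩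
            have := htype.1 p q hTpq h1 h2
            simp only [Fin.le_def] at this hia haw hbj hwb
            omega
      · have h1 := hpre (j + 1) (by rw [Fin.le_def] at hbj; omega) (fun p q hpq hTpq hne => ?_)
        · have h2 := hright _ i j ⟨hmain, fun s hs hTs => hij.not_ge (htype.1 j s hTs le_rfl hs)⟩
            hij w' (by simp only [Fin.le_def] at hia haw; omega)
            (by simp only [Fin.le_def] at hbj hwb; omega)
          linarith
        · constructor
          · rintro ⟨h1, h2⟩
            by_contra hcon
            have hqj : q ≤ j := by
              rw [Fin.le_def]; simp only [Fin.le_def] at hbj hwb; omega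
            have hip : i ≤ p := by
              by_contra hip
              have := htype.2 p q hTpq (not_le.1 hip) (by
                rw [Fin.lt_def]; simp only [Fin.le_def] at hia haw; omega)
              exact this.not_ge hqj
            exact hcross p q hTpq hne hip hqj h1 h2
          · rintro ⟨h1, h2⟩
            have := htype.1 p q hTpq (Fin.le_def.2 (by omega)) (Fin.lt_def.2 (by omega))
            simp only [Fin.le_def] at this hia haw hbj hwb
            omega
    · obtain ⟨c, d, hb, hca, hbd⟩ :=
        exists_block_of_adj hT.isAcyclic hnc hconn hab hia hbj hadj hout
      have hbounds := hb.bounds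
      have hcd := hb.1
      refine ih (d.val - c.val) ?_ c d rfl hb.1 hb.connIn
        (fun Q a b hQ => hpc Q a b (isPseudoComponent_of_block hT.isAcyclic hnc hij hconn hb hQ))
        (Or.inr (hb.left_or_right hnc)) a b hca hab hbd hadj
      simp only [Fin.le_def, Fin.lt_def] at hbounds hcd
      omega

/-- The right side says that the relative interior of `cone F` consists of interior directions of
`cone T`. Membership is first turned into prefix-sum inequalities. These make all `T`-coefficients
positive by recursion over the blocks; conversely, positive coefficients give each inequality by
comparing which edges of `T` straddle the two cuts. -/
theorem mem_canonicalForests_iff {T : SimpleGraph (Fin (n + 1))} (hn : 1 ≤ n) (hT : T.IsTree)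
    (hnc : IsNoncrossing T) {F : SimpleGraph (Fin (n + 1))} (hF : F ≤ transClosure T)
    (hFn : IsNCAlt F) {d : Fin (n + 1) × Fin (n + 1) → ℝ} (hd0 : 0 ≤ d) (hd : SupportedOn d F)
    (hfull : ∀ p : Fin (n + 1) × Fin (n + 1), p.1 < p.2 → F.Adj p.1 p.2 → d p ≠ 0) :
    F ∈ canonicalForests T ↔
      ∀ p : Fin (n + 1) × Fin (n + 1), p.1 < p.2 → T.Adj p.1 p.2 →
        0 < edgeCoeff T (comb d) p := by
  have hx := sum_comb_univ d
  have h0 : (0 : Fin (n + 1)) < Fin.last n := by rw [Fin.lt_def, Fin.val_last]; exact hn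
  have hconn := connIn_univ hT.connected
  have hroot : IsPseudoInterval T 0 (Fin.last n) :=
    ⟨h0, hconn, fun _ x y _ _ h => absurd (Fin.le_last y) h.not_ge,
      fun _ x y _ h => absurd (Fin.zero_le x) h.not_ge⟩
  have hpi : ∀ {Q i j}, IsPseudoComponent T Q i j → IsPseudoInterval T i j := by
    intro Q i j h
    exact h.isPseudoInterval hT.isAcyclic hnc 0 (Fin.last n) (restr_univ T).symm hroot
  have hchar : F ∈ canonicalForests T ↔ (∀ k : ℕ, 1 ≤ k → k ≤ n → 0 < prefixSum (comb d) k) ∧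
      (∀ Q i j, IsRightPseudoComponent T Q i j → i < j →
        ∀ k : ℕ, i.val < k → k ≤ j.val → prefixSum (comb d) (j + 1) < prefixSum (comb d) k) ∧
      (∀ Q i j, IsLeftPseudoComponent T Q i j → i < j →
        ∀ k : ℕ, i.val < k → k ≤ j.val → prefixSum (comb d) i < prefixSum (comb d) k) := by
    rw [← adj_zero_last_iff hn hFn hd0 hd hfull]
    constructor
    · rintro ⟨_, _, _, _, h1, h2, h3⟩
      exact ⟨h1, fun Q i j h hij => (exists_adj_right_iff hFn hd0 hd hfull hij).1 (h2 Q i j h),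
        fun Q i j h hij => (exists_adj_left_iff hFn hd0 hd hfull hij).1 (h3 Q i j h)⟩
    · rintro ⟨h1, h2, h3⟩
      exact ⟨hF, isAcyclic_of_isNCAlt hFn, hFn.1, hFn.2, h1,
        fun Q i j h => (exists_adj_right_iff hFn hd0 hd hfull (hpi h.1).lt).2
          (h2 Q i j h (hpi h.1).lt),
        fun Q i j h => (exists_adj_left_iff hFn hd0 hd hfull (hpi h.1).lt).2
          (h3 Q i j h (hpi h.1).lt)⟩
  rw [hchar]
  constructor
  · rintro ⟨h1, h2, h3⟩ ⟨a, b⟩ hab hadj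
    exact edgeCoeff_pos_of_prefixSum hT hnc hx h1 h2 h3 _ 0 (Fin.last n) rfl h0 hconn
      (fun Q a b h => by rwa [restr_univ] at h) (Or.inl ⟨rfl, rfl⟩) a b (Fin.zero_le _) hab
      (Fin.le_last _) hadj
  · intro hpos
    have hsupp := supportedOn_edgeCoeff T (comb d)
    have hnn : ∀ p, 0 ≤ edgeCoeff T (comb d) p := by
      intro p
      by_cases hp : p.1 < p.2 ∧ T.Adj p.1 p.2
      · exact (hpos p hp.1 hp.2).le
      · simp [edgeCoeff, hp]
    -- If every edge of `T` over `l` is also over `k`, and some edge `e` is over `k` only,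
    -- positivity makes the prefix sum at `k` strictly larger.
    have hcmp : ∀ (l k : ℕ) (e : Fin (n + 1) × Fin (n + 1)), e.1 < e.2 → T.Adj e.1 e.2 →
        e.1.val < k → k ≤ e.2.val → ¬ (e.1.val < l ∧ l ≤ e.2.val) →
        (∀ p : Fin (n + 1) × Fin (n + 1), p.1 < p.2 → T.Adj p.1 p.2 → p.1.val < l → l ≤ p.2.val →
          p.1.val < k ∧ k ≤ p.2.val) → prefixSum (comb d) l < prefixSum (comb d) k := by
      intro l k e he1 he2 hk1 hk2 hl h
      rw [← comb_edgeCoeff hT hx, prefixSum_comb (fun p hp => (hsupp p hp).1),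
        prefixSum_comb (fun p hp => (hsupp p hp).1), Finset.sum_filter, Finset.sum_filter]
      refine Finset.sum_lt_sum (fun p _ => ?_) ⟨e, Finset.mem_univ e, ?_⟩
      · by_cases hp : edgeCoeff T (comb d) p = 0
        · simp [hp]
        · have hp' := hsupp p hp
          split_ifs with h1 h2 h2
          · exact le_rfl
          · exact absurd (h p hp'.1 hp'.2 h1.1 h1.2) h2
          · exact hnn p
          · exact le_rfl
      · rw [if_neg hl, if_pos ⟨hk1, hk2⟩]
        exact hpos e he1 he2
    refine ⟨?_, ?_, ?_⟩
    · intro k hk1 hkn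
      -- The cut `k` lies just after the vertex `k - 1`; connectedness yields an edge over it.
      obtain ⟨a, b, _, ha, hb, _, hab⟩ := exists_adj_across hconn (k := ⟨k - 1, by omega⟩)
        (Fin.zero_le _) (by rw [Fin.lt_def, Fin.val_last]; simp only; omega)
      rw [Fin.le_def] at ha
      rw [Fin.lt_def] at hb
      simp only at ha hb
      have := hcmp 0 k (a, b) (show a < b from Fin.lt_def.2 (by omega)) hab (by simp only; omega)
        (by simp only; omega) (by simp only; omega) (fun p _ _ h => by omega)
      rwa [prefixSum_zero] at this
    · intro Q i j h hij k hik hkj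
      have hI := hpi h.1
      obtain ⟨a, b, _, ha, hb, hbj, hab⟩ := exists_adj_across hI.conn (k := ⟨k - 1, by omega⟩)
        (Fin.le_def.2 (by simp only; omega)) (Fin.lt_def.2 (by simp only; omega))
      simp only [Fin.le_def, Fin.lt_def] at ha hb hbj
      refine hcmp (j + 1) k (a, b) (show a < b from Fin.lt_def.2 (by omega)) hab (by simp only; omega)
        (by simp only; omega) (by simp only; omega) ?_
      intro p _ hTp h1 h2
      have := hI.right h.2 p.1 p.2 hTp (Fin.le_def.2 (by omega)) (Fin.lt_def.2 (by omega))
      rw [Fin.le_def] at this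
      omega
    · intro Q i j h hij k hik hkj
      have hI := hpi h.1
      obtain ⟨a, b, hia, ha, hb, hbj, hab⟩ := exists_adj_across hI.conn (k := ⟨k - 1, by omega⟩)
        (Fin.le_def.2 (by simp only; omega)) (Fin.lt_def.2 (by simp only; omega))
      simp only [Fin.le_def, Fin.lt_def] at ha hb hbj hia
      refine hcmp i k (a, b) (show a < b from Fin.lt_def.2 (by omega)) hab (by simp only; omega)
        (by simp only; omega) (by simp only; omega) ?_
      intro p _ hTp h1 h2
      have := hI.left h.2 p.1 p.2 hTp (Fin.lt_def.2 (by omega)) (Fin.le_def.2 (by omega))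
      rw [Fin.le_def] at this
      omega

end RootPolytope

/-! ### Faces that meet the interior of the polytope. -/

namespace RootPolytope

open Finset Filter Topology

variable {n : ℕ}

/-! ### Faces meeting the interior -/

open Classical in
/-- The weight `1` on every edge of `F`. -/
noncomputable def edgeInd (F : SimpleGraph (Fin (n + 1))) (p : Fin (n + 1) × Fin (n + 1)) : ℝ :=
  if p ∈ edgePairs F then 1 else 0

theorem edgeInd_nonneg (F : SimpleGraph (Fin (n + 1))) : 0 ≤ edgeInd F := by
  intro p; unfold edgeInd; split_ifs <;> simp

theorem supportedOn_edgeInd (F : SimpleGraph (Fin (n + 1))) : SupportedOn (edgeInd F) F := by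
  intro p hp
  rw [← mem_edgePairs]
  by_contra h
  exact hp (by simp [edgeInd, h])

theorem edgeInd_of_adj {F : SimpleGraph (Fin (n + 1))} {p : Fin (n + 1) × Fin (n + 1)}
    (h : p.1 < p.2) (hF : F.Adj p.1 p.2) : edgeInd F p = 1 := by
  simp [edgeInd, mem_edgePairs, h, hF]

theorem isNCAlt_of_mem_canonicalForests {T F : SimpleGraph (Fin (n + 1))}
    (hF : F ∈ canonicalForests T) : IsNCAlt F := ⟨hF.2.2.1, hF.2.2.2.1⟩

theorem edgeCoeff_pos_of_mem_canonicalForests {T F : SimpleGraph (Fin (n + 1))} (hn : 1 ≤ n)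
    (hT : T.IsTree) (hnc : IsNoncrossing T) (hF : F ∈ canonicalForests T)
    {d : Fin (n + 1) × Fin (n + 1) → ℝ} (hd0 : 0 ≤ d) (hd : SupportedOn d F)
    (hfull : ∀ p : Fin (n + 1) × Fin (n + 1), p.1 < p.2 → F.Adj p.1 p.2 → d p ≠ 0)
    {p : Fin (n + 1) × Fin (n + 1)} (hp : p.1 < p.2) (hpT : T.Adj p.1 p.2) :
    0 < edgeCoeff T (comb d) p :=
  (mem_canonicalForests_iff hn hT hnc hF.1 (isNCAlt_of_mem_canonicalForests hF) hd0 hd hfull).1 hF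
    p hp hpT

/-- The given point may lie on a proper face of `cone F`. Adding `edgeInd F` gives full support, and
the `T`-coefficients do not decrease. -/
theorem mem_canonicalForests_of_mem_cone {T F : SimpleGraph (Fin (n + 1))} (hn : 1 ≤ n)
    (hT : T.IsTree) (hnc : IsNoncrossing T) (hF : F ≤ transClosure T) (hFn : IsNCAlt F)
    {x : Fin (n + 1) → ℝ} (hx : x ∈ cone F)
    (hpos : ∀ p : Fin (n + 1) × Fin (n + 1), p.1 < p.2 → T.Adj p.1 p.2 → 0 < edgeCoeff T x p) :
    F ∈ canonicalForests T := by
  obtain ⟨d, h1, h2, rfl⟩ := mem_cone_iff.1 hx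
  refine (mem_canonicalForests_iff hn hT hnc hF hFn (add_nonneg h1 (edgeInd_nonneg F))
    (h2.add (supportedOn_edgeInd F)) ?_).2 ?_
  · intro p hp hpF
    have : 0 ≤ d p := h1 p
    rw [Pi.add_apply, edgeInd_of_adj hp hpF]
    positivity
  · intro p hp hpT
    rw [map_add, map_add]
    have h3 : comb (edgeInd F) ∈ cone T := by
      rw [← cone_transClosure]
      exact comb_mem_cone (edgeInd_nonneg F) ((supportedOn_edgeInd F).mono hF)
    exact add_pos_of_pos_of_nonneg (hpos p hp hpT) (edgeCoeff_nonneg hT.isAcyclic h3 p)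

theorem le_supportGraph {F : SimpleGraph (Fin (n + 1))} {d : Fin (n + 1) × Fin (n + 1) → ℝ}
    (h : ∀ p : Fin (n + 1) × Fin (n + 1), p.1 < p.2 → F.Adj p.1 p.2 → d p ≠ 0) :
    F ≤ supportGraph d := by
  rw [SimpleGraph_le_iff_lt]
  intro i j hij hF
  exact (supportGraph_adj_of_lt hij).2 (h (i, j) hij hF)

theorem ncWeight_comb_edgeInd {F : SimpleGraph (Fin (n + 1))} (hF : IsNCAlt F) :
    ncWeight (comb (edgeInd F)) = edgeInd F :=
  ncWeight_comb (edgeInd_nonneg F) (supportedOn_edgeInd F) hF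

theorem exists_ncAltTree_ge {T F : SimpleGraph (Fin (n + 1))} (hT : T.IsTree)
    (hnc : IsNoncrossing T) (hF : F ≤ transClosure T) (hFn : IsNCAlt F) :
    ∃ S ∈ ncAltTrees T, F ≤ S := by
  have h3 : comb (edgeInd F) ∈ cone T := by
    rw [← cone_transClosure]
    exact comb_mem_cone (edgeInd_nonneg F) ((supportedOn_edgeInd F).mono hF)
  obtain ⟨S, hS, hle⟩ := exists_ncAltTree_of_mem_cone hT hnc h3
  refine ⟨S, hS, le_trans (le_supportGraph fun p hp hpF => ?_) hle⟩
  rw [ncWeight_comb_edgeInd hFn, edgeInd_of_adj hp hpF]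
  exact one_ne_zero

/-- Suppose all trees above `F` share an edge `(i, j)` not in `F`. Moving a little from the interior
point `comb (edgeInd F)` in the direction `-root i j` stays in `cone T` and keeps the edges of `F`
in the support. The new point then lies in the cone of a tree above `F`, although its coefficient at
`(i, j)` is negative. -/
theorem sInf_ncAltTrees_ge {T F : SimpleGraph (Fin (n + 1))} (hn : 1 ≤ n) (hT : T.IsTree)
    (hnc : IsNoncrossing T) (hF : F ∈ canonicalForests T) :
    sInf {S | S ∈ ncAltTrees T ∧ F ≤ S} = F := by
  have hFn := isNCAlt_of_mem_canonicalForests hF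
  have hne : {S | S ∈ ncAltTrees T ∧ F ≤ S}.Nonempty := by
    obtain ⟨S, hS, hle⟩ := exists_ncAltTree_ge hT hnc hF.1 hFn
    exact ⟨S, hS, hle⟩
  refine le_antisymm ?_ (le_sInf fun S hS => hS.2)
  rw [SimpleGraph_le_iff_lt]
  intro i j hij hadj
  rw [SimpleGraph.sInf_adj_of_nonempty hne] at hadj
  by_contra hFij
  let y : ℝ → Fin (n + 1) → ℝ := fun t => comb (edgeInd F - t • Pi.single (i, j) 1)
  have hcomb : Continuous (comb (n := n)) := LinearMap.continuous_of_finiteDimensional _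
  have hy : Continuous y := hcomb.comp (by fun_prop)
  have hy0 : y 0 = comb (edgeInd F) := by simp [y]
  have h1 : ∀ᶠ t in 𝓝[>] (0 : ℝ), ∀ p : Fin (n + 1) × Fin (n + 1), p.1 < p.2 → T.Adj p.1 p.2 →
      0 < edgeCoeff T (y t) p := by
    rw [eventually_all]
    intro p
    by_cases hp : p.1 < p.2 ∧ T.Adj p.1 p.2
    · have h2 : Tendsto (fun t => edgeCoeff T (y t) p) (𝓝[>] 0)
          (𝓝 (edgeCoeff T (comb (edgeInd F)) p)) := by
        have := ((continuous_apply p).comp ((continuous_edgeCoeff T).comp hy)).tendsto 0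
        simp only [Function.comp_apply, hy0] at this
        exact this.mono_left nhdsWithin_le_nhds
      have h3 := edgeCoeff_pos_of_mem_canonicalForests hn hT hnc hF (edgeInd_nonneg F)
        (supportedOn_edgeInd F) (fun p hp hpF => by rw [edgeInd_of_adj hp hpF]; exact one_ne_zero)
        hp.1 hp.2
      filter_upwards [h2.eventually_const_lt h3] with t ht _ _
      exact ht
    · exact Eventually.of_forall fun _ h1 h2 => absurd ⟨h1, h2⟩ hp
  have h2 : ∀ᶠ t in 𝓝[>] (0 : ℝ), ∀ p : Fin (n + 1) × Fin (n + 1), p.1 < p.2 → F.Adj p.1 p.2 →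
      ncWeight (y t) p ≠ 0 := by
    rw [eventually_all]
    intro p
    by_cases hp : p.1 < p.2 ∧ F.Adj p.1 p.2
    · have h2 : Tendsto (fun t => ncWeight (y t) p) (𝓝[>] 0) (𝓝 (edgeInd F p)) := by
        have := ((continuous_apply p).comp (continuous_ncWeight.comp hy)).tendsto 0
        simp only [Function.comp_apply, hy0, ncWeight_comb_edgeInd hFn] at this
        exact this.mono_left nhdsWithin_le_nhds
      rw [edgeInd_of_adj hp.1 hp.2] at h2
      filter_upwards [h2.eventually_ne one_ne_zero] with t ht _ _
      exact ht
    · exact Eventually.of_forall fun _ h1 h2 => absurd ⟨h1, h2⟩ hp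
  obtain ⟨t, ⟨ht1, ht2⟩, ht0⟩ := ((h1.and h2).and self_mem_nhdsWithin).exists
  have ht0 : (0 : ℝ) < t := ht0
  have hyT : y t ∈ cone T := by
    refine (mem_cone_iff_edgeCoeff hT).2 ⟨sum_comb_univ _, fun p => ?_⟩
    by_cases hp : p.1 < p.2 ∧ T.Adj p.1 p.2
    · exact (ht1 p hp.1 hp.2).le
    · simp [edgeCoeff, hp]
  obtain ⟨S, hS, hle⟩ := exists_ncAltTree_of_mem_cone hT hnc hyT
  have hFS : F ≤ S := (le_supportGraph ht2).trans hle
  have hSij : S.Adj i j := hadj S ⟨hS, hFS⟩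
  have hyS : y t ∈ cone S := by
    obtain ⟨h1, h2, h3, _⟩ := ncWeight_of_mem_cone isUncrossable_top (cone_mono le_top hyT)
    rw [← h3]
    exact comb_mem_cone h1 (h2.supportGraph.mono hle)
  have h4 := edgeCoeff_nonneg hS.2.1.isAcyclic hyS (i, j)
  have h5 : SupportedOn (edgeInd F - t • Pi.single (i, j) 1) S :=
    ((supportedOn_edgeInd F).mono hFS).sub
      ((supportedOn_single (p := (i, j)) hij hSij 1).smul t)
  simp only [y] at h4
  rw [edgeCoeff_comb hS.2.1.isAcyclic h5] at h4
  have h6 : edgeInd F (i, j) = 0 := by simp [edgeInd, mem_edgePairs, hFij]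
  simp [h6] at h4
  linarith

theorem interior_faces {T : SimpleGraph (Fin (n + 1))} (hn : 1 ≤ n) (hT : T.IsTree)
    (hnc : IsNoncrossing T) :
    {I : Set (Fin (n + 1) → ℝ) | ∃ 𝒮 ⊆ ncAltTrees T, 𝒮.Nonempty ∧
        I = (⋂ S ∈ 𝒮, polytope S) ∧ (I ∩ intrinsicInterior ℝ (polytope T)).Nonempty} =
      polytope '' canonicalForests T := by
  ext I
  constructor
  · rintro ⟨𝒮, h𝒮, hne, rfl, x, hxI, hxT⟩
    rw [iInter_polytope h𝒮 hne] at hxI ⊢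
    obtain ⟨S, hS⟩ := hne
    have hle : sInf 𝒮 ≤ S := sInf_le hS
    have hnS := (h𝒮 hS).2.2
    refine ⟨sInf 𝒮, mem_canonicalForests_of_mem_cone hn hT hnc (hle.trans (h𝒮 hS).1)
      ⟨fun i j k l h1 h2 h3 h => hnS.1 i j k l h1 h2 h3 ⟨hle h.1, hle h.2⟩,
        fun i j k h1 h2 h => hnS.2 i j k h1 h2 ⟨hle h.1, hle h.2⟩⟩
      (mem_polytope_iff.1 hxI).1 fun p hp hpT => ?_, rfl⟩
    exact edgeCoeff_pos_of_mem_intrinsicInterior hT.isAcyclic le_rfl le_rfl hxT hp hpT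
  · rintro ⟨F, hF, rfl⟩
    have hFn := isNCAlt_of_mem_canonicalForests hF
    have hsub : {S | S ∈ ncAltTrees T ∧ F ≤ S} ⊆ ncAltTrees T := fun S hS => hS.1
    have hne : {S | S ∈ ncAltTrees T ∧ F ≤ S}.Nonempty := by
      obtain ⟨S, hS, hle⟩ := exists_ncAltTree_ge hT hnc hF.1 hFn
      exact ⟨S, hS, hle⟩
    have hI := iInter_polytope hsub hne
    rw [sInf_ncAltTrees_ge hn hT hnc hF] at hI
    refine ⟨_, hsub, hne, hI.symm, ?_⟩
    set z := comb (edgeInd F) with hz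
    have hz0 := height_nonneg z
    -- Scaling brings the height strictly below 1, so the only remaining interior conditions concern
    -- the cone.
    set c : ℝ := 1 / (height z + 1) with hc
    have hc0 : 0 < c := by positivity
    have hzc : z ∈ cone F := comb_mem_cone (edgeInd_nonneg F) (supportedOn_edgeInd F)
    have hcz : height (c • z) < 1 := by
      rw [height_smul hc0.le, hc, one_div, inv_mul_lt_iff₀ (by positivity)]
      linarith
    refine ⟨c • z, mem_polytope_iff.2 ⟨?_, hcz.le⟩, mem_intrinsicInterior_polytope hT ?_ ?_ hcz⟩
    · exact PointedCone.smul_mem (cone F) hc0.le hzc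
    · rw [hz, ← map_smul]; exact sum_comb_univ _
    · intro p hp hpT
      rw [map_smul, Pi.smul_apply, smul_eq_mul]
      refine mul_pos hc0 (edgeCoeff_pos_of_mem_canonicalForests hn hT hnc hF (edgeInd_nonneg F)
        (supportedOn_edgeInd F) (fun p hp hpF => ?_) hp hpT)
      rw [edgeInd_of_adj hp hpF]; exact one_ne_zero

/-- A `T`-coefficient is nonnegative on all roots of `S`. It cannot vanish on all of them, since
they span the root of the corresponding edge of `T`, where it is 1. -/
theorem mem_canonicalForests_of_mem_ncAltTrees {T S : SimpleGraph (Fin (n + 1))} (hn : 1 ≤ n)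
    (hT : T.IsTree) (hnc : IsNoncrossing T) (hS : S ∈ ncAltTrees T) : S ∈ canonicalForests T := by
  have hzS : comb (edgeInd S) ∈ cone S := comb_mem_cone (edgeInd_nonneg S) (supportedOn_edgeInd S)
  refine mem_canonicalForests_of_mem_cone hn hT hnc hS.1 hS.2.2 hzS ?_
  intro p hp hpT
  have hroot : ∀ q, 0 ≤ edgeInd S q * edgeCoeff T (root q.1 q.2) p := by
    intro q
    by_cases hq : edgeInd S q = 0
    · simp [hq]
    · have h1 := supportedOn_edgeInd S q hq
      have h2 : root q.1 q.2 ∈ cone T :=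
        cone_le_of_mem_ncAltTrees hS (Submodule.subset_span ⟨_, _, h1.1, h1.2, rfl⟩)
      exact mul_nonneg (edgeInd_nonneg S q) (edgeCoeff_nonneg hT.isAcyclic h2 p)
  have hlin : ∀ d : Fin (n + 1) × Fin (n + 1) → ℝ, edgeCoeff T (comb d) p =
      ∑ q, d q * edgeCoeff T (root q.1 q.2) p := by
    intro d
    rw [comb_apply, map_sum, Finset.sum_apply]
    exact Finset.sum_congr rfl fun q _ => by rw [map_smul]; rfl
  rw [hlin]
  refine lt_of_le_of_ne (Finset.sum_nonneg fun q _ => hroot q) fun h0 => ?_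
  have h1 := (Finset.sum_eq_zero_iff_of_nonneg fun q _ => hroot q).1 h0.symm
  obtain ⟨d, hd, hdc⟩ := exists_comb_of_connected hS.2.1.connected
    (show ∑ v, (root p.1 p.2 : Fin (n + 1) → ℝ) v = 0 by simp [sum_root])
  have h2 : edgeCoeff T (root p.1 p.2) p = 1 := by
    have := edgeCoeff_comb hT.isAcyclic (supportedOn_single hp hpT 1)
    rw [comb_single, one_smul] at this
    simp [this]
  rw [← hdc, hlin, Finset.sum_eq_zero] at h2
  · exact zero_ne_one h2
  · intro q _
    by_cases hq : d q = 0
    · simp [hq]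
    · have h3 := hd q hq
      have h4 := h1 q (Finset.mem_univ q)
      rw [edgeInd_of_adj h3.1 h3.2, one_mul] at h4
      rw [h4, mul_zero]

/-- A canonical forest extends to a noncrossing alternating tree, which also has `n` edges. -/
theorem numForests_top {T : SimpleGraph (Fin (n + 1))} (hn : 1 ≤ n) (hT : T.IsTree)
    (hnc : IsNoncrossing T) : numForests T n = (ncAltTrees T).ncard := by
  unfold numForests
  congr 1
  ext F
  constructor
  · rintro ⟨hF, hcard⟩
    obtain ⟨S, hS, hle⟩ := exists_ncAltTree_ge hT hnc hF.1 (isNCAlt_of_mem_canonicalForests hF)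
    have : F.edgeSet = S.edgeSet := by
      refine Set.eq_of_subset_of_ncard_le (SimpleGraph.edgeSet_mono hle) ?_ (Set.toFinite _)
      rw [hcard, ncard_edgeSet_of_isTree hS.2.1]
    rw [SimpleGraph.edgeSet_inj] at this
    exact this ▸ hS
  · intro hS
    exact ⟨mem_canonicalForests_of_mem_ncAltTrees hn hT hnc hS, ncard_edgeSet_of_isTree hS.2.1⟩

end RootPolytope

/-! ### Unimodular simplices and the volume. -/

namespace RootPolytope

open Finset MeasureTheory

variable {n : ℕ}

/-! ### Volumes -/

/-- The corner simplex `c ≥ 0`, `∑ c ≤ 1`. -/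
def cornerSimplex (n : ℕ) : Set (Fin n → ℝ) := {c | 0 ≤ c ∧ ∑ i, c i ≤ 1}

theorem isClosed_cornerSimplex (n : ℕ) : IsClosed (cornerSimplex n) :=
  isClosed_Ici.inter
    (isClosed_le (f := fun c : Fin n → ℝ => ∑ i, c i) (by fun_prop) continuous_const)

theorem volume_coordinate_hyperplane (i : Fin n) : volume {x : Fin n → ℝ | x i = 0} = 0 := by
  have := Measure.addHaar_submodule (volume : Measure (Fin n → ℝ))
    (LinearMap.ker (LinearMap.proj i : (Fin n → ℝ) →ₗ[ℝ] ℝ)) (fun h => by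
      have h1 : (Pi.single i 1 : Fin n → ℝ) ∈
          LinearMap.ker (LinearMap.proj i : (Fin n → ℝ) →ₗ[ℝ] ℝ) := h ▸ Submodule.mem_top
      simp at h1)
  exact this

/-- Sign changes cut the ℓ¹ unit ball, of volume `2 ^ n / n!`, into `2 ^ n` copies of the corner
simplex that meet only in coordinate hyperplanes. -/
theorem volume_cornerSimplex (hn : 1 ≤ n) :
    volume (cornerSimplex n) = 1 / (n.factorial : ENNReal) := by
  have : Nonempty (Fin n) := ⟨⟨0, hn⟩⟩
  have hball := volume_sum_rpow_le (Fin n) (p := 1) le_rfl 1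
  simp only [div_one, Real.rpow_one, ENNReal.ofReal_one, one_pow, one_mul, Fintype.card_fin] at hball
  rw [Real.Gamma_nat_eq_factorial, show (1 : ℝ) + 1 = ((1 : ℕ) : ℝ) + 1 by norm_num,
    Real.Gamma_nat_eq_factorial, Nat.factorial_one, Nat.cast_one, mul_one] at hball
  let f : (Fin n → ℤˣ) → (Fin n → ℝ) → (Fin n → ℝ) := fun σ x i => ((σ i : ℤ) : ℝ) * x i
  have hf : ∀ σ, MeasurePreserving (f σ) := by
    intro σ
    refine volume_preserving_pi (f := fun i (x : ℝ) => ((σ i : ℤ) : ℝ) * x) fun i => ?_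
    rcases Int.units_eq_one_or (σ i) with h | h
    · simp only [h, Units.val_one, Int.cast_one, one_mul]
      exact MeasurePreserving.id _
    · simpa [h] using Measure.measurePreserving_neg (volume : Measure ℝ)
  have hunion : {x : Fin n → ℝ | ∑ i, |x i| ≤ 1} =
      ⋃ σ ∈ (univ : Finset (Fin n → ℤˣ)), f σ ⁻¹' cornerSimplex n := by
    ext x
    simp only [Set.mem_ofPred_eq, Finset.mem_univ, Set.iUnion_true, Set.mem_iUnion,
      Set.mem_preimage, cornerSimplex]
    constructor
    · intro h
      have h1 : ∀ i, ((((if 0 ≤ x i then 1 else -1 : ℤˣ)) : ℤ) : ℝ) * x i = |x i| := by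
        intro i
        split_ifs with h0
        · simp [abs_of_nonneg h0]
        · simp [abs_of_neg (not_le.1 h0)]
      refine ⟨fun i => if 0 ≤ x i then 1 else -1, fun i => ?_, ?_⟩
      · simp only [f, h1]; exact abs_nonneg _
      · simpa only [f, h1] using h
    · rintro ⟨σ, h1, h2⟩
      refine le_trans (Finset.sum_le_sum fun i _ => ?_) h2
      have h3 : 0 ≤ f σ x i := h1 i
      have h4 : |x i| = |f σ x i| := by
        rcases Int.units_eq_one_or (σ i) with h | h <;> simp [f, h]
      rw [h4, abs_of_nonneg h3]
  have hmeas : ∀ σ, MeasurableSet (f σ ⁻¹' cornerSimplex n) := fun σ =>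
    (hf σ).measurable (isClosed_cornerSimplex n).measurableSet
  rw [hunion, measure_biUnion_finset₀ ?_ fun σ _ => (hmeas σ).nullMeasurableSet] at hball
  · simp only [(hf _).measure_preimage (isClosed_cornerSimplex n).measurableSet.nullMeasurableSet,
      Finset.sum_const, Finset.card_univ, Fintype.card_pi, Fintype.card_units_int,
      Finset.prod_const, Fintype.card_fin, nsmul_eq_mul] at hball
    have h2 : ENNReal.ofReal (2 ^ n / (n.factorial : ℝ)) =
        (2 ^ n : ENNReal) / (n.factorial : ENNReal) := by
      rw [ENNReal.ofReal_div_of_pos (by positivity), ENNReal.ofReal_natCast,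
        ENNReal.ofReal_pow (by norm_num)]
      simp
    rw [h2] at hball
    push_cast at hball
    have h3 : (2 ^ n : ENNReal) ≠ 0 := by positivity
    have h4 : (2 ^ n : ENNReal) ≠ ⊤ := by finiteness
    rw [← mul_one_div] at hball
    exact (ENNReal.mul_right_inj h3 h4).1 hball
  · intro σ _ τ _ hne
    obtain ⟨i, hi⟩ := Function.ne_iff.1 hne
    refine measure_mono_null ?_ (volume_coordinate_hyperplane i)
    rintro x ⟨h1, h2⟩
    have h1 : 0 ≤ f σ x i := h1.1 i
    have h2 : 0 ≤ f τ x i := h2.1 i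
    simp only [f] at h1 h2
    simp only [Set.mem_ofPred_eq]
    rcases Int.units_eq_one_or (σ i) with h | h <;> rcases Int.units_eq_one_or (τ i) with h' | h'
    · exact absurd (h.trans h'.symm) hi
    · simp [h, h'] at h1 h2; linarith
    · simp [h, h'] at h1 h2; linarith
    · exact absurd (h.trans h'.symm) hi

theorem exists_int_det (f : (Fin n → ℝ) →ₗ[ℝ] (Fin n → ℝ))
    (hf : ∀ j i, ∃ z : ℤ, f (Pi.single j 1) i = z) : ∃ z : ℤ, LinearMap.det f = z := by
  choose A hA using hf
  refine ⟨(Matrix.of fun i j => A j i).det, ?_⟩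
  rw [← LinearMap.det_toMatrix', Int.cast_det]
  congr 1
  ext i j
  rw [LinearMap.toMatrix'_apply]
  simp [hA]

/-- Both determinants are integers and their product is 1. -/
theorem abs_det_eq_one_of_comp_eq_id {f g : (Fin n → ℝ) →ₗ[ℝ] (Fin n → ℝ)}
    (hf : ∀ j i, ∃ z : ℤ, f (Pi.single j 1) i = z) (hg : ∀ j i, ∃ z : ℤ, g (Pi.single j 1) i = z)
    (hfg : f ∘ₗ g = LinearMap.id) : |LinearMap.det f| = 1 := by
  obtain ⟨a, ha⟩ := exists_int_det f hf
  obtain ⟨b, hb⟩ := exists_int_det g hg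
  have h1 : LinearMap.det f * LinearMap.det g = 1 := by
    rw [← LinearMap.det_comp, hfg, LinearMap.det_id]
  rw [ha, hb] at h1
  have h2 : a * b = 1 := by exact_mod_cast h1
  rw [ha]
  rcases Int.eq_one_or_neg_one_of_mul_eq_one h2 with h | h <;> simp [h]

/-- The chart of the hyperplane of vectors with coordinate sum zero. -/
noncomputable def chart : (Fin n → ℝ) →ₗ[ℝ] (Fin (n + 1) → ℝ) where
  toFun y := Fin.snoc (α := fun _ => ℝ) y (-∑ i, y i)
  map_add' y z := by
    ext v
    refine Fin.lastCases ?_ (fun i => ?_) v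
    · simp [Finset.sum_add_distrib]; ring
    · simp
  map_smul' c y := by
    ext v
    refine Fin.lastCases ?_ (fun i => ?_) v
    · simp [Finset.mul_sum]
    · simp

theorem chart_castSucc (y : Fin n → ℝ) (i : Fin n) : chart y i.castSucc = y i := by
  simp [chart]

theorem sum_chart (y : Fin n → ℝ) : ∑ v, chart y v = 0 := by
  rw [Fin.sum_univ_castSucc]
  simp [chart]

theorem chart_init {x : Fin (n + 1) → ℝ} (hx : ∑ v, x v = 0) :
    chart (fun i : Fin n => x i.castSucc) = x := by
  ext v
  refine Fin.lastCases ?_ (fun i => ?_) v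
  · rw [Fin.sum_univ_castSucc] at hx
    simp only [chart, LinearMap.coe_mk, AddHom.coe_mk, Fin.snoc_last]
    linarith
  · exact chart_castSucc _ i

theorem relVolume_eq (A : Set (Fin (n + 1) → ℝ)) : relVolume A = volume (chart ⁻¹' A) := rfl

theorem continuous_chart : Continuous (chart (n := n)) :=
  LinearMap.continuous_of_finiteDimensional _

theorem edgeCoeff_root {G : SimpleGraph (Fin (n + 1))} (hG : G.IsAcyclic)
    {p : Fin (n + 1) × Fin (n + 1)} (hp : p ∈ edgePairs G) :
    edgeCoeff G (root p.1 p.2) = Pi.single p 1 := by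
  rw [mem_edgePairs] at hp
  have := edgeCoeff_comb hG (supportedOn_single hp.1 hp.2 1)
  rwa [comb_single, one_smul] at this

theorem polytope_eq_of_isTree {S : SimpleGraph (Fin (n + 1))} (hS : S.IsTree)
    (halt : IsAlternating S) : polytope S =
      {x | ∑ v, x v = 0 ∧ (∀ p ∈ edgePairs S, 0 ≤ edgeCoeff S x p) ∧
        ∑ p ∈ edgePairs S, edgeCoeff S x p ≤ 1} := by
  have hsupp : ∀ x p, p ∉ edgePairs S → edgeCoeff S x p = 0 := by
    intro x p hp
    by_contra h
    exact hp (mem_edgePairs.2 (supportedOn_edgeCoeff S x p h))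
  ext x
  rw [mem_polytope_iff, mem_cone_iff_edgeCoeff hS, Set.mem_ofPred_eq, and_assoc]
  refine and_congr_right fun hx => ?_
  have h1 : 0 ≤ edgeCoeff S x ↔ ∀ p ∈ edgePairs S, 0 ≤ edgeCoeff S x p := by
    refine ⟨fun h p _ => h p, fun h p => ?_⟩
    by_cases hp : p ∈ edgePairs S
    · exact h p hp
    · exact (hsupp x p hp).ge
  rw [← h1]
  refine and_congr_right fun h0 => ?_
  have h2 := height_comb h0 (supportedOn_edgeCoeff S x) halt
  rw [comb_edgeCoeff hS hx] at h2
  rw [h2, Finset.sum_subset (Finset.subset_univ (edgePairs S)) fun p _ hp => hsupp x p hp]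

/-- In the chart, the edge coefficients map the polytope onto the corner simplex. This map and its
inverse are integral, so volume is preserved. -/
theorem relVolume_polytope_of_isTree {S : SimpleGraph (Fin (n + 1))} (hn : 1 ≤ n)
    (hS : S.IsTree) (halt : IsAlternating S) :
    relVolume (polytope S) = 1 / (n.factorial : ENNReal) := by
  have hcard : Fintype.card (edgePairs S) = n := by
    rw [Fintype.card_coe, card_edgePairs, ncard_edgeSet_of_isTree hS]
  let e : Fin n ≃ edgePairs S := (Fintype.equivFinOfCardEq hcard).symm
  let f : (Fin n → ℝ) →ₗ[ℝ] (Fin n → ℝ) :=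
    LinearMap.pi fun k => (LinearMap.proj (e k).1).comp ((edgeCoeff S).comp chart)
  have hf : ∀ y k, f y k = edgeCoeff S (chart y) (e k).1 := fun y k => rfl
  let g : (Fin n → ℝ) →ₗ[ℝ] (Fin n → ℝ) :=
    LinearMap.pi fun i => ∑ k, (root (e k).1.1 (e k).1.2 i.castSucc) • LinearMap.proj k
  have hg : ∀ c, chart (g c) = ∑ k, c k • root (e k).1.1 (e k).1.2 := by
    intro c
    rw [← chart_init (x := ∑ k, c k • root (e k).1.1 (e k).1.2)]
    · congr 1
      ext i
      simp [g, Finset.sum_apply, mul_comm]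
    · simp_rw [Finset.sum_apply, Pi.smul_apply]
      rw [Finset.sum_comm]
      refine Finset.sum_eq_zero fun k _ => ?_
      rw [← Finset.smul_sum]
      simp [sum_root]
  have hfg : f ∘ₗ g = LinearMap.id := by
    ext j k
    simp only [LinearMap.comp_apply, LinearMap.id_apply, LinearMap.coe_single]
    rw [hf, hg, map_sum, Finset.sum_apply, Finset.sum_eq_single j]
    · rw [map_smul, edgeCoeff_root hS.isAcyclic (e j).2, Pi.single_eq_same, one_smul]
      by_cases hkj : k = j
      · subst hkj; simp
      · rw [Pi.single_eq_of_ne hkj, Pi.single_eq_of_ne]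
        exact fun h => hkj (e.injective (Subtype.ext h))
    · intro l _ hl
      rw [Pi.single_eq_of_ne hl, zero_smul, map_zero]; rfl
    · simp
  have hdet : |LinearMap.det f| = 1 := by
    refine abs_det_eq_one_of_comp_eq_id (g := g) ?_ ?_ hfg
    · intro j i
      rw [hf]
      refine exists_int_edgeCoeff (fun v => ?_) _
      refine Fin.lastCases ?_ (fun i => ?_) v
      · exact ⟨-1, by simp [chart]⟩
      · rw [chart_castSucc]
        exact ⟨if i = j then 1 else 0, by simp [Pi.single_apply]⟩
    · intro j i
      simp only [g, LinearMap.pi_apply, LinearMap.sum_apply, LinearMap.smul_apply,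
        LinearMap.proj_apply, smul_eq_mul]
      rw [Finset.sum_eq_single j (fun k _ hk => by rw [Pi.single_eq_of_ne hk, mul_zero]) (by simp),
        Pi.single_eq_same, mul_one, root_apply]
      exact ⟨(if i.castSucc = (e j).1.1 then 1 else 0) - (if i.castSucc = (e j).1.2 then 1 else 0),
        by push_cast; rfl⟩
  have hpre : chart ⁻¹' polytope S = f ⁻¹' cornerSimplex n := by
    rw [polytope_eq_of_isTree hS halt]
    ext y
    simp only [Set.mem_preimage, Set.mem_ofPred_eq, sum_chart, true_and, cornerSimplex, hf,
      Pi.le_def, Pi.zero_apply]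
    refine and_congr ⟨fun h k => h _ (e k).2, fun h p hp => ?_⟩ ?_
    · simpa using h (e.symm ⟨p, hp⟩)
    · rw [Equiv.sum_comp e (fun p : edgePairs S => edgeCoeff S (chart y) p.1),
        Finset.sum_coe_sort (edgePairs S) (fun p => edgeCoeff S (chart y) p)]
  have hdet0 : LinearMap.det f ≠ 0 := by
    intro h; rw [h] at hdet; simp at hdet
  rw [relVolume_eq, hpre, Measure.addHaar_preimage_linearMap _ hdet0, abs_inv, hdet,
    volume_cornerSimplex hn]
  simp

theorem isClosed_polytope_of_isTree {S : SimpleGraph (Fin (n + 1))} (hS : S.IsTree) :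
    IsClosed (polytope S) := by
  have : polytope S = {x | ∑ v, x v = 0} ∩ {x | 0 ≤ edgeCoeff S x} ∩ {x | height x ≤ 1} := by
    ext x
    rw [mem_polytope_iff, mem_cone_iff_edgeCoeff hS]
    rfl
  rw [this]
  refine ((isClosed_eq (by fun_prop) continuous_const).inter ?_).inter
    (isClosed_le continuous_height continuous_const)
  exact isClosed_Ici.preimage (continuous_edgeCoeff S)

theorem relVolume_polytope {T : SimpleGraph (Fin (n + 1))} (hn : 1 ≤ n) (hT : T.IsTree)
    (hnc : IsNoncrossing T) :
    relVolume (polytope T) = ((ncAltTrees T).ncard : ENNReal) / (n.factorial : ENNReal) := by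
  classical
  have hfin : (ncAltTrees T).Finite := Set.toFinite _
  rw [← iUnion_polytope hT hnc, relVolume_eq, Set.preimage_iUnion₂,
    ← hfin.coe_toFinset, Set.ncard_coe_finset]
  simp only [Finset.mem_coe]
  rw [measure_biUnion_finset₀]
  · rw [Finset.sum_congr rfl fun S hS => ?_, Finset.sum_const, nsmul_eq_mul]
    · exact (mul_one_div _ _)
    · rw [hfin.mem_toFinset] at hS
      exact relVolume_polytope_of_isTree hn hS.2.1 hS.2.2.2
  · intro S hS S' hS' hne
    rw [Finset.mem_coe, hfin.mem_toFinset] at hS hS'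
    -- Both trees have `n` edges, so some edge `p` belongs to `S` only. Its coefficient vanishes on
    -- the overlap, which therefore lies in a hyperplane.
    obtain ⟨p, hp, hpS'⟩ : ∃ p, p ∈ edgePairs S ∧ p ∉ edgePairs S' := by
      by_contra hcon
      push Not at hcon
      apply hne
      have h1 : edgePairs S = edgePairs S' := by
        refine Finset.eq_of_subset_of_card_le hcon ?_
        rw [card_edgePairs, card_edgePairs, ncard_edgeSet_of_isTree hS.2.1,
          ncard_edgeSet_of_isTree hS'.2.1]
      have h2 : ∀ {A B : SimpleGraph (Fin (n + 1))}, edgePairs A = edgePairs B → A ≤ B := by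
        intro A B h
        rw [SimpleGraph_le_iff_lt]
        intro i j hij hA
        exact (mem_edgePairs.1 (h ▸ mem_edgePairs.2 ⟨hij, hA⟩ : (i, j) ∈ edgePairs B)).2
      exact le_antisymm (h2 h1) (h2 h1.symm)
    let l : (Fin n → ℝ) →ₗ[ℝ] ℝ := (LinearMap.proj p).comp ((edgeCoeff S).comp chart)
    refine measure_mono_null (t := (LinearMap.ker l : Set (Fin n → ℝ))) ?_
      (Measure.addHaar_submodule _ _ ?_)
    · rintro y ⟨h1, h2⟩
      have e1 := ncWeight_eq_edgeCoeff hS.2.2 (mem_polytope_iff.1 h1).1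
      have e2 := ncWeight_eq_edgeCoeff hS'.2.2 (mem_polytope_iff.1 h2).1
      rw [SetLike.mem_coe, LinearMap.mem_ker]
      change edgeCoeff S (chart y) p = 0
      rw [← e1, e2]
      by_contra h
      exact hpS' (mem_edgePairs.2 (supportedOn_edgeCoeff S' _ p h))
    · intro htop
      have h1 : (fun i : Fin n => (root p.1 p.2 : Fin (n + 1) → ℝ) i.castSucc) ∈
          LinearMap.ker l := htop ▸ Submodule.mem_top
      rw [LinearMap.mem_ker] at h1
      change edgeCoeff S (chart _) p = 0 at h1
      rw [chart_init (by simp [sum_root]), edgeCoeff_root hS.2.1.isAcyclic hp] at h1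
      simp at h1
  · intro S hS
    rw [hfin.mem_toFinset] at hS
    exact ((isClosed_polytope_of_isTree hS.2.1).preimage
      continuous_chart).measurableSet.nullMeasurableSet

end RootPolytope

/-! ### Half-open subdivisions and reciprocity of counts. -/

namespace RootPolytope

open Finset

variable {n : ℕ}

/-! ### Counting integer weights -/

section Counting

variable {ι : Type*} [Fintype ι]

/-- The combination `∑ a s • (e_i - e_j)` over an indexed family of pairs `(i, j)`. -/
noncomputable def famComb (e : ι → Fin (n + 1) × Fin (n + 1)) (a : ι → ℕ) : Fin (n + 1) → ℝ :=
  ∑ s, (a s : ℝ) • root (e s).1 (e s).2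

/-- The weights, positive on `Z`, of the combinations of height at most `t`. -/
def weights (e : ι → Fin (n + 1) × Fin (n + 1)) (Z : Finset ι) (t : ℕ) : Set (ι → ℕ) :=
  {a | (∀ s ∈ Z, 0 < a s) ∧ height (famComb e a) ≤ t}

/-- Pairs may repeat in an indexed family, as happens after exchanges, so weights are collected per
pair before `height_comb` applies. -/
theorem height_famComb {e : ι → Fin (n + 1) × Fin (n + 1)} (he : ∀ s, (e s).1 < (e s).2)
    (halt : ∀ s t, (e s).2 ≠ (e t).1) (a : ι → ℕ) :
    height (famComb e a) = ∑ s, (a s : ℝ) := by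
  let d : Fin (n + 1) × Fin (n + 1) → ℝ := ∑ s, Pi.single (e s) (a s : ℝ)
  have hd0 : 0 ≤ d := Finset.sum_nonneg fun s _ => Pi.single_nonneg.2 (Nat.cast_nonneg _)
  have hdne : ∀ p, d p ≠ 0 → ∃ s, e s = p := by
    intro p hp
    by_contra hcon
    push Not at hcon
    apply hp
    simp only [d, Finset.sum_apply]
    exact Finset.sum_eq_zero fun s _ => Pi.single_eq_of_ne (hcon s).symm _
  have hdlt : ∀ p, d p ≠ 0 → p.1 < p.2 := by
    intro p hp
    obtain ⟨s, rfl⟩ := hdne p hp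
    exact he s
  have hsupp : SupportedOn d (supportGraph d) :=
    fun p hp => ⟨hdlt p hp, (supportGraph_adj_of_lt (hdlt p hp)).2 hp⟩
  have hG : IsAlternating (supportGraph d) := by
    rintro i j k hij hjk ⟨h1, h2⟩
    rw [supportGraph_adj_of_lt hij] at h1
    rw [supportGraph_adj_of_lt hjk] at h2
    obtain ⟨s, hs⟩ := hdne _ h1
    obtain ⟨t, ht⟩ := hdne _ h2
    exact halt s t (by rw [hs, ht])
  have hc : comb d = famComb e a := by
    simp only [d, map_sum, comb_single, famComb]
  rw [← hc, height_comb hd0 hsupp hG]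
  simp only [d, Finset.sum_apply]
  rw [Finset.sum_comm]
  exact Finset.sum_congr rfl fun s _ => by simp

variable [DecidableEq ι]

theorem famComb_update_weight (e : ι → Fin (n + 1) × Fin (n + 1)) (a : ι → ℕ) (s : ι) (c : ℕ) :
    famComb e (Function.update a s c) =
      famComb e a + ((c : ℝ) - a s) • root (e s).1 (e s).2 := by
  rw [← sub_eq_iff_eq_add', famComb, famComb, ← Finset.sum_sub_distrib, Finset.sum_eq_single s]
  · rw [Function.update_self, sub_smul]
  · intro u _ hu
    rw [Function.update_of_ne hu, sub_self]
  · simp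

theorem famComb_update_edge (e : ι → Fin (n + 1) × Fin (n + 1)) (a : ι → ℕ) (t : ι)
    (p : Fin (n + 1) × Fin (n + 1)) :
    famComb (Function.update e t p) a =
      famComb e a + (a t : ℝ) • (root p.1 p.2 - root (e t).1 (e t).2) := by
  rw [← sub_eq_iff_eq_add', famComb, famComb, ← Finset.sum_sub_distrib, Finset.sum_eq_single t]
  · rw [Function.update_self, smul_sub]
  · intro u _ hu
    rw [Function.update_of_ne hu, sub_self]
  · simp

/-- The index `none` carries the slack, which turns the inequality into an equation counted by stars
and bars. -/
theorem ncard_sum_le (s : ℕ) : {a : ι → ℕ | ∑ i, a i ≤ s}.Finite ∧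
    {a : ι → ℕ | ∑ i, a i ≤ s}.ncard = (s + Fintype.card ι).choose (Fintype.card ι) := by
  have h : {a : ι → ℕ | ∑ i, a i ≤ s} =
      (fun f : Option ι → ℕ => fun i => f (some i)) '' (piAntidiag (univ : Finset (Option ι)) s) := by
    ext a
    simp only [Set.mem_ofPred_eq, Set.mem_image, Finset.mem_coe, mem_piAntidiag, Finset.mem_univ,
      implies_true, and_true, Fintype.sum_option]
    constructor
    · intro ha
      exact ⟨fun o => o.elim (s - ∑ i, a i) a, by simp only [Option.elim]; omega, rfl⟩
    · rintro ⟨f, hf, rfl⟩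
      simp only
      omega
  rw [h]
  refine ⟨(Finset.finite_toSet _).image _, ?_⟩
  rw [Set.InjOn.ncard_image, Set.ncard_coe_finset, ← map_sym_eq_piAntidiag, Finset.card_map,
    Finset.sym_univ, Finset.card_univ, Sym.card_sym_eq_choose, Fintype.card_option,
    show Fintype.card ι + 1 + s - 1 = s + Fintype.card ι by omega, Nat.choose_symm_add]
  intro f hf g hg hfg
  simp only [Finset.mem_coe, mem_piAntidiag, Finset.mem_univ, implies_true, and_true,
    Fintype.sum_option] at hf hg
  have h1 : ∀ i, f (some i) = g (some i) := fun i => congrFun hfg i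
  funext o
  cases o with
  | some i => exact h1 i
  | none => simp only [h1] at hf; omega

theorem ncard_pos_sum_le (Z : Finset ι) (t : ℕ) :
    {a : ι → ℕ | (∀ s ∈ Z, 0 < a s) ∧ ∑ i, a i ≤ t}.Finite ∧
      {a : ι → ℕ | (∀ s ∈ Z, 0 < a s) ∧ ∑ i, a i ≤ t}.ncard =
        (t + Fintype.card ι - Z.card).choose (Fintype.card ι) := by
  have hZ : Z.card ≤ Fintype.card ι := Finset.card_le_univ Z
  have hsum : ∑ i, (if i ∈ Z then 1 else 0) = Z.card := by simp
  rcases Nat.lt_or_ge t Z.card with h | h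
  · have h1 : {a : ι → ℕ | (∀ s ∈ Z, 0 < a s) ∧ ∑ i, a i ≤ t} = ∅ := by
      rw [Set.eq_empty_iff_forall_notMem]
      rintro a ⟨h1, h2⟩
      have : ∑ i, (if i ∈ Z then 1 else 0) ≤ ∑ i, a i := by
        refine Finset.sum_le_sum fun i _ => ?_
        split_ifs with hi
        · exact h1 i hi
        · exact Nat.zero_le _
      omega
    rw [h1, Set.ncard_empty, Nat.choose_eq_zero_of_lt (by omega)]
    exact ⟨Set.finite_empty, rfl⟩
  · have h1 : {a : ι → ℕ | (∀ s ∈ Z, 0 < a s) ∧ ∑ i, a i ≤ t} =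
        (fun a i => a i + if i ∈ Z then 1 else 0) '' {a : ι → ℕ | ∑ i, a i ≤ t - Z.card} := by
      ext a
      constructor
      · rintro ⟨h1, h2⟩
        have h3 : ∀ i, a i - (if i ∈ Z then 1 else 0) + (if i ∈ Z then 1 else 0) = a i := by
          intro i
          refine Nat.sub_add_cancel ?_
          split_ifs with hi
          · exact h1 i hi
          · exact Nat.zero_le _
        refine ⟨fun i => a i - if i ∈ Z then 1 else 0, ?_, funext h3⟩
        have h4 : ∑ i, (a i - (if i ∈ Z then 1 else 0)) + ∑ i, (if i ∈ Z then 1 else 0) =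
            ∑ i, a i := by
          rw [← Finset.sum_add_distrib]
          exact Finset.sum_congr rfl fun i _ => h3 i
        simp only [Set.mem_ofPred_eq]
        omega
      · rintro ⟨b, hb, rfl⟩
        simp only [Set.mem_ofPred_eq] at hb ⊢
        refine ⟨fun s hs => by simp [hs], ?_⟩
        rw [Finset.sum_add_distrib, hsum]
        omega
    have h2 := ncard_sum_le (ι := ι) (t - Z.card)
    rw [h1]
    refine ⟨h2.1.image _, ?_⟩
    rw [Set.InjOn.ncard_image, h2.2]
    · congr 1; omega
    · intro a _ b _ hab
      funext i
      have := congrFun hab i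
      simpa using this

theorem ncard_weights_of_alternating {e : ι → Fin (n + 1) × Fin (n + 1)}
    (he : ∀ s, (e s).1 < (e s).2) (halt : ∀ s t, (e s).2 ≠ (e t).1) (Z : Finset ι) (t : ℕ) :
    (weights e Z t).Finite ∧
      (weights e Z t).ncard = (t + Fintype.card ι - Z.card).choose (Fintype.card ι) := by
  have : weights e Z t = {a : ι → ℕ | (∀ s ∈ Z, 0 < a s) ∧ ∑ i, a i ≤ t} := by
    ext a
    simp only [weights, Set.mem_ofPred_eq, height_famComb he halt]
    exact and_congr_right fun _ => by exact_mod_cast Iff.rfl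
  rw [this]
  exact ncard_pos_sum_le Z t

/-- The positivity conditions after replacing the pair `(j, k)` with index `t` by `(i, k)`, in the
presence of the pair `(i, j)` with index `s`. -/
def toggle (Z : Finset ι) (s t : ι) : Finset ι := if t ∈ Z then Z.erase s else insert s Z

/-- This compatibility lets the subdivisions for `Z` and for its complement proceed in parallel. -/
theorem toggle_compl (Z : Finset ι) (s t : ι) : toggle Zᶜ s t = (toggle Z s t)ᶜ := by
  unfold toggle
  by_cases h : t ∈ Z <;> ext u <;> by_cases hu : u = s <;> simp [h, hu]

/-- Common weight on `(i, j)` and `(j, k)` moves to `(i, k)`, leaving the excess on the pair that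
had more; the vector, hence its height, is unchanged. The wall `a s = a t` must be counted once: it
goes to the first piece if `t ∈ Z`, and to the second otherwise. This dictates `toggle`. -/
theorem weights_split {e : ι → Fin (n + 1) × Fin (n + 1)} {s t : ι} {i j k : Fin (n + 1)}
    (hs : e s = (i, j)) (ht : e t = (j, k)) (hst : s ≠ t) (Z : Finset ι) (N : ℕ)
    (h1 : (weights (Function.update e t (i, k)) (toggle Z s t) N).Finite)
    (h2 : (weights (Function.update e s (i, k)) Z N).Finite) :
    (weights e Z N).Finite ∧ (weights e Z N).ncard =
      (weights (Function.update e t (i, k)) (toggle Z s t) N).ncard +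
        (weights (Function.update e s (i, k)) Z N).ncard := by
  set f₁ : (ι → ℕ) → ι → ℕ := fun b => Function.update b s (b s + b t) with hf₁
  set f₂ : (ι → ℕ) → ι → ℕ := fun b => Function.update b t (b t + b s) with hf₂
  have hr : (root i k : Fin (n + 1) → ℝ) = root i j + root j k := (root_add_root i j k).symm
  have hc₁ : ∀ b, famComb e (f₁ b) = famComb (Function.update e t (i, k)) b := by
    intro b
    simp only [hf₁]
    rw [famComb_update_weight, famComb_update_edge, hs, ht, hr]
    push_cast
    simp
  have hc₂ : ∀ b, famComb e (f₂ b) = famComb (Function.update e s (i, k)) b := by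
    intro b
    simp only [hf₂]
    rw [famComb_update_weight, famComb_update_edge, hs, ht, hr]
    push_cast
    simp
  have hf₁s : ∀ b, f₁ b s = b s + b t := fun b => Function.update_self _ _ _
  have hf₁u : ∀ b u, u ≠ s → f₁ b u = b u := fun b u hu => Function.update_of_ne hu _ _
  have hf₂t : ∀ b, f₂ b t = b t + b s := fun b => Function.update_self _ _ _
  have hf₂u : ∀ b u, u ≠ t → f₂ b u = b u := fun b u hu => Function.update_of_ne hu _ _
  have hinj₁ : Function.Injective f₁ := by
    intro a b hab
    have e1 : ∀ u, u ≠ s → a u = b u := fun u hu => by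
      rw [← hf₁u a u hu, ← hf₁u b u hu, hab]
    have e2 : a s + a t = b s + b t := by rw [← hf₁s, ← hf₁s, hab]
    funext u
    by_cases hu : u = s
    · subst hu; have := e1 t hst.symm; omega
    · exact e1 u hu
  have hinj₂ : Function.Injective f₂ := by
    intro a b hab
    have e1 : ∀ u, u ≠ t → a u = b u := fun u hu => by
      rw [← hf₂u a u hu, ← hf₂u b u hu, hab]
    have e2 : a t + a s = b t + b s := by rw [← hf₂t, ← hf₂t, hab]
    funext u
    by_cases hu : u = t
    · subst hu; have := e1 s hst; omega
    · exact e1 u hu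
  have hsplit : weights e Z N = f₁ '' weights (Function.update e t (i, k)) (toggle Z s t) N ∪
      f₂ '' weights (Function.update e s (i, k)) Z N := by
    ext a
    constructor
    · rintro ⟨ha, hh⟩
      by_cases hcase : if t ∈ Z then a t ≤ a s else a t < a s
      · left
        have hle : a t ≤ a s := by split_ifs at hcase <;> omega
        have hback : f₁ (Function.update a s (a s - a t)) = a := by
          funext u
          by_cases hu : u = s
          · subst hu
            rw [hf₁s, Function.update_self, Function.update_of_ne hst.symm]; omega
          · rw [hf₁u _ _ hu, Function.update_of_ne hu]
        refine ⟨Function.update a s (a s - a t), ⟨fun u hu => ?_, ?_⟩, hback⟩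
        · by_cases hus : u = s
          · subst hus
            rw [Function.update_self]
            unfold toggle at hu
            split_ifs at hu hcase with h
            · simp at hu
            · omega
          · rw [Function.update_of_ne hus]
            refine ha u ?_
            unfold toggle at hu
            split_ifs at hu
            · exact Finset.mem_of_mem_erase hu
            · exact (Finset.mem_insert.1 hu).resolve_left hus
        · rwa [← hc₁, hback]
      · right
        have hle : a s ≤ a t := by split_ifs at hcase <;> omega
        have hback : f₂ (Function.update a t (a t - a s)) = a := by
          funext u
          by_cases hu : u = t
          · subst hu
            rw [hf₂t, Function.update_self, Function.update_of_ne hst]; omega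
          · rw [hf₂u _ _ hu, Function.update_of_ne hu]
        refine ⟨Function.update a t (a t - a s), ⟨fun u hu => ?_, ?_⟩, hback⟩
        · by_cases hut : u = t
          · subst hut
            rw [Function.update_self]
            rw [if_pos hu] at hcase
            omega
          · rw [Function.update_of_ne hut]
            exact ha u hu
        · rwa [← hc₂, hback]
    · rintro (⟨b, ⟨hb, hh⟩, rfl⟩ | ⟨b, ⟨hb, hh⟩, rfl⟩)
      · refine ⟨fun u hu => ?_, by rwa [hc₁]⟩
        by_cases hus : u = s
        · subst hus
          rw [hf₁s]
          by_cases htZ : t ∈ Z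
          · have := hb t (by unfold toggle; rw [if_pos htZ]; exact Finset.mem_erase.2 ⟨hst.symm, htZ⟩)
            omega
          · have := hb u (by unfold toggle; rw [if_neg htZ]; exact Finset.mem_insert_self _ _)
            omega
        · rw [hf₁u _ _ hus]
          refine hb u ?_
          unfold toggle
          split_ifs
          · exact Finset.mem_erase.2 ⟨hus, hu⟩
          · exact Finset.mem_insert_of_mem hu
      · refine ⟨fun u hu => ?_, by rwa [hc₂]⟩
        have := hb u hu
        by_cases hut : u = t
        · subst hut; rw [hf₂t]; omega
        · rwa [hf₂u _ _ hut]
  have hdisj : Disjoint (f₁ '' weights (Function.update e t (i, k)) (toggle Z s t) N)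
      (f₂ '' weights (Function.update e s (i, k)) Z N) := by
    rw [Set.disjoint_left]
    rintro _ ⟨b, ⟨hb, _⟩, rfl⟩ ⟨b', ⟨hb', _⟩, heq⟩
    have e1 : b' s = b s + b t := by rw [← hf₁s, ← heq, hf₂u _ _ hst]
    have e2 : b' t + b' s = b t := by rw [← hf₂t, heq, hf₁u _ _ hst.symm]
    by_cases htZ : t ∈ Z
    · have := hb' t htZ; omega
    · have := hb s (by unfold toggle; rw [if_neg htZ]; exact Finset.mem_insert_self _ _)
      omega
  rw [hsplit]
  refine ⟨(h1.image _).union (h2.image _), ?_⟩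
  rw [Set.ncard_union_eq hdisj (h1.image _) (h2.image _), Set.ncard_image_of_injective _ hinj₁,
    Set.ncard_image_of_injective _ hinj₂]

/-- Reciprocity: the numbers of weights that are positive on `Z` and on its complement are governed
by the same multiset. -/
theorem exists_weights_reciprocity (M : ℕ) : ∀ e : ι → Fin (n + 1) × Fin (n + 1),
    (∀ s, (e s).1 < (e s).2) → ∑ s, (n + 1 - ((e s).2.val - (e s).1.val)) = M →
    ∀ Z : Finset ι, ∃ H : Multiset ℕ, (∀ z ∈ H, z ≤ Fintype.card ι) ∧ ∀ N : ℕ,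
      ((weights e Z N).Finite ∧ (weights e Z N).ncard =
        (H.map fun z => (N + Fintype.card ι - z).choose (Fintype.card ι)).sum) ∧
      ((weights e Zᶜ N).Finite ∧ (weights e Zᶜ N).ncard =
        (H.map fun z => (N + z).choose (Fintype.card ι)).sum) := by
  induction M using Nat.strong_induction_on with
  | _ M ih =>
    intro e he hM Z
    by_cases halt : ∀ s t, (e s).2 ≠ (e t).1
    -- For an alternating family the height is the sum of the weights, so a single half-open simplex
    -- is counted, with `Z.card` strict conditions.
    · refine ⟨{Z.card}, ?_, fun N => ⟨?_, ?_⟩⟩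
      · simpa using Finset.card_le_univ Z
      · simpa using ncard_weights_of_alternating he halt Z N
      · have := ncard_weights_of_alternating he halt Zᶜ N
        rw [Finset.card_compl] at this
        have hZ : Z.card ≤ Fintype.card ι := Finset.card_le_univ Z
        rw [show N + Fintype.card ι - (Fintype.card ι - Z.card) = N + Z.card by omega] at this
        simpa using this
    · push Not at halt
      obtain ⟨s, t, hst⟩ := halt
      obtain ⟨i, j, k, hs, ht⟩ : ∃ i j k, e s = (i, j) ∧ e t = (j, k) :=
        ⟨(e s).1, (e s).2, (e t).2, rfl, by rw [hst]⟩
      have hij : i < j := by have := he s; rwa [hs] at this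
      have hjk : j < k := by have := he t; rwa [ht] at this
      have hne : s ≠ t := by
        rintro rfl
        rw [hs, Prod.mk.injEq] at ht
        exact hij.ne ht.1
      have hlt : ∀ u, (e u = (i, j) ∨ e u = (j, k)) →
          (∀ v, (Function.update e u (i, k) v).1 < (Function.update e u (i, k) v).2) ∧
          ∑ v, (n + 1 - ((Function.update e u (i, k) v).2.val -
            (Function.update e u (i, k) v).1.val)) < M := by
        intro u hu
        constructor
        · intro v
          by_cases hv : v = u
          · subst hv; rw [Function.update_self]; exact hij.trans hjk
          · rw [Function.update_of_ne hv]; exact he v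
        · rw [← hM]
          -- An exchange lengthens one pair, so the total of the deficits `n + 1 - length` drops and
          -- the induction terminates.
          have hlt : n + 1 - (k.val - i.val) < n + 1 - ((e u).2.val - (e u).1.val) := by
            have := k.2
            rw [Fin.lt_def] at hij hjk
            rcases hu with hu | hu <;> rw [hu] <;> simp only <;> omega
          refine Finset.sum_lt_sum (fun v _ => ?_) ⟨u, Finset.mem_univ u, ?_⟩
          · by_cases hv : v = u
            · subst hv; rw [Function.update_self]; exact hlt.le
            · rw [Function.update_of_ne hv]
          · rw [Function.update_self]; exact hlt
      obtain ⟨he1, hM1⟩ := hlt t (Or.inr ht)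
      obtain ⟨he2, hM2⟩ := hlt s (Or.inl hs)
      obtain ⟨H₁, hH₁, h₁⟩ := ih _ hM1 _ he1 rfl (toggle Z s t)
      obtain ⟨H₂, hH₂, h₂⟩ := ih _ hM2 _ he2 rfl Z
      refine ⟨H₁ + H₂, ?_, fun N => ⟨?_, ?_⟩⟩
      · intro z hz
        rw [Multiset.mem_add] at hz
        exact hz.elim (hH₁ z) (hH₂ z)
      · have := weights_split hs ht hne Z N (h₁ N).1.1 (h₂ N).1.1
        refine ⟨this.1, ?_⟩
        rw [this.2, (h₁ N).1.2, (h₂ N).1.2, Multiset.map_add, Multiset.sum_add]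
      · have := weights_split hs ht hne Zᶜ N (by rw [toggle_compl]; exact (h₁ N).2.1) (h₂ N).2.1
        refine ⟨this.1, ?_⟩
        rw [this.2, toggle_compl, (h₁ N).2.2, (h₂ N).2.2, Multiset.map_add, Multiset.sum_add]

end Counting

/-! ### The binomial reciprocity -/

open Polynomial in
/-- The polynomial `X (X - 1) ⋯ (X - k + 1) / k!`. -/
noncomputable def choosePoly (k : ℕ) : ℚ[X] := C (1 / (k.factorial : ℚ)) * descPochhammer ℚ k

theorem choosePoly_eval_natCast (k N : ℕ) : (choosePoly k).eval (N : ℚ) = N.choose k := by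
  rw [choosePoly, Polynomial.eval_mul, Polynomial.eval_C, descPochhammer_eval_eq_descFactorial,
    Nat.descFactorial_eq_factorial_mul_choose]
  have : (k.factorial : ℚ) ≠ 0 := by positivity
  push_cast
  field_simp

/-- The factors `x - i` are paired with those of the reflected argument by reversing their order. -/
theorem choosePoly_eval_reflect (k : ℕ) (x : ℚ) :
    (choosePoly k).eval x = (-1) ^ k * (choosePoly k).eval (k - 1 - x) := by
  simp only [choosePoly, Polynomial.eval_mul, Polynomial.eval_C, descPochhammer_eval_eq_prod_range]
  rw [mul_left_comm]
  congr 1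
  rw [← Finset.prod_range_reflect, ← Finset.card_range k, ← Finset.prod_const, Finset.card_range,
    ← Finset.prod_mul_distrib]
  refine Finset.prod_congr rfl fun i hi => ?_
  rw [Finset.mem_range] at hi
  rw [show k - 1 - i = k - (i + 1) by omega, Nat.cast_sub (by omega)]
  push_cast
  ring

/-- Equality at all natural numbers is an identity of polynomials, evaluated here at `-N - 1`.
Reflection turns the two kinds of terms into `(N + n - z).choose n` and `(N + i).choose i`, up to
sign. The bound `z ≤ n` makes the natural subtraction exact. -/
theorem sum_choose_reciprocity {n : ℕ} {H : Multiset ℕ} (hH : ∀ z ∈ H, z ≤ n) {f : ℕ → ℕ}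
    (h : ∀ N : ℕ, (H.map fun z => (N + z).choose n).sum = ∑ i ∈ range (n + 1), f i * N.choose i)
    (N : ℕ) : (((H.map fun z => (N + n - z).choose n).sum : ℕ) : ℤ) =
      (-1) ^ n * ∑ i ∈ range (n + 1), (-1) ^ i * (f i : ℤ) * ((N + i).choose i : ℤ) := by
  let P : Polynomial ℚ := (H.map fun z : ℕ => (choosePoly n).comp (Polynomial.X + Polynomial.C (z : ℚ))).sum
  let Q : Polynomial ℚ := ∑ i ∈ range (n + 1), Polynomial.C (f i : ℚ) * choosePoly i
  have hPe : ∀ x, P.eval x = (H.map fun z : ℕ => (choosePoly n).eval (x + (z : ℚ))).sum := by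
    intro x
    simp only [P]
    rw [← Polynomial.coe_evalRingHom, map_multiset_sum, Multiset.map_map]
    congr 1
    refine Multiset.map_congr rfl fun z _ => ?_
    simp
  have hQe : ∀ x, Q.eval x = ∑ i ∈ range (n + 1), (f i : ℚ) * (choosePoly i).eval x := by
    intro x
    simp [Q, Polynomial.eval_finsetSum]
  have hPQ : P = Q := by
    rw [← sub_eq_zero]
    refine Polynomial.eq_zero_of_infinite_isRoot _ ?_
    refine (Set.infinite_range_of_injective (Nat.cast_injective (R := ℚ))).mono ?_
    rintro _ ⟨M, rfl⟩
    rw [Set.mem_ofPred_eq, Polynomial.IsRoot, Polynomial.eval_sub, sub_eq_zero, hPe, hQe]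
    have h1 := congrArg (Nat.cast (R := ℚ)) (h M)
    rw [Nat.cast_multiset_sum, Multiset.map_map] at h1
    simp only [← Nat.cast_add, choosePoly_eval_natCast]
    simp only [Function.comp_def] at h1
    rw [h1]
    push_cast
    rfl
  have h1 : P.eval (-(N : ℚ) - 1) = Q.eval (-(N : ℚ) - 1) := by rw [hPQ]
  rw [hPe, hQe] at h1
  have h2 : ∀ z ∈ H, (choosePoly n).eval (-(N : ℚ) - 1 + z) =
      (-1) ^ n * ((N + n - z).choose n : ℕ) := by
    intro z hz
    rw [choosePoly_eval_reflect, ← choosePoly_eval_natCast]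
    congr 2
    rw [Nat.cast_sub (by have := hH z hz; omega)]
    push_cast
    ring
  have h3 : ∀ i, (choosePoly i).eval (-(N : ℚ) - 1) = (-1) ^ i * ((N + i).choose i : ℕ) := by
    intro i
    rw [choosePoly_eval_reflect, ← choosePoly_eval_natCast]
    congr 2
    push_cast
    ring
  rw [Multiset.map_congr rfl h2, Multiset.sum_map_mul_left] at h1
  simp only [h3] at h1
  have h4 : ((-1 : ℚ) ^ n) * (-1) ^ n = 1 := by rw [← mul_pow]; simp
  have h5 : (((H.map fun z => (N + n - z).choose n).sum : ℕ) : ℚ) =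
      (-1) ^ n * ∑ i ∈ range (n + 1), (-1) ^ i * (f i : ℚ) * ((N + i).choose i : ℚ) := by
    rw [Nat.cast_multiset_sum, Multiset.map_map]
    have h6 := congrArg (fun x => (-1 : ℚ) ^ n * x) h1
    simp only [← mul_assoc, h4, one_mul] at h6
    simp only [Function.comp_def]
    rw [h6]
    simp only [mul_assoc]
    congr 1
    exact Finset.sum_congr rfl fun i _ => by ring
  generalize (H.map fun z => (N + n - z).choose n).sum = K at h5 ⊢
  apply Int.cast_injective (α := ℚ)
  push_cast
  exact h5

end RootPolytope

/-! ### Lattice points of the closed and the open cone, and the Ehrhart polynomial. -/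

namespace RootPolytope

open Finset

variable {n : ℕ}

/-! ### Lattice points -/

theorem mem_latticePoints_polytope {G : SimpleGraph (Fin (n + 1))} {t : ℕ}
    {x : Fin (n + 1) → ℝ} : x ∈ latticePoints (polytope G) t ↔
      x ∈ cone G ∧ height x ≤ t ∧ ∀ v, ∃ z : ℤ, x v = z := by
  rw [latticePoints, Set.mem_ofPred_eq, ← and_assoc]
  refine and_congr_left fun _ => ?_
  rw [Set.mem_smul_set]
  constructor
  · rintro ⟨y, hy, rfl⟩
    rw [mem_polytope_iff] at hy
    refine ⟨PointedCone.smul_mem (cone G) (Nat.cast_nonneg t) hy.1, ?_⟩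
    rw [height_smul (Nat.cast_nonneg t)]
    exact mul_le_of_le_one_right (Nat.cast_nonneg t) hy.2
  · rintro ⟨h1, h2⟩
    -- At `t = 0` scaling is not invertible, but height zero together with coordinate sum zero
    -- already forces `x = 0`.
    rcases Nat.eq_zero_or_pos t with rfl | ht
    · refine ⟨0, zero_mem_polytope G, ?_⟩
      rw [smul_zero, eq_zero_of_height_eq_zero (sum_eq_zero_of_mem_cone h1)
        (le_antisymm (by simpa using h2) (height_nonneg x))]
    · have ht' : (0 : ℝ) < t := Nat.cast_pos.2 ht
      refine ⟨(t : ℝ)⁻¹ • x, mem_polytope_iff.2 ⟨?_, ?_⟩, smul_inv_smul₀ ht'.ne' x⟩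
      · exact PointedCone.smul_mem (cone G) (inv_nonneg.2 ht'.le) h1
      · rw [height_smul (inv_nonneg.2 ht'.le), inv_mul_le_iff₀ ht', mul_one]
        exact h2

/-- The extension by zero of a family of weights of the edges of `G`. -/
noncomputable def extendWeight (G : SimpleGraph (Fin (n + 1))) (a : edgePairs G → ℕ) :
    Fin (n + 1) × Fin (n + 1) → ℝ :=
  fun p => if h : p ∈ edgePairs G then (a ⟨p, h⟩ : ℝ) else 0

theorem extendWeight_apply {G : SimpleGraph (Fin (n + 1))} (a : edgePairs G → ℕ)
    (s : edgePairs G) : extendWeight G a s.1 = a s := by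
  rw [extendWeight, dif_pos s.2]

theorem extendWeight_nonneg (G : SimpleGraph (Fin (n + 1))) (a : edgePairs G → ℕ) :
    0 ≤ extendWeight G a := by
  intro p
  unfold extendWeight
  split_ifs
  · exact Nat.cast_nonneg _
  · exact le_rfl

theorem supportedOn_extendWeight (G : SimpleGraph (Fin (n + 1))) (a : edgePairs G → ℕ) :
    SupportedOn (extendWeight G a) G := by
  intro p hp
  rw [← mem_edgePairs]
  by_contra h
  exact hp (dif_neg h)

theorem famComb_val (G : SimpleGraph (Fin (n + 1))) (a : edgePairs G → ℕ) :
    famComb (fun s : edgePairs G => s.1) a = comb (extendWeight G a) := by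
  rw [comb_apply, famComb, ← Finset.sum_subset (Finset.subset_univ (edgePairs G))]
  · rw [← Finset.sum_coe_sort (edgePairs G)]
    exact Finset.sum_congr rfl fun s _ => by rw [extendWeight_apply]
  · intro p _ hp
    rw [extendWeight, dif_neg hp, zero_smul]

theorem famComb_val_injective {G : SimpleGraph (Fin (n + 1))} (hG : G.IsAcyclic) :
    Function.Injective (famComb fun s : edgePairs G => s.1) := by
  intro a b hab
  rw [famComb_val, famComb_val] at hab
  have h := congrArg (edgeCoeff G) hab
  rw [edgeCoeff_comb hG (supportedOn_extendWeight G a),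
    edgeCoeff_comb hG (supportedOn_extendWeight G b)] at h
  funext s
  have h1 := congrFun h s.1
  rw [extendWeight_apply, extendWeight_apply] at h1
  exact_mod_cast h1

theorem exists_int_famComb {ι : Type*} [Fintype ι] (e : ι → Fin (n + 1) × Fin (n + 1))
    (a : ι → ℕ) (v : Fin (n + 1)) : ∃ z : ℤ, famComb e a v = z := by
  refine ⟨∑ s, (a s : ℤ) * ((if v = (e s).1 then 1 else 0) - if v = (e s).2 then 1 else 0), ?_⟩
  simp only [famComb, Finset.sum_apply, Pi.smul_apply, root_apply, smul_eq_mul]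
  push_cast
  rfl

/-- The integer points of the cone of `G` in the interior directions prescribed by `Z`. -/
theorem image_weights {G : SimpleGraph (Fin (n + 1))} (hG : G.IsAcyclic)
    (Z : Finset (edgePairs G)) (N : ℕ) :
    famComb (fun s : edgePairs G => s.1) '' weights (fun s : edgePairs G => s.1) Z N =
      {x | x ∈ cone G ∧ (∀ s ∈ Z, 0 < edgeCoeff G x s.1) ∧ height x ≤ N ∧
        ∀ v, ∃ z : ℤ, x v = z} := by
  ext x
  constructor
  · rintro ⟨a, ⟨h1, h2⟩, rfl⟩
    refine ⟨?_, fun s hs => ?_, h2, exists_int_famComb _ a⟩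
    · rw [famComb_val]
      exact comb_mem_cone (extendWeight_nonneg G a) (supportedOn_extendWeight G a)
    · rw [famComb_val, edgeCoeff_comb hG (supportedOn_extendWeight G a), extendWeight_apply]
      exact_mod_cast h1 s hs
  · rintro ⟨h1, h2, h3, h4⟩
    have h5 := edgeCoeff_nonneg hG h1
    have h6 : ∀ s : edgePairs G, ∃ k : ℕ, edgeCoeff G x s.1 = k := by
      intro s
      obtain ⟨z, hz⟩ := exists_int_edgeCoeff (G := G) h4 s.1
      have : 0 ≤ z := by
        have : (0 : ℝ) ≤ edgeCoeff G x s.1 := h5 s.1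
        rw [hz] at this
        exact_mod_cast this
      lift z to ℕ using this
      exact ⟨z, by simpa using hz⟩
    choose a ha using h6
    have h7 : extendWeight G a = edgeCoeff G x := by
      funext p
      by_cases hp : p ∈ edgePairs G
      · rw [ha ⟨p, hp⟩, ← extendWeight_apply]
      · rw [extendWeight, dif_neg hp]
        by_contra h
        exact hp (mem_edgePairs.2 (supportedOn_edgeCoeff G x p (Ne.symm h)))
    have h8 : famComb (fun s : edgePairs G => s.1) a = x := by
      obtain ⟨d, _, hd, rfl⟩ := mem_cone_iff.1 h1
      rw [famComb_val, h7, edgeCoeff_comb hG hd]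
    refine ⟨a, ⟨fun s hs => ?_, by rwa [h8]⟩, h8⟩
    have := h2 s hs
    rw [ha] at this
    exact_mod_cast this

theorem ncard_weights_univ {F : SimpleGraph (Fin (n + 1))} (hF : IsAlternating F) (N : ℕ) :
    (weights (fun s : edgePairs F => s.1) univ N).Finite ∧
      (weights (fun s : edgePairs F => s.1) univ N).ncard = N.choose F.edgeSet.ncard := by
  classical
  have := ncard_weights_of_alternating (e := fun s : edgePairs F => s.1)
    (fun s => (mem_edgePairs.1 s.2).1) (fun s t hst => ?_) univ N
  · rwa [Finset.card_univ, Fintype.card_coe, card_edgePairs, Nat.add_sub_cancel] at this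
  · have h1 := mem_edgePairs.1 s.2
    have h2 := mem_edgePairs.1 t.2
    rw [← hst] at h2
    exact hF _ _ _ h1.1 h2.1 ⟨h1.2, h2.2⟩

/-- The integer points of the interior of the cone of `T`, according to their canonical forest. -/
theorem image_weights_univ {T : SimpleGraph (Fin (n + 1))} (hn : 1 ≤ n) (hT : T.IsTree)
    (hnc : IsNoncrossing T) (N : ℕ) :
    famComb (fun s : edgePairs T => s.1) '' weights (fun s : edgePairs T => s.1) univ N =
      ⋃ F ∈ canonicalForests T,
        famComb (fun s : edgePairs F => s.1) '' weights (fun s : edgePairs F => s.1) univ N := by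
  rw [image_weights hT.isAcyclic]
  ext x
  simp only [Set.mem_iUnion, exists_prop]
  constructor
  · rintro ⟨h1, h2, h3, h4⟩
    have hx : x ∈ cone (transClosure T) := by rwa [cone_transClosure]
    obtain ⟨h5, h6, h7, h8⟩ := ncWeight_of_mem_cone (isUncrossable_transClosure hnc) hx
    have h9 : x ∈ cone (supportGraph (ncWeight x)) := by
      have := comb_mem_cone h5 h6.supportGraph
      rwa [h7] at this
    refine ⟨supportGraph (ncWeight x), mem_canonicalForests_of_mem_cone hn hT hnc
      (supportGraph_le h6) h8 h9 fun p hp hpT => h2 ⟨p, mem_edgePairs.2 ⟨hp, hpT⟩⟩ (mem_univ _), ?_⟩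
    rw [image_weights (isAcyclic_of_isNCAlt h8)]
    refine ⟨h9, fun s _ => ?_, h3, h4⟩
    rw [← ncWeight_eq_edgeCoeff h8 h9]
    have h10 := mem_edgePairs.1 s.2
    rw [supportGraph_adj_of_lt h10.1] at h10
    exact lt_of_le_of_ne (h5 s.1) (Ne.symm h10.2)
  · rintro ⟨F, hF, hx⟩
    have hFn := isNCAlt_of_mem_canonicalForests hF
    rw [image_weights (isAcyclic_of_isNCAlt hFn)] at hx
    obtain ⟨h1, h2, h3, h4⟩ := hx
    obtain ⟨d, h5, h6, rfl⟩ := mem_cone_iff.1 h1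
    rw [edgeCoeff_comb (isAcyclic_of_isNCAlt hFn) h6] at h2
    refine ⟨?_, fun s _ => ?_, h3, h4⟩
    · rw [← cone_transClosure]
      exact cone_mono hF.1 h1
    · have h7 := mem_edgePairs.1 s.2
      exact edgeCoeff_pos_of_mem_canonicalForests hn hT hnc hF h5 h6
        (fun p hp hpF => (h2 ⟨p, mem_edgePairs.2 ⟨hp, hpF⟩⟩ (mem_univ _)).ne') h7.1 h7.2

theorem eq_of_mem_image_weights_univ {F F' : SimpleGraph (Fin (n + 1))} (hF : IsNCAlt F)
    (hF' : IsNCAlt F') {N : ℕ} {x : Fin (n + 1) → ℝ}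
    (hx : x ∈ famComb (fun s : edgePairs F => s.1) '' weights (fun s : edgePairs F => s.1) univ N)
    (hx' : x ∈ famComb (fun s : edgePairs F' => s.1) ''
      weights (fun s : edgePairs F' => s.1) univ N) : F = F' := by
  rw [image_weights (isAcyclic_of_isNCAlt hF)] at hx
  rw [image_weights (isAcyclic_of_isNCAlt hF')] at hx'
  have key : ∀ {A B : SimpleGraph (Fin (n + 1))}, IsNCAlt A → IsNCAlt B → x ∈ cone A → x ∈ cone B →
      (∀ s ∈ (univ : Finset (edgePairs A)), 0 < edgeCoeff A x s.1) → A ≤ B := by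
    intro A B hA hB h1 h2 h3
    rw [SimpleGraph_le_iff_lt]
    intro i j hij h
    have h4 := h3 ⟨(i, j), mem_edgePairs.2 ⟨hij, h⟩⟩ (mem_univ _)
    rw [← ncWeight_eq_edgeCoeff hA h1, ncWeight_eq_edgeCoeff hB h2] at h4
    exact (supportedOn_edgeCoeff B x (i, j) h4.ne').2
  exact le_antisymm (key hF hF' hx.1 hx'.1 hx.2.1) (key hF' hF hx'.1 hx.1 hx'.2.1)

theorem ncard_edgeSet_le_of_mem_canonicalForests {T F : SimpleGraph (Fin (n + 1))} (hT : T.IsTree)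
    (hnc : IsNoncrossing T) (hF : F ∈ canonicalForests T) : F.edgeSet.ncard ≤ n := by
  obtain ⟨S, hS, hle⟩ := exists_ncAltTree_ge hT hnc hF.1 (isNCAlt_of_mem_canonicalForests hF)
  exact (Set.ncard_le_ncard (SimpleGraph.edgeSet_mono hle) (Set.toFinite _)).trans_eq
    (ncard_edgeSet_of_isTree hS.2.1)

/-- Interior integer points of `cone T` are sorted by the support of `ncWeight`, a canonical forest.
A forest with `i` edges contributes the strictly positive weights of total at most `N`, which number
`N.choose i`. -/
theorem ncard_weights_univ_of_isTree {T : SimpleGraph (Fin (n + 1))} (hn : 1 ≤ n) (hT : T.IsTree)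
    (hnc : IsNoncrossing T) (N : ℕ) :
    (weights (fun s : edgePairs T => s.1) univ N).ncard =
      ∑ i ∈ range (n + 1), numForests T i * N.choose i := by
  classical
  have hfin : (canonicalForests T).Finite := Set.toFinite _
  rw [← Set.ncard_image_of_injective _ (famComb_val_injective hT.isAcyclic),
    image_weights_univ hn hT hnc]
  have hbU : (⋃ F ∈ canonicalForests T, famComb (fun s : edgePairs F => s.1) ''
      weights (fun s : edgePairs F => s.1) univ N).ncard =
      ∑ F ∈ hfin.toFinset, N.choose F.edgeSet.ncard := by
    have h0 := fun F (hF : F ∈ hfin.toFinset) =>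
      isNCAlt_of_mem_canonicalForests (hfin.mem_toFinset.1 hF)
    have h1 : ∀ F ∈ hfin.toFinset, (famComb (fun s : edgePairs F => s.1) ''
        weights (fun s : edgePairs F => s.1) univ N).ncard = N.choose F.edgeSet.ncard := by
      intro F hF
      rw [Set.ncard_image_of_injective _ (famComb_val_injective (isAcyclic_of_isNCAlt (h0 F hF))),
        (ncard_weights_univ (h0 F hF).2 N).2]
    rw [← Finset.sum_congr rfl h1]
    have h2 : ∀ F ∈ hfin.toFinset, (famComb (fun s : edgePairs F => s.1) ''
        weights (fun s : edgePairs F => s.1) univ N).Finite := fun F hF =>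
      (ncard_weights_univ (h0 F hF).2 N).1.image _
    have h3 : (hfin.toFinset : Set (SimpleGraph (Fin (n + 1)))).PairwiseDisjoint fun F =>
        famComb (fun s : edgePairs F => s.1) '' weights (fun s : edgePairs F => s.1) univ N := by
      intro F hF F' hF' hne
      refine Set.disjoint_left.2 fun x hx hx' => hne ?_
      exact eq_of_mem_image_weights_univ (h0 F hF) (h0 F' hF') hx hx'
    have h4 : (⋃ F ∈ canonicalForests T, famComb (fun s : edgePairs F => s.1) ''
        weights (fun s : edgePairs F => s.1) univ N) =
        ⋃ F ∈ hfin.toFinset, famComb (fun s : edgePairs F => s.1) ''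
          weights (fun s : edgePairs F => s.1) univ N := by
      simp only [Set.Finite.mem_toFinset]
    rw [h4]
    -- Only finiteness and disjointness are kept, so that the induction runs over arbitrary finite
    -- families.
    generalize hg : hfin.toFinset = 𝒯 at h2 h3 ⊢
    clear h0 h1 h4 hg
    induction 𝒯 using Finset.induction_on with
    | empty => simp
    | insert F 𝒯 hF ih =>
      have hfinU : (⋃ F ∈ 𝒯, famComb (fun s : edgePairs F => s.1) ''
          weights (fun s : edgePairs F => s.1) univ N).Finite :=
        Set.Finite.biUnion 𝒯.finite_toSet fun F' hF' => h2 F' (Finset.mem_insert_of_mem hF')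
      rw [Finset.sum_insert hF, Finset.set_biUnion_insert, Set.ncard_union_eq ?_
        (h2 F (Finset.mem_insert_self _ _)) hfinU, ih]
      · exact fun F' hF' => h2 F' (Finset.mem_insert_of_mem hF')
      · exact h3.subset (Finset.coe_subset.2 (Finset.subset_insert _ _))
      · refine Set.disjoint_iUnion₂_right.2 fun F' hF' => ?_
        exact h3 (Finset.mem_coe.2 (Finset.mem_insert_self _ _))
          (Finset.mem_coe.2 (Finset.mem_insert_of_mem hF')) (fun h => hF (h ▸ hF'))
  rw [hbU, ← Finset.sum_fiberwise_of_maps_to (s := hfin.toFinset) (t := range (n + 1))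
    (g := fun F => F.edgeSet.ncard)]
  · refine Finset.sum_congr rfl fun i _ => ?_
    rw [Finset.sum_congr rfl (g := fun _ => N.choose i), Finset.sum_const, smul_eq_mul, numForests]
    · congr 1
      rw [← Set.ncard_coe_finset]
      congr 1
      ext F
      simp
    · intro F hF
      rw [(Finset.mem_filter.1 hF).2]
  · intro F hF
    rw [Finset.mem_range, Nat.lt_succ_iff]
    exact ncard_edgeSet_le_of_mem_canonicalForests hT hnc (hfin.mem_toFinset.1 hF)

/-- Reciprocity is applied with `Z = ∅`: the closed cone gives the lattice points of the dilates,
and the complement `univ` gives the interior points, already counted by canonical forests. -/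
theorem ehrhart_polytope {T : SimpleGraph (Fin (n + 1))} (hn : 1 ≤ n) (hT : T.IsTree)
    (hnc : IsNoncrossing T) (t : ℕ) : (latticePoints (polytope T) t).Finite ∧
      ((latticePoints (polytope T) t).ncard : ℤ) =
        (-1) ^ n * ∑ i ∈ range (n + 1),
          (-1) ^ i * (numForests T i : ℤ) * ((t + i).choose i : ℤ) := by
  classical
  have hcard : Fintype.card (edgePairs T) = n := by
    rw [Fintype.card_coe, card_edgePairs, ncard_edgeSet_of_isTree hT]
  obtain ⟨H, hH, h⟩ := exists_weights_reciprocity _ (fun s : edgePairs T => s.1)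
    (fun s => (mem_edgePairs.1 s.2).1) rfl ∅
  rw [hcard] at hH h
  rw [Finset.compl_empty] at h
  have hpts : latticePoints (polytope T) t = famComb (fun s : edgePairs T => s.1) ''
      weights (fun s : edgePairs T => s.1) ∅ t := by
    rw [image_weights hT.isAcyclic]
    ext x
    simp [mem_latticePoints_polytope]
  rw [hpts]
  refine ⟨(h t).1.1.image _, ?_⟩
  rw [Set.ncard_image_of_injective _ (famComb_val_injective hT.isAcyclic), (h t).1.2]
  exact sum_choose_reciprocity hH (fun N => by
    rw [← (h N).2.2, ncard_weights_univ_of_isTree hn hT hnc]) t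

end RootPolytope

theorem theorem1 (n : ℕ) (hn : 1 ≤ n) (T : SimpleGraph (Fin (n + 1)))
    (hT : T.IsTree) (hnc : RootPolytope.IsNoncrossing T) :
    -- the simplices, their interiors and their union
    (∀ S ∈ RootPolytope.ncAltTrees T, RootPolytope.IsSimplex n (RootPolytope.polytope S)) ∧
    (∀ S ∈ RootPolytope.ncAltTrees T, ∀ S' ∈ RootPolytope.ncAltTrees T, S ≠ S' →
      Disjoint (intrinsicInterior ℝ (RootPolytope.polytope S))
        (intrinsicInterior ℝ (RootPolytope.polytope S'))) ∧
    (⋃ S ∈ RootPolytope.ncAltTrees T, RootPolytope.polytope S) = RootPolytope.polytope T ∧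
    -- they form a central triangulation: the origin is a vertex of each of them, all their
    -- vertices are vertices of the polytope, and they intersect in common faces
    (∀ S ∈ RootPolytope.ncAltTrees T,
      (0 : Fin (n + 1) → ℝ) ∈ (RootPolytope.polytope S).extremePoints ℝ ∧
      (RootPolytope.polytope S).extremePoints ℝ ⊆ (RootPolytope.polytope T).extremePoints ℝ) ∧
    (∀ 𝒮 ⊆ RootPolytope.ncAltTrees T, 𝒮.Nonempty →
      (⋂ S ∈ 𝒮, RootPolytope.polytope S) = RootPolytope.polytope (sInf 𝒮) ∧
      ∀ S ∈ 𝒮, IsExposed ℝ (RootPolytope.polytope S) (⋂ S' ∈ 𝒮, RootPolytope.polytope S')) ∧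
    -- the intersections that meet the interior of the polytope
    (∀ F ∈ RootPolytope.canonicalForests T,
      RootPolytope.IsSimplex F.edgeSet.ncard (RootPolytope.polytope F)) ∧
    {I : Set (Fin (n + 1) → ℝ) | ∃ 𝒮 ⊆ RootPolytope.ncAltTrees T, 𝒮.Nonempty ∧
        I = (⋂ S ∈ 𝒮, RootPolytope.polytope S) ∧
        (I ∩ intrinsicInterior ℝ (RootPolytope.polytope T)).Nonempty} =
      RootPolytope.polytope '' RootPolytope.canonicalForests T ∧
    -- the volume
    RootPolytope.relVolume (RootPolytope.polytope T) =
      ((RootPolytope.ncAltTrees T).ncard : ENNReal) / (n.factorial : ENNReal) ∧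
    RootPolytope.relVolume (RootPolytope.polytope T) =
      (RootPolytope.numForests T n : ENNReal) / (n.factorial : ENNReal) ∧
    -- the Ehrhart polynomial
    (∀ t : ℕ, (RootPolytope.latticePoints (RootPolytope.polytope T) t).Finite ∧
      ((RootPolytope.latticePoints (RootPolytope.polytope T) t).ncard : ℤ) =
        (-1) ^ n * ∑ i ∈ Finset.range (n + 1),
          (-1) ^ i * (RootPolytope.numForests T i : ℤ) * ((t + i).choose i : ℤ)) := by
  refine ⟨fun S hS => ?_, fun S hS S' hS' hne => ?_, RootPolytope.iUnion_polytope hT hnc,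
    fun S hS => ⟨RootPolytope.zero_mem_extremePoints S,
      RootPolytope.extremePoints_polytope_subset hS⟩, fun 𝒮 h𝒮 hne => ?_, fun F hF => ?_,
    RootPolytope.interior_faces hn hT hnc, RootPolytope.relVolume_polytope hn hT hnc, ?_,
    RootPolytope.ehrhart_polytope hn hT hnc⟩
  · have h := RootPolytope.isSimplex_polytope hS.2.1.isAcyclic hS.2.2.2
    rwa [RootPolytope.ncard_edgeSet_of_isTree hS.2.1] at h
  · exact RootPolytope.disjoint_intrinsicInterior_polytope hS.2.2 hS'.2.2 hne
  · have h := RootPolytope.iInter_polytope h𝒮 hne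
    refine ⟨h, fun S hS => ?_⟩
    rw [h]
    exact RootPolytope.isExposed_polytope (h𝒮 hS).2.1.isAcyclic (sInf_le hS)
  · exact RootPolytope.isSimplex_polytope hF.2.1 hF.2.2.2.1
  · rw [RootPolytope.numForests_top hn hT hnc]
    exact RootPolytope.relVolume_polytope hn hT hnc
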